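/- Let $K$ be a saturated algebraically closed field of characteristic $0$ (that is, every set of first-order formulas in one variable in the language of rings, with parameters in a set $A\subset K$ with $|A|<|K|$, that is finitely satisfiable in $K$ is realised in $K$). Then there are a function $E:K\to K^\times$ and a field automorphism $\sigma$ of $K$ of order two with $\sigma\circ E=E\circ\sigma$ such that the following hold. * (E) $E(x+y)=E(x)E(y)$ for all $x,y\in K$. * (LOG) $E:K\to K^\times$ is surjective. * (STD) $\ker E=\omega\mathbb{Z}$ for some $\omega\in K^\times$. * (SP) If $z_1,\dots,z_n\in K$ are $\mathbb{Q}$-linearly independent, then $\operatorname{tr.deg.}_{\mathbb{Q}}(z_1,\dots,z_n,E(z_1),\dots,E(z_n))\ge n$. * (CCP) For every $n\ge 1$, every absolutely free rotund variety $V\subset\mathbb{G}^n$ over $K$ with $\dim V=n$, and every finite tuple $\bar c$ of elements of $K$ such that $V$ is defined over $\bar c$, the set of $\bar z\in K^n$ such that $(\bar z,E(\bar z)):=((z_1,E(z_1)),\dots,(z_n,E(z_n)))\in V$ and $\operatorname{tr.deg.}_{\mathbb{Q}(\bar c,E(\bar c))}(\bar z,E(\bar z))=\dim V$ is at most countable.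 Moreover, $E$ is continuous with respect to the topology induced by $\sigma$, i.e. the product topology on $K=K^\sigma(i)\cong K^\sigma\times K^\sigma$, where $i^2=-1$ and the fixed field $K^\sigma$, which is real closed, carries its order topology. Here $\mathbb{G}=\mathbb{G}_a\times\mathbb{G}_m$, an integer matrix $M=(m_{i,j})\in\mathcal{M}_{k,n}(\mathbb{Z})$ acts by $M\cdot(z_j,w_j)_j=\bigl(\sum_j m_{i,j}z_j,\prod_j w_j^{m_{i,j}}\bigr)_i$ from $\mathbb{G}^n$ to $\mathbb{G}^k$, and $\pi_a,\pi_m$ are the projections of $\mathbb{G}$ to its two factors. A subvariety $V\subset\mathbb{G}^n$ that is defined and irreducible over some subfield of $K$ is *rotund* if $\dim M\cdot V\ge\operatorname{rank}M$ for all $M\in\mathcal{M}_{n,n}(\mathbb{Z})$, and *absolutely free* if $\dim\pi_a(M\cdot V)=\dim\pi_m(M\cdot V)=1$ for all non-zero $M\in\mathcal{M}_{1,n}(\mathbb{Z})$. -/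

import Mathlib

open scoped Cardinal Topology

/-! ## Saturated structures -/

/-- A structure `M` is saturated if, for every parameter set `A ⊆ M` with `|A| < |M|`, every set of
formulas in one free variable with parameters in `A` that is finitely satisfiable in `M` is
realized in `M`. -/
def FirstOrder.Language.IsSaturated (L : FirstOrder.Language.{0, 0}) (M : Type*)
    [L.Structure M] : Prop :=
  ∀ A : Set M, #A < #M → ∀ p : Set ((L.withConstants A).Formula Unit),
    (∀ q : Finset ((L.withConstants A).Formula Unit), (q : Set _) ⊆ p →
      ∃ x : M, ∀ φ ∈ q, φ.Realize (fun _ => x)) →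
    ∃ x : M, ∀ φ ∈ p, φ.Realize (fun _ => x)

/-- A field is saturated if it is so as a structure in the language of rings. -/
def IsSaturatedField (K : Type*) [Field K] : Prop :=
  letI := FirstOrder.Ring.compatibleRingOfRing K
  FirstOrder.Language.IsSaturated FirstOrder.Language.ring K

namespace ExpField

noncomputable section

/-- The transcendence degree over `k` of the field generated over `k` by a subset of `K`. -/
def trdegOver {K : Type*} [Field K] (k : Subfield K) (S : Set K) : Cardinal :=
  Algebra.trdeg k (IntermediateField.adjoin k S)

/-- The dimension of (the Zariski closure of) a set of points of affine space: the maximal number of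
algebraically independent functions in its coordinate ring. -/
def dimAffine {K ι : Type*} [Field K] (S : Set (ι → K)) : Cardinal :=
  Algebra.trdeg K (MvPolynomial ι K ⧸ MvPolynomial.vanishingIdeal K S)

/-! ## The group `𝔾ⁿ = (𝔾ₐ × 𝔾ₘ)ⁿ` and its subvarieties -/

/-- The `K`-points of `𝔾ⁿ`. -/
abbrev GPoint (K : Type*) [Field K] (n : ℕ) : Type _ := Fin n → K × Kˣ

/-- The inclusion of `𝔾ⁿ` in the affine space of dimension `2n`. -/
def coords {K : Type*} [Field K] {n : ℕ} (p : GPoint K n) : Fin n ⊕ Fin n → K :=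
  Sum.elim (fun j => (p j).1) (fun j => ((p j).2 : K))

/-- The action of integer matrices,
`M · (z_j, w_j)_j = (∑ j, m_{i,j} z_j, ∏ j, w_j ^ m_{i,j})_i`. -/
def matAct {K : Type*} [Field K] {k n : ℕ} (M : Matrix (Fin k) (Fin n) ℤ) (p : GPoint K n) :
    GPoint K k :=
  fun i => (∑ j, (M i j : K) * (p j).1, ∏ j, (p j).2 ^ M i j)

/-- The projection to the additive factors. -/
def projA {K : Type*} [Field K] {n : ℕ} (p : GPoint K n) : Fin n → K := fun j => (p j).1

/-- The projection to the multiplicative factors. -/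
def projM {K : Type*} [Field K] {n : ℕ} (p : GPoint K n) : Fin n → K := fun j => ((p j).2 : K)

/-- The dimension of a subset of `𝔾ⁿ`. -/
def dimG {K : Type*} [Field K] {n : ℕ} (S : Set (GPoint K n)) : Cardinal :=
  dimAffine (coords '' S)

/-- `V` is the set of common zeros in `𝔾ⁿ` of some polynomials with coefficients in `k`. -/
def DefinedOver {K : Type*} [Field K] {n : ℕ} (k : Subfield K) (V : Set (GPoint K n)) : Prop :=
  ∃ S : Set (MvPolynomial (Fin n ⊕ Fin n) k),
    V = {p | ∀ f ∈ S, MvPolynomial.aeval (coords p) f = 0}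

/-- `V` is defined over `k`, non-empty, and not the union of two proper subvarieties that are
defined over `k`. -/
def IrreducibleOver {K : Type*} [Field K] {n : ℕ} (k : Subfield K) (V : Set (GPoint K n)) : Prop :=
  DefinedOver k V ∧ V.Nonempty ∧
    ∀ V₁ V₂ : Set (GPoint K n), DefinedOver k V₁ → DefinedOver k V₂ → V = V₁ ∪ V₂ →
      V = V₁ ∨ V = V₂

/-- Irreducible subvarieties of `𝔾ⁿ`. The base field of irreducibility is not specified, so that
`V` need not be absolutely irreducible; taking `k = ⊤` gives those irreducible over `K`. -/
def IsIrreducibleVariety {K : Type*} [Field K] {n : ℕ} (V : Set (GPoint K n)) : Prop :=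
  ∃ k : Subfield K, IrreducibleOver k V

def IsRotund {K : Type*} [Field K] {n : ℕ} (V : Set (GPoint K n)) : Prop :=
  IsIrreducibleVariety V ∧
    ∀ M : Matrix (Fin n) (Fin n) ℤ, (M.rank : Cardinal) ≤ dimG (matAct M '' V)

def IsAbsolutelyFree {K : Type*} [Field K] {n : ℕ} (V : Set (GPoint K n)) : Prop :=
  IsIrreducibleVariety V ∧
    ∀ M : Matrix (Fin 1) (Fin n) ℤ, M ≠ 0 →
      dimAffine (projA '' (matAct M '' V)) = 1 ∧ dimAffine (projM '' (matAct M '' V)) = 1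

/-! ## The axioms -/

/-- The point `((z₁, E z₁), …, (zₙ, E zₙ))` of `𝔾ⁿ`. -/
def graphPoint {K : Type*} [Field K] {n : ℕ} (E : K → Kˣ) (z : Fin n → K) : GPoint K n :=
  fun j => (z j, E (z j))

/-- The set consisting of the entries of a tuple and of their images under `E`. -/
def withExp {K : Type*} [Field K] {n : ℕ} (E : K → Kˣ) (z : Fin n → K) : Set K :=
  Set.range z ∪ Set.range (fun j => (E (z j) : K))

/-- `z` is a generic solution of `V(c)`: the point `(z, E z)` is in `V`, and its transcendence degree
over the field generated by `c` and `E c` is `dim V`. -/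
def IsGenericSolution {K : Type*} [Field K] {n m : ℕ} (E : K → Kˣ) (V : Set (GPoint K n))
    (c : Fin m → K) (z : Fin n → K) : Prop :=
  graphPoint E z ∈ V ∧ trdegOver (Subfield.closure (withExp E c)) (withExp E z) = dimG V

/-- (E): `E` is a homomorphism from the additive to the multiplicative group. -/
def AxE {K : Type*} [Field K] (E : K → Kˣ) : Prop :=
  ∀ x y : K, E (x + y) = E x * E y

/-- (LOG): every non-zero element has a logarithm. -/
def AxLOG {K : Type*} [Field K] (E : K → Kˣ) : Prop :=
  Function.Surjective E

/-- (STD): the kernel is `ωℤ` for some non-zero `ω`. -/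
def AxSTD {K : Type*} [Field K] (E : K → Kˣ) : Prop :=
  ∃ ω : K, ω ≠ 0 ∧ {x : K | E x = 1} = {x : K | ∃ m : ℤ, x = ω * m}

/-- (SP), Schanuel's Property; `⊥` is the prime field, a copy of `ℚ`. -/
def AxSP {K : Type*} [Field K] [CharZero K] (E : K → Kˣ) : Prop :=
  ∀ (n : ℕ) (z : Fin n → K), LinearIndependent ℚ z →
    (n : Cardinal) ≤ trdegOver (⊥ : Subfield K) (withExp E z)

/-- (CCP), the Countable Closure Property. -/
def AxCCP {K : Type*} [Field K] (E : K → Kˣ) : Prop :=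
  ∀ (n : ℕ), 0 < n → ∀ V : Set (GPoint K n), IsAbsolutelyFree V → IsRotund V → dimG V = n →
    ∀ (m : ℕ) (c : Fin m → K), DefinedOver (Subfield.closure (Set.range c)) V →
      {z : Fin n → K | IsGenericSolution E V c z}.Countable

/-! ## Involutions -/

/-- A field automorphism of order two. -/
def IsInvolution {K : Type*} [Field K] (σ : K ≃+* K) : Prop :=
  orderOf (σ : RingAut K) = 2

/-- The fixed field `K^σ`. -/
def fixedField {K : Type*} [Field K] (σ : K ≃+* K) : Subfield K :=
  RingHom.eqLocusField (σ : K →+* K) (RingHom.id K)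

/-- The order of `K^σ`. For an involution `σ` of an algebraically closed field, `K^σ` is real closed,
and `x < y` means that `y - x` is a non-zero square in `K^σ`. -/
def fixedLT {K : Type*} [Field K] (σ : K ≃+* K) (x y : fixedField σ) : Prop :=
  ∃ t : fixedField σ, t ≠ 0 ∧ y - x = t ^ 2

/-- The order topology of `K^σ`, generated by the open rays. -/
@[reducible] def fixedTopology {K : Type*} [Field K] (σ : K ≃+* K) : TopologicalSpace (fixedField σ) :=
  TopologicalSpace.generateFrom
    {s | ∃ a : fixedField σ, s = {x | fixedLT σ a x} ∨ s = {x | fixedLT σ x a}}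

/-- The topology on `K` induced by `σ`: given a square root `i` of `-1`, it is the product topology
of `K^σ × K^σ` carried over to `K = K^σ(i)` by the bijection `(x, y) ↦ x + i y`. -/
@[reducible] def involutionTopology {K : Type*} [Field K] (σ : K ≃+* K) (i : K) : TopologicalSpace K :=
  TopologicalSpace.coinduced (fun p : fixedField σ × fixedField σ => (p.1 : K) + i * (p.2 : K))
    (@instTopologicalSpaceProd _ _ (fixedTopology σ) (fixedTopology σ))

end

end ExpField

/-! The field `K` is realised inside the nonstandard complex numbers `Ω`, which carry an exponential
and a conjugation, and `E` becomes `exp ∘ φ` for a ℚ-linear map `φ : K → Ω`. The work lies in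
choosing the copy of `K` and the map `φ` so that the algebra is triangular and small elements stay
small.

Saturation gives `K` a transcendence basis of size `|K|`. Let `Ω` be an ultrapower of `ℂ` in which
any `|K|` non-zero elements have norms above a common positive hyperreal. Along a well-ordering
divided into `ω` levels, choose positive `u γ` below the norm of every non-zero element algebraic
over the earlier generators, and let the generator `θ γ` be `1/u γ`, `exp (u γ)` or `exp (i u γ)`.
The generators are algebraically independent (`θ_notMem`), and `K` is identified with the algebraic
closure of all of them. This closure is the union of stages `F n`, the algebraic closures of the
generators of level below `n`, each stable under conjugation.

`exists_dual_bases` produces a ℚ-basis `A` of this copy of `K` and a family `M` of logarithms in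
`Ω`, and `φ` sends `A d` to `M d`. Each `d` owns a generator `θ (rho d)`: either `A d` is that
generator up to a factor `1` or `i`, and `exp (M d)` is algebraic over earlier generators; or `exp
(M d)` is the generator and `A d` is algebraic over earlier ones. Since `A d` and `M d` are both
real or both imaginary, `E` commutes with conjugation. The kernel of the nonstandard exponential is
too large; its elements outside the standard periods are absorbed by a complement `Z` of `ℚ · 2πi`
in the logarithms of roots of unity. Independence of `M` modulo `Z` gives (STD), and the fact that
`M` and `Z` together span all logarithms gives (LOG).

For (SP), consider the largest generator owned by a basis vector occurring in a finite-dimensional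
space. For a vector `v` involving it, exactly one of `v`, `E v` is new, and the vectors not
involving it form a hyperplane; induction gives one degree per dimension (`finrank_le_trdegOver`).
For (CCP), every finite tuple lies in a countable closed part of the construction. Over such a part
the first vector outside contributes two degrees (`finrank_add_one_le_trdegOver`), while rotundity
bounds from below the degree of the part of a generic solution that lies inside. A solution outside
would have transcendence degree at least `n + 1`.

For continuity, infinite generators cannot occur in infinitesimal elements. Hence an element small
relative to `F m` is a combination of those `A d` whose `M d` is small relative to `F m`, so `φ`
preserves smallness, and `exp` of a small element is close to `1`. -/

namespace ExpField

/-! ### Relative algebraic closure and transcendence degree -/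

section Closure

variable {K : Type*} [Field K]

/-- The relative algebraic closure in `K` of the subfield generated by a set. -/
noncomputable def acl (S : Set K) : Subfield K :=
  (algebraicClosure (Subfield.closure S) K).toSubfield

theorem mem_acl {S : Set K} {x : K} : x ∈ acl S ↔ IsAlgebraic (Subfield.closure S) x :=
  mem_algebraicClosure_iff

theorem isAlgebraic_of_le {k k' : Subfield K} (h : k ≤ k') {x : K} (hx : IsAlgebraic k x) :
    IsAlgebraic k' x := by
  let _ : Algebra k k' := (Subfield.inclusion h).toAlgebra
  have : IsScalarTower k k' K := .of_algebraMap_eq fun _ => rfl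
  exact hx.tower_top k'

theorem isAlgebraic_iff_mem_acl {k : Subfield K} {x : K} : IsAlgebraic k x ↔ x ∈ acl (k : Set K) := by
  rw [mem_acl, Subfield.closure_eq]

theorem closure_le_acl (S : Set K) : Subfield.closure S ≤ acl S := fun x hx =>
  mem_acl.2 (isAlgebraic_algebraMap (⟨x, hx⟩ : Subfield.closure S))

theorem subset_acl (S : Set K) : S ⊆ acl S := fun _ hx => closure_le_acl S (Subfield.subset_closure hx)

theorem acl_mono {S T : Set K} (h : S ⊆ T) : acl S ≤ acl T := fun _ hx =>
  mem_acl.2 (isAlgebraic_of_le (Subfield.closure_mono h) (mem_acl.1 hx))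

theorem acl_le {S T : Set K} (h : S ⊆ acl T) : acl S ≤ acl T := by
  intro x hx
  have h1 : IsAlgebraic (acl T) x := isAlgebraic_of_le (Subfield.closure_le.2 h) (mem_acl.1 hx)
  have : Algebra.IsAlgebraic (Subfield.closure T) (algebraicClosure (Subfield.closure T) K) :=
    inferInstance
  have h2 : IsAlgebraic (algebraicClosure (Subfield.closure T) K) x := h1
  exact mem_acl.2 (h2.restrictScalars (Subfield.closure T))

theorem acl_acl (S : Set K) : acl (acl S : Set K) = acl S :=
  le_antisymm (acl_le le_rfl) (subset_acl _)

theorem mem_acl_of_pow_mem {S : Set K} {x : K} {n : ℕ} (hn : 0 < n) (h : x ^ n ∈ acl S) : x ∈ acl S := by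
  have := isAlgebraic_algebraMap (A := K) (⟨_, h⟩ : acl S)
  have h2 : IsAlgebraic (acl S) x := this.of_pow hn
  rw [← acl_acl]
  exact isAlgebraic_iff_mem_acl.1 h2

theorem adjoin_toSubfield (k : Subfield K) (S : Set K) :
    (IntermediateField.adjoin k S).toSubfield = Subfield.closure (k ∪ S) := by
  have : Set.range (algebraMap k K) = k := Subtype.range_coe
  simp [IntermediateField.adjoin, this]

theorem isAlgebraic_adjoin_iff_mem_acl {k : Subfield K} {S : Set K} {x : K} :
    IsAlgebraic (Algebra.adjoin k S) x ↔ x ∈ acl (k ∪ S) := by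
  rw [← IntermediateField.isAlgebraic_adjoin_iff, mem_acl, ← adjoin_toSubfield]
  rfl

/-- The link to the algebraic independence matroid makes bases, ranks, exchange and finitary closure
available for `acl`. -/
theorem matroid_closure_eq (k : Subfield K) (S : Set K) :
    (AlgebraicIndependent.matroid k K).closure S = acl (k ∪ S) := by
  rw [AlgebraicIndependent.matroid_closure_eq]
  ext x
  exact isAlgebraic_adjoin_iff_mem_acl

theorem matroid_bot_closure_eq (S : Set K) :
    (AlgebraicIndependent.matroid (⊥ : Subfield K) K).closure S = acl S := by
  rw [matroid_closure_eq]
  refine congrArg _ (le_antisymm (acl_le ?_) (acl_mono Set.subset_union_right))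
  exact Set.union_subset (fun x hx => closure_le_acl S ((bot_le : ⊥ ≤ Subfield.closure S) hx)) (subset_acl S)

theorem exists_finite_mem_acl {S : Set K} {x : K} (hx : x ∈ acl S) :
    ∃ T ⊆ S, T.Finite ∧ x ∈ acl T := by
  rw [← SetLike.mem_coe, ← matroid_bot_closure_eq] at hx
  obtain ⟨T, hT, hf, _, hx⟩ := Matroid.exists_mem_finite_closure_of_mem_closure hx
  rw [matroid_bot_closure_eq] at hx
  exact ⟨T, hT, hf, hx⟩

theorem exists_isBasis (k : Subfield K) (S : Set K) :
    ∃ s ⊆ S, AlgebraicIndependent k ((↑) : s → K) ∧ S ⊆ acl (k ∪ s) := by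
  obtain ⟨s, hs⟩ := (AlgebraicIndependent.matroid k K).exists_isBasis S
  refine ⟨s, hs.subset, AlgebraicIndependent.matroid_indep_iff.1 hs.indep, ?_⟩
  rw [← matroid_closure_eq]
  exact hs.subset_closure

theorem subset_closure_union (k : Subfield K) (S : Set K) :
    S ⊆ (Subfield.closure ((k : Set K) ∪ S) : Set K) :=
  fun _ hx => Subfield.subset_closure (Or.inr hx)

theorem subset_acl_union (k : Subfield K) (S : Set K) : S ⊆ (acl ((k : Set K) ∪ S) : Set K) :=
  fun _ hx => subset_acl _ (Or.inr hx)

/-- The set `s` is a basis of its own matroid closure, which contains the field generated by `S`. It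
need only lie in that field, not in `S` itself. -/
theorem trdegOver_eq_mk {k : Subfield K} {S s : Set K}
    (hs : AlgebraicIndependent k ((↑) : s → K)) (hsS : s ⊆ Subfield.closure (k ∪ S)) (hS : S ⊆ acl (k ∪ s)) :
    trdegOver k S = #s := by
  have hadj : ((IntermediateField.adjoin k S : IntermediateField k K) : Set K) ⊆ acl (k ∪ s) := by
    intro x hx
    have hx : x ∈ (IntermediateField.adjoin k S).toSubfield := hx
    rw [adjoin_toSubfield] at hx
    exact acl_le (Set.union_subset (Set.subset_union_left.trans (subset_acl _)) hS)
      (closure_le_acl _ hx)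
  have hsI := AlgebraicIndependent.matroid_indep_iff.2 hs
  have hle : ∀ t : Set K, t ⊆ acl (k ∪ s) → AlgebraicIndependent k ((↑) : t → K) → #t ≤ #s := by
    intro t ht hti
    rw [← matroid_closure_eq] at ht
    obtain ⟨J, hJ, htJ⟩ := (AlgebraicIndependent.matroid_indep_iff.2 hti).subset_isBasis_of_subset ht
    rw [hsI.isBasis_closure.cardinalMk_eq hJ]
    exact Cardinal.mk_le_mk_of_subset htJ
  apply le_antisymm
  · refine ciSup_le' fun t => ?_
    have := t.2.map' (f := (IntermediateField.adjoin k S).val) Subtype.val_injective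
    have h2 := this.to_subtype_range
    have h3 := hle _ ?_ h2
    · rwa [Cardinal.mk_range_eq _ this.injective] at h3
    · rintro _ ⟨x, rfl⟩
      exact hadj x.1.2
  · have hmem : ∀ x : s, (x : K) ∈ IntermediateField.adjoin k S := fun x => by
      have := hsS x.2
      rwa [← adjoin_toSubfield] at this
    let f : s → IntermediateField.adjoin k S := fun x => ⟨x, hmem x⟩
    have h : AlgebraicIndependent k f :=
      (AlgHom.algebraicIndependent_iff (IntermediateField.adjoin k S).val Subtype.val_injective).1 hs
    exact h.cardinalMk_le_trdeg

theorem trdegOver_eq_cRk (k : Subfield K) (S : Set K) :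
    trdegOver k S = (AlgebraicIndependent.matroid k K).cRk S := by
  obtain ⟨s, hs⟩ := (AlgebraicIndependent.matroid k K).exists_isBasis S
  have hi : AlgebraicIndependent k ((↑) : s → K) := AlgebraicIndependent.matroid_indep_iff.1 hs.indep
  rw [← hs.cardinalMk_eq_cRk]
  refine trdegOver_eq_mk hi (hs.subset.trans (subset_closure_union _ _)) ?_
  rw [← matroid_closure_eq]
  exact hs.subset_closure

theorem trdegOver_le {k : Subfield K} {S T : Set K} (h : S ⊆ acl (k ∪ T)) :
    trdegOver k S ≤ trdegOver k T := by
  rw [trdegOver_eq_cRk, trdegOver_eq_cRk, ← Matroid.cRk_closure _ T, matroid_closure_eq]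
  exact Matroid.cRk_mono _ h

theorem mk_le_trdegOver {k : Subfield K} {S s : Set K}
    (hs : AlgebraicIndependent k ((↑) : s → K)) (h : s ⊆ acl (k ∪ S)) : #s ≤ trdegOver k S := by
  refine le_of_eq_of_le (trdegOver_eq_mk hs ?_ ?_).symm (trdegOver_le h)
  · exact subset_closure_union _ _
  · exact subset_acl_union _ _

theorem algebraicIndependent_of_le {k k' : Subfield K} (h : k ≤ k') {ι : Type*} {x : ι → K}
    (hx : AlgebraicIndependent k' x) : AlgebraicIndependent k x := by
  let _ : Algebra k k' := (Subfield.inclusion h).toAlgebra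
  have : IsScalarTower k k' K := .of_algebraMap_eq fun _ => rfl
  exact hx.restrictScalars (algebraMap k k').injective

theorem algebraicIndependent_sumElim {k : Subfield K} {ι κ : Type*} {x : ι → K} {y : κ → K} :
    AlgebraicIndependent k (Sum.elim y x) ↔ AlgebraicIndependent k x ∧
      AlgebraicIndependent (Subfield.closure ((k : Set K) ∪ Set.range x)) y := by
  rw [AlgebraicIndependent.sumElim_iff, ← IntermediateField.algebraicIndependent_adjoin_iff,
    ← adjoin_toSubfield]
  rfl

/-- Tower law: a basis of `S` over `k` and a basis of `T` over `k(S)` together form a basis of `S ∪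
T` over `k`. -/
theorem trdegOver_add (k : Subfield K) (S T : Set K) :
    trdegOver k (S ∪ T) = trdegOver k S + trdegOver (Subfield.closure (k ∪ S)) T := by
  obtain ⟨s, hsS, hs, hS⟩ := exists_isBasis k S
  obtain ⟨t, htT, ht, hT⟩ := exists_isBasis (Subfield.closure (k ∪ S)) T
  have hks : Subfield.closure ((k : Set K) ∪ s) ≤ Subfield.closure (k ∪ S) :=
    Subfield.closure_mono (Set.union_subset_union_right _ hsS)
  have hst : AlgebraicIndependent k (Sum.elim ((↑) : t → K) ((↑) : s → K)) := by
    rw [algebraicIndependent_sumElim, Subtype.range_coe]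
    exact ⟨hs, algebraicIndependent_of_le hks ht⟩
  have hr : Set.range (Sum.elim ((↑) : t → K) ((↑) : s → K)) = t ∪ s := by
    rw [Set.Sum.elim_range, Subtype.range_coe, Subtype.range_coe]
  have hkS : (k : Set K) ∪ S ⊆ acl (k ∪ (t ∪ s)) :=
    Set.union_subset (Set.subset_union_left.trans (subset_acl _))
      (hS.trans (acl_mono (Set.union_subset_union_right _ Set.subset_union_right)))
  rw [trdegOver_eq_mk hs (hsS.trans (subset_closure_union _ _)) hS,
    trdegOver_eq_mk ht (htT.trans (subset_closure_union _ _)) hT,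
    trdegOver_eq_mk (s := t ∪ s) (hr ▸ hst.to_subtype_range) ?_ ?_, add_comm, ← hr,
    Cardinal.mk_range_eq _ hst.injective, Cardinal.mk_sum, Cardinal.lift_id, Cardinal.lift_id]
  · exact (Set.union_subset (htT.trans Set.subset_union_right)
      (hsS.trans Set.subset_union_left)).trans (subset_closure_union _ _)
  · refine Set.union_subset (Set.subset_union_right.trans hkS) (hT.trans (acl_le ?_))
    refine Set.union_subset ?_ (Set.subset_union_left.trans (subset_acl_union _ _))
    exact fun x hx => acl_le hkS (closure_le_acl _ hx)

theorem trdegOver_anti {k k' : Subfield K} (h : k ≤ k') (S : Set K) :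
    trdegOver k' S ≤ trdegOver k S := by
  obtain ⟨s, hsS, hs, hS⟩ := exists_isBasis k' S
  rw [trdegOver_eq_mk hs (hsS.trans (subset_closure_union _ _)) hS]
  exact mk_le_trdegOver (algebraicIndependent_of_le h hs)
    (hsS.trans (subset_acl_union _ _))

theorem one_le_trdegOver {k : Subfield K} {S : Set K} {x : K} (hx : x ∈ S) (h : x ∉ acl (k : Set K)) :
    1 ≤ trdegOver k S := by
  rw [Cardinal.one_le_iff_ne_zero]
  intro h0
  have := trdeg_eq_zero_iff.1 h0
  apply h
  rw [← isAlgebraic_iff_mem_acl]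
  exact (this.isAlgebraic (⟨x, IntermediateField.subset_adjoin _ _ hx⟩ :
    IntermediateField.adjoin k S)).algHom (IntermediateField.val _)

end Closure
end ExpField

namespace ExpField

/-! ### Homomorphisms from the additive to the multiplicative group -/

section AxE

variable {K : Type*} [Field K]

/-- An additive-to-multiplicative homomorphism on `K`, as a monoid homomorphism. -/
def AxE.toMonoidHom {E : K → Kˣ} (hE : AxE E) : Multiplicative K →* Kˣ :=
  MonoidHom.mk' (fun x => E x.toAdd) fun x y => hE x.toAdd y.toAdd

theorem AxE.map_zero {E : K → Kˣ} (hE : AxE E) : E 0 = 1 := hE.toMonoidHom.map_one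

theorem AxE.map_neg {E : K → Kˣ} (hE : AxE E) (x : K) : E (-x) = (E x)⁻¹ :=
  hE.toMonoidHom.map_inv (.ofAdd x)

theorem AxE.map_nsmul {E : K → Kˣ} (hE : AxE E) (n : ℕ) (x : K) : E (n * x) = E x ^ n := by
  have := hE.toMonoidHom.map_pow (.ofAdd x) n
  rwa [← ofAdd_nsmul, nsmul_eq_mul] at this

theorem AxE.map_zsmul {E : K → Kˣ} (hE : AxE E) (n : ℤ) (x : K) : E (n * x) = E x ^ n := by
  have := hE.toMonoidHom.map_zpow (.ofAdd x) n
  rwa [← ofAdd_zsmul, zsmul_eq_mul] at this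

theorem AxE.map_sum {E : K → Kˣ} (hE : AxE E) {ι : Type*} (s : Finset ι) (f : ι → K) :
    E (∑ i ∈ s, f i) = ∏ i ∈ s, E (f i) := by
  classical
  induction s using Finset.induction_on with
  | empty => simpa using hE.map_zero
  | insert i s hi ih => rw [Finset.sum_insert hi, Finset.prod_insert hi, hE, ih]

/-- A set together with its exponentials. -/
def addExp (E : K → Kˣ) (V : Set K) : Set K := V ∪ (fun x => (E x : K)) '' V

theorem withExp_eq {n : ℕ} (E : K → Kˣ) (z : Fin n → K) : withExp E z = addExp E (Set.range z) := by
  rw [withExp, addExp, ← Set.range_comp]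
  rfl

theorem addExp_mono {E : K → Kˣ} {V W : Set K} (h : V ⊆ W) : addExp E V ⊆ addExp E W :=
  Set.union_subset_union h (Set.image_mono h)

end AxE

/-! ### Triangular exponentials and Schanuel's Property -/

section Triangular

variable {K : Type*} [Field K] [CharZero K]

/-- `acl S` as a vector space over the rationals. -/
def aclSubmodule (S : Set K) : Submodule ℚ K where
  carrier := acl S
  add_mem' := add_mem
  zero_mem' := zero_mem _
  smul_mem' q x hx := by
    rw [Rat.smul_def]
    exact mul_mem (SubfieldClass.ratCast_mem _ q) hx

theorem mem_aclSubmodule {S : Set K} {x : K} : x ∈ aclSubmodule S ↔ x ∈ acl S := Iff.rfl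

/-- The elements whose exponential is in `acl S`. -/
def logSubmodule {E : K → Kˣ} (hE : AxE E) (S : Set K) : Submodule ℚ K where
  carrier := {x | (E x : K) ∈ acl S}
  add_mem' {x y} hx hy := by
    have : (E (x + y) : K) = E x * E y := by rw [hE, Units.val_mul]
    simpa [this] using mul_mem hx hy
  zero_mem' := by simp [hE.map_zero, one_mem]
  smul_mem' q x hx := by
    refine mem_acl_of_pow_mem q.den_pos ?_
    have : E (q • x) ^ q.den = E x ^ q.num := by
      rw [← hE.map_nsmul, ← hE.map_zsmul, Rat.smul_def, ← mul_assoc]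
      congr 2
      exact_mod_cast Rat.den_mul_eq_num q
    rw [← Units.val_pow_eq_pow_val, this, Units.val_zpow_eq_zpow_val]
    exact zpow_mem hx _

theorem mem_logSubmodule {E : K → Kˣ} (hE : AxE E) {S : Set K} {x : K} :
    x ∈ logSubmodule hE S ↔ (E x : K) ∈ acl S := Iff.rfl

theorem addExp_subset_iff {E : K → Kˣ} (hE : AxE E) {V S : Set K} :
    addExp E V ⊆ acl S ↔ Submodule.span ℚ V ≤ aclSubmodule S ⊓ logSubmodule hE S := by
  rw [Submodule.span_le, addExp, Set.union_subset_iff, Set.image_subset_iff, ← Set.subset_inter_iff]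
  rfl

theorem addExp_span_subset {E : K → Kˣ} (hE : AxE E) {V S : Set K} (h : addExp E V ⊆ acl S) :
    addExp E (Submodule.span ℚ V : Submodule ℚ K) ⊆ acl S := by
  rw [addExp_subset_iff hE] at h ⊢
  rwa [Submodule.span_eq]

/-- A homomorphism from the additive to the multiplicative group of `K`, given by a basis `b` of
`K` over the rationals such that exactly one of `b d`, `E (b d)` involves the element `θ (ρ d)`
of an algebraically independent family, and the other one only involves earlier elements. -/
structure TriangularExp (K Λ D : Type*) [Field K] [CharZero K] [LinearOrder Λ] where
  E : K → Kˣ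
  hE : AxE E
  θ : Λ → K
  notMem_acl : ∀ γ, θ γ ∉ acl (θ '' {γ}ᶜ)
  b : Module.Basis D ℚ K
  ρ : D → Λ
  ρ_inj : Function.Injective ρ
  pair : ∀ d, (θ (ρ d) ∈ acl {b d} ∧ b d ∈ acl {θ (ρ d)} ∧ (E (b d) : K) ∈ acl (θ '' Set.Iio (ρ d))) ∨
    (θ (ρ d) ∈ acl {(E (b d) : K)} ∧ (E (b d) : K) ∈ acl {θ (ρ d)} ∧ b d ∈ acl (θ '' Set.Iio (ρ d)))

namespace TriangularExp

variable {Λ D : Type*} [LinearOrder Λ] (T : TriangularExp K Λ D)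

/-- `Y` contains everything that is needed to generate the pairs with index in `Y`. -/
def IsClosed (Y : Set Λ) : Prop :=
  ∀ d, T.ρ d ∈ Y → T.b d ∈ acl (T.θ '' Y) ∧ (T.E (T.b d) : K) ∈ acl (T.θ '' Y)

/-- The span of the basis vectors with index in `Y`. -/
def spanOf (Y : Set Λ) : Submodule ℚ K := Submodule.span ℚ (T.b '' (T.ρ ⁻¹' Y))

theorem mem_spanOf {Y : Set Λ} {v : K} : v ∈ T.spanOf Y ↔ ∀ d, T.b.repr v d ≠ 0 → T.ρ d ∈ Y := by
  rw [spanOf, Module.Basis.mem_span_image]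
  constructor
  · exact fun h d hd => h (Finsupp.mem_support_iff.2 hd)
  · exact fun h d hd => h d (Finsupp.mem_support_iff.1 hd)

theorem basis_mem_of_lt {d : D} {W : Set Λ} (h : Set.Iic (T.ρ d) ⊆ W) :
    T.b d ∈ acl (T.θ '' W) ∧ (T.E (T.b d) : K) ∈ acl (T.θ '' W) := by
  have h1 : acl (T.θ '' Set.Iio (T.ρ d)) ≤ acl (T.θ '' W) :=
    acl_mono (Set.image_mono (Set.Iio_subset_Iic_self.trans h))
  have h2 : acl {T.θ (T.ρ d)} ≤ acl (T.θ '' W) :=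
    acl_mono (Set.singleton_subset_iff.2 ⟨_, h Set.self_mem_Iic, rfl⟩)
  rcases T.pair d with ⟨_, h3, h4⟩ | ⟨_, h3, h4⟩
  exacts [⟨h2 h3, h1 h4⟩, ⟨h1 h4, h2 h3⟩]

theorem spanOf_le_of_closed {Y : Set Λ} (hY : T.IsClosed Y) :
    T.spanOf Y ≤ aclSubmodule (T.θ '' Y) ⊓ logSubmodule T.hE (T.θ '' Y) := by
  rw [spanOf, Submodule.span_le]
  rintro _ ⟨d, hd, rfl⟩
  exact hY d hd

theorem notMem_acl_of_notMem {γ : Λ} {W : Set Λ} (h : γ ∉ W) : T.θ γ ∉ acl (T.θ '' W) := by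
  have hW : W ⊆ {γ}ᶜ := fun x hx he => h (Set.mem_singleton_iff.1 he ▸ hx)
  exact fun h1 => T.notMem_acl γ (acl_mono (Set.image_mono hW) h1)

/-- The span of the basis vectors with index in `Y` or below `γ` is in the closure of these indices. -/
theorem mem_inf_of_support {Y : Set Λ} (hY : T.IsClosed Y) {γ : Λ} {v : K}
    (hv : ∀ d, T.b.repr v d ≠ 0 → T.ρ d ∈ Y ∨ T.ρ d < γ) :
    v ∈ aclSubmodule (T.θ '' (Y ∪ Set.Iio γ)) ⊓ logSubmodule T.hE (T.θ '' (Y ∪ Set.Iio γ)) := by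
  rw [← T.b.linearCombination_repr v, Finsupp.linearCombination_apply]
  refine Submodule.sum_mem _ fun d hd => Submodule.smul_mem _ _ ?_
  rcases hv d (Finsupp.mem_support_iff.1 hd) with h | h
  · exact ⟨acl_mono (Set.image_mono Set.subset_union_left) (hY d h).1,
      acl_mono (Set.image_mono Set.subset_union_left) (hY d h).2⟩
  · exact T.basis_mem_of_lt ((Set.Iic_subset_Iio.2 h).trans Set.subset_union_right)

/-- Up to a non-zero rational multiple of `b d₀`, the vector `v` and its exponential are algebraic
over the generators in `Y` or below `ρ d₀`. So both memberships reduce to those for `b d₀`, and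
there exactly one side involves `θ (ρ d₀)`. -/
theorem top_dichotomy {Y : Set Λ} (hY : T.IsClosed Y) {v : K} {d₀ : D} (h0 : T.b.repr v d₀ ≠ 0)
    (hd₀ : T.ρ d₀ ∉ Y) (hv : ∀ d, d ≠ d₀ → T.b.repr v d ≠ 0 → T.ρ d ∈ Y ∨ T.ρ d < T.ρ d₀) :
    (v ∉ acl (T.θ '' (Y ∪ Set.Iio (T.ρ d₀))) ∧ (T.E v : K) ∈ acl (T.θ '' (Y ∪ Set.Iio (T.ρ d₀)))) ∨
    ((T.E v : K) ∉ acl (T.θ '' (Y ∪ Set.Iio (T.ρ d₀))) ∧ v ∈ acl (T.θ '' (Y ∪ Set.Iio (T.ρ d₀)))) := by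
  set W := Y ∪ Set.Iio (T.ρ d₀) with hW
  have hr : v - T.b.repr v d₀ • T.b d₀ ∈ aclSubmodule (T.θ '' W) ⊓ logSubmodule T.hE (T.θ '' W) := by
    refine T.mem_inf_of_support hY fun d hd => ?_
    by_cases h : d = d₀
    · subst h; simp at hd
    · refine hv d h ?_
      simpa [Finsupp.single_apply, Ne.symm h] using hd
  have key : ∀ P : Submodule ℚ K, v - T.b.repr v d₀ • T.b d₀ ∈ P → (v ∈ P ↔ T.b d₀ ∈ P) := by
    intro P hP
    rw [← Submodule.smul_mem_iff P h0 (x := T.b d₀)]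
    constructor
    · intro h; simpa using sub_mem h hP
    · intro h; simpa using add_mem hP h
  have hnot : T.θ (T.ρ d₀) ∉ acl (T.θ '' W) := T.notMem_acl_of_notMem (by simp [hW, hd₀])
  have h1 : acl (T.θ '' Set.Iio (T.ρ d₀)) ≤ acl (T.θ '' W) :=
    acl_mono (Set.image_mono Set.subset_union_right)
  have kA := key _ hr.1
  have kL := key _ hr.2
  rw [mem_aclSubmodule, mem_aclSubmodule] at kA
  rw [mem_logSubmodule, mem_logSubmodule] at kL
  rw [kA, kL]
  rcases T.pair d₀ with ⟨h2, _, h3⟩ | ⟨h2, _, h3⟩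
  · exact Or.inl ⟨fun h => hnot (acl_le (Set.singleton_subset_iff.2 h) h2), h1 h3⟩
  · exact Or.inr ⟨fun h => hnot (acl_le (Set.singleton_subset_iff.2 h) h2), h1 h3⟩

/-- One step of the triangular decomposition of a finite-dimensional space. -/
theorem exists_step {Y : Set Λ} (hY : T.IsClosed Y) (V : Submodule ℚ K) [FiniteDimensional ℚ V]
    (hV : Disjoint V (T.spanOf Y)) (hV0 : V ≠ ⊥) :
    ∃ V' ≤ V, Module.finrank ℚ V' + 1 = Module.finrank ℚ V ∧ ∃ v ∈ V, v ∉ V' ∧ ∃ W, Y ⊆ W ∧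
      addExp T.E V' ⊆ acl (T.θ '' W) ∧
      ((v ∉ acl (T.θ '' W) ∧ (T.E v : K) ∈ acl (T.θ '' W)) ∨
        ((T.E v : K) ∉ acl (T.θ '' W) ∧ v ∈ acl (T.θ '' W))) := by
  classical
  obtain ⟨s, hs⟩ := (Submodule.fg_iff_finiteDimensional V).2 ‹_›
  let A := s.biUnion fun x => (T.b.repr x).support
  have hA : ∀ v ∈ V, ∀ d, T.b.repr v d ≠ 0 → d ∈ A := by
    intro v hv
    rw [← hs] at hv
    have : Submodule.span ℚ (s : Set K) ≤ Submodule.span ℚ (T.b '' A) := by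
      rw [Submodule.span_le]
      intro x hx
      rw [SetLike.mem_coe, Module.Basis.mem_span_image]
      exact fun d hd => Finset.mem_biUnion.2 ⟨x, hx, hd⟩
    have := this hv
    rw [Module.Basis.mem_span_image] at this
    exact fun d hd => this (Finsupp.mem_support_iff.2 hd)
  -- `B` consists of the indices outside `Y` that occur in `V`. It is non-empty since otherwise `V`
  -- would lie in `spanOf Y`. The hyperplane of vectors with zero coefficient at its largest member
  -- is the smaller space.
  let B := A.filter fun d => T.ρ d ∉ Y ∧ ∃ v ∈ V, T.b.repr v d ≠ 0
  have hB : B.Nonempty := by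
    by_contra hB
    refine hV0 (eq_bot_iff.2 (hV.le_bot.trans' (le_inf le_rfl fun v hv => ?_)))
    rw [mem_spanOf]
    intro d hd
    by_contra h
    exact hB ⟨d, Finset.mem_filter.2 ⟨hA v hv d hd, h, v, hv, hd⟩⟩
  obtain ⟨d₀, hd₀, hmax⟩ := Finset.exists_max_image B T.ρ hB
  obtain ⟨_, hdY, v, hv, hvd⟩ := Finset.mem_filter.1 hd₀
  have hlt : ∀ w ∈ V, ∀ d, d ≠ d₀ → T.b.repr w d ≠ 0 → T.ρ d ∈ Y ∨ T.ρ d < T.ρ d₀ := by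
    intro w hw d hne hd
    by_cases h : T.ρ d ∈ Y
    · exact Or.inl h
    · exact Or.inr (lt_of_le_of_ne (hmax d (Finset.mem_filter.2 ⟨hA w hw d hd, h, w, hw, hd⟩))
        fun he => hne (T.ρ_inj he))
  refine ⟨V ⊓ LinearMap.ker (T.b.coord d₀), inf_le_left, ?_, v, hv, fun h => hvd h.2,
    Y ∪ Set.Iio (T.ρ d₀), Set.subset_union_left, ?_, T.top_dichotomy hY hvd hdY (hlt v hv)⟩
  · have hsurj : Function.Surjective ((T.b.coord d₀).domRestrict V) := by
      intro q
      refine ⟨(q / T.b.repr v d₀) • ⟨v, hv⟩, ?_⟩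
      simp [hvd]
    have h := LinearMap.finrank_range_add_finrank_ker ((T.b.coord d₀).domRestrict V)
    rw [LinearMap.range_eq_top.2 hsurj, finrank_top, Module.finrank_self, LinearMap.ker_domRestrict,
      add_comm] at h
    rw [← h, ← Submodule.finrank_map_subtype_eq, Submodule.map_comap_subtype]
  · rw [addExp_subset_iff T.hE, Submodule.span_eq]
    intro w hw
    refine T.mem_inf_of_support hY fun d hd => hlt w hw.1 d ?_ hd
    rintro rfl
    exact hd hw.2

/-- All of `V'` and its exponentials lie in `acl S`; since `v` or `E v` does not, it is
transcendental over them. -/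
theorem trdegOver_step {k : Subfield K} {V' V : Submodule ℚ K} {E : K → Kˣ} (h : V' ≤ V) {v : K}
    (hv : v ∈ V) {S : Set K} (hk : (k : Set K) ⊆ acl S) (hV' : addExp E V' ⊆ acl S)
    (hd : v ∉ acl S ∨ (E v : K) ∉ acl S) :
    trdegOver k (addExp E V') + 1 ≤ trdegOver k (addExp E V) := by
  have h1 : addExp E V' ∪ addExp E {v} ⊆ acl ((k : Set K) ∪ addExp E V) :=
    (Set.union_subset (addExp_mono h) (addExp_mono (Set.singleton_subset_iff.2 hv))).trans
      (subset_acl_union _ _)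
  refine le_trans ?_ (trdegOver_le h1)
  rw [trdegOver_add]
  gcongr
  have h2 : acl (Subfield.closure ((k : Set K) ∪ addExp E V') : Set K) ≤ acl S :=
    acl_le fun x hx => acl_le (Set.union_subset hk hV') (closure_le_acl _ hx)
  rcases hd with hd | hd
  · exact one_le_trdegOver (x := v) (Or.inl rfl) fun hx => hd (h2 hx)
  · exact one_le_trdegOver (x := E v) (Or.inr ⟨v, rfl, rfl⟩) fun hx => hd (h2 hx)

theorem finrank_le_trdegOver {Y : Set Λ} (hY : T.IsClosed Y) (V : Submodule ℚ K)
    [FiniteDimensional ℚ V] (hV : Disjoint V (T.spanOf Y)) :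
    (Module.finrank ℚ V : Cardinal) ≤ trdegOver (acl (T.θ '' Y)) (addExp T.E V) := by
  induction hn : Module.finrank ℚ V generalizing V with
  | zero => simp
  | succ n ih =>
    have hV0 : V ≠ ⊥ := by rintro rfl; simp at hn
    obtain ⟨V', hV', hr, v, hv, _, W, hYW, hVW, hd⟩ := T.exists_step hY V hV hV0
    have : FiniteDimensional ℚ V' := Submodule.finiteDimensional_of_le hV'
    have := ih V' (hV.mono_left hV') (by omega)
    push_cast
    refine (add_le_add_left this 1).trans (trdegOver_step hV' hv (acl_mono (Set.image_mono hYW)) hVW ?_)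
    exact hd.imp And.left And.left

/-- The additional degree, which makes (CCP) work, comes from the last line left by the induction:
by `hY'`, a vector outside `spanOf Y` has both its value and its exponential transcendental over
`acl (θ '' Y)`. -/
theorem finrank_add_one_le_trdegOver {Y : Set Λ} (hY : T.IsClosed Y)
    (hY' : ∀ v, v ∈ acl (T.θ '' Y) ∨ (T.E v : K) ∈ acl (T.θ '' Y) → v ∈ T.spanOf Y)
    (V : Submodule ℚ K) [FiniteDimensional ℚ V] (hV : Disjoint V (T.spanOf Y)) (hV0 : V ≠ ⊥) :
    (Module.finrank ℚ V + 1 : Cardinal) ≤ trdegOver (acl (T.θ '' Y)) (addExp T.E V) := by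
  induction hn : Module.finrank ℚ V generalizing V with
  | zero => exact absurd (Submodule.finrank_eq_zero.1 hn) hV0
  | succ n ih =>
    obtain ⟨V', hV', hr, v, hv, hvV', W, hYW, hVW, hd⟩ := T.exists_step hY V hV hV0
    have : FiniteDimensional ℚ V' := Submodule.finiteDimensional_of_le hV'
    by_cases hV'0 : V' = ⊥
    · subst hV'0
      have hn0 : n = 0 := by simp at hr; omega
      subst hn0
      have hvY : v ∉ T.spanOf Y := fun h => hvV' ((hV.le_bot) ⟨hv, h⟩)
      have hv1 : v ∉ acl (T.θ '' Y) := fun h => hvY (hY' v (Or.inl h))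
      have hv2 : (T.E v : K) ∉ acl (T.θ '' Y) := fun h => hvY (hY' v (Or.inr h))
      have hYW' : acl (T.θ '' Y) ≤ acl (T.θ '' W) := acl_mono (Set.image_mono hYW)
      -- Of `v` and `E v`, the one in `acl (θ '' W)` gives a first degree over `acl (θ '' Y)`, and
      -- the other is still transcendental after adjoining it.
      have two : ∀ x y : K, x ∈ addExp T.E V → y ∈ addExp T.E V → x ∉ acl (T.θ '' W) →
          y ∈ acl (T.θ '' W) → y ∉ acl (T.θ '' Y) →
          (1 + 1 : Cardinal) ≤ trdegOver (acl (T.θ '' Y)) (addExp T.E V) := by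
        intro x y hx hy hxW hyW hyY
        have h1 : ({y} ∪ {x} : Set K) ⊆ acl ((acl (T.θ '' Y) : Set K) ∪ addExp T.E V) :=
          (Set.union_subset (Set.singleton_subset_iff.2 hy) (Set.singleton_subset_iff.2 hx)).trans
            (subset_acl_union _ _)
        refine le_trans ?_ (trdegOver_le h1)
        rw [trdegOver_add]
        refine add_le_add (one_le_trdegOver rfl (by rwa [acl_acl])) (one_le_trdegOver rfl ?_)
        intro h
        refine hxW (acl_le ?_ h)
        exact fun a ha => acl_le (Set.union_subset hYW' (Set.singleton_subset_iff.2 hyW))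
          (closure_le_acl _ ha)
      have hvE : v ∈ addExp T.E V := Or.inl hv
      have hEvE : (T.E v : K) ∈ addExp T.E V := Or.inr ⟨v, hv, rfl⟩
      simp only [zero_add, Nat.cast_one]
      rcases hd with ⟨h1, h2⟩ | ⟨h1, h2⟩
      · exact two _ _ hvE hEvE h1 h2 hv2
      · exact two _ _ hEvE hvE h1 h2 hv1
    · have := ih V' (hV.mono_left hV') hV'0 (by omega)
      push_cast
      refine (add_le_add_left this 1).trans (trdegOver_step hV' hv (acl_mono (Set.image_mono hYW)) hVW ?_)
      exact hd.imp And.left And.left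

theorem axSP : AxSP T.E := by
  intro n z hz
  have hY : T.IsClosed ∅ := fun d hd => hd.elim
  have hbot : T.spanOf ∅ = ⊥ := by simp [spanOf]
  have : FiniteDimensional ℚ (Submodule.span ℚ (Set.range z)) :=
    .span_of_finite ℚ (Set.finite_range z)
  have h := T.finrank_le_trdegOver hY (Submodule.span ℚ (Set.range z)) (by simp [hbot])
  rw [finrank_span_eq_card hz, Fintype.card_fin] at h
  refine h.trans ((trdegOver_anti bot_le _).trans (trdegOver_le ?_))
  rw [withExp_eq]
  exact addExp_span_subset T.hE (subset_acl_union _ _)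

end TriangularExp

end Triangular

end ExpField

namespace ExpField

/-! ### Transcendence degree of finitely generated algebras -/

section Algebra

variable {k A ι : Type*} [Field k] [CommRing A] [Algebra k A]

/-- In an algebra generated by finitely many elements, the transcendence degree is at most the size
of some algebraically independent subfamily of the generators. -/
theorem exists_trdeg_le_ncard [Nontrivial A] [Finite ι] (x : ι → A)
    (hx : Algebra.adjoin k (Set.range x) = ⊤) :
    ∃ t : Set ι, AlgebraicIndependent k (fun i : t => x i) ∧ Algebra.trdeg k A ≤ t.ncard := by
  classical
  have hne : {t : Set ι | AlgebraicIndependent k (fun i : t => x i)}.Nonempty :=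
    ⟨∅, algebraicIndependent_empty_type_iff.2 (algebraMap k A).injective⟩
  obtain ⟨t, ht, hmax⟩ := Set.exists_max_image _ Set.ncard (Set.toFinite _) hne
  refine ⟨t, ht, ciSup_le' fun s => ?_⟩
  -- The algebra may have zero divisors. A prime that avoids the non-zero polynomials in `s` keeps
  -- `s` independent in a quotient domain, where a transcendence basis can be chosen among the
  -- generators; independence then lifts back to `A`.
  let S : Submonoid A := (nonZeroDivisors (MvPolynomial s.1 k)).map
    (MvPolynomial.aeval (R := k) ((↑) : s.1 → A))
  have hinj : Function.Injective (MvPolynomial.aeval (R := k) ((↑) : s.1 → A)) := s.2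
  have hdis : Disjoint ((⊥ : Ideal A) : Set A) S := by
    rw [Set.disjoint_left]
    rintro _ h0 ⟨f, hf, rfl⟩
    have h0 : MvPolynomial.aeval ((↑) : s.1 → A) f = 0 := h0
    rw [map_eq_zero_iff _ hinj] at h0
    exact nonZeroDivisors.ne_zero hf h0
  obtain ⟨P, hP, -, hPS⟩ := Ideal.exists_le_prime_disjoint ⊥ S hdis
  have hs : AlgebraicIndependent k (fun i : s.1 => Ideal.Quotient.mkₐ k P i) := by
    rw [algebraicIndependent_iff]
    intro f hf
    by_contra h0
    refine Set.disjoint_left.1 hPS ?_ ⟨f, mem_nonZeroDivisors_of_ne_zero h0, rfl⟩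
    have : Ideal.Quotient.mkₐ k P (MvPolynomial.aeval ((↑) : s.1 → A) f) = 0 := by
      rw [← hf, MvPolynomial.comp_aeval_apply]
    exact Ideal.Quotient.eq_zero_iff_mem.1 this
  let y : ι → A ⧸ P := fun i => Ideal.Quotient.mkₐ k P (x i)
  have hy : Algebra.adjoin k (Set.range y) = ⊤ := by
    have : Set.range y = Ideal.Quotient.mkₐ k P '' Set.range x := by rw [← Set.range_comp]; rfl
    rw [this, ← AlgHom.map_adjoin, hx, Algebra.map_top, AlgHom.range_eq_top]
    exact Ideal.Quotient.mkₐ_surjective k P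
  have : Algebra.IsAlgebraic (Algebra.adjoin k (Set.range y)) (A ⧸ P) :=
    ⟨fun a => isAlgebraic_algebraMap (⟨a, hy ▸ Algebra.mem_top⟩ : Algebra.adjoin k (Set.range y))⟩
  obtain ⟨u, hu, hub⟩ := exists_isTranscendenceBasis_subset (R := k) (Set.range y)
  choose g hg using fun a : u => hu a.2
  have hginj : Function.Injective g := fun a b h => Subtype.ext (by rw [← hg a, ← hg b, h])
  have hind : AlgebraicIndependent k (fun i : Set.range g => x i) := by
    have h1 : AlgebraicIndependent k (fun i : Set.range g => y i) := by
      have h2 := hub.1.comp _ (Equiv.ofInjective g hginj).symm.injective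
      convert h2 using 1
      funext ⟨_, a, rfl⟩
      simp [hg]
    exact AlgebraicIndependent.of_comp (Ideal.Quotient.mkₐ k P) h1
  have : Finite u := Finite.of_injective g hginj
  calc #s.1 ≤ Algebra.trdeg k (A ⧸ P) := hs.cardinalMk_le_trdeg
    _ = #u := hub.cardinalMk_eq_trdeg.symm
    _ = ((Set.range g).ncard : Cardinal) := by
      rw [← Nat.card_coe_set_eq, Nat.card_range_of_injective hginj, Nat.cast_card]
    _ ≤ t.ncard := by exact_mod_cast hmax _ hind

end Algebra

/-! ### Generic points over small subfields -/

section Points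

variable {K ι : Type*} [Field K]

theorem exists_isBasis_index [Finite ι] (k : Subfield K) (y : ι → K) :
    ∃ t : Set ι, AlgebraicIndependent k (fun i : t => y i) ∧
      trdegOver k (Set.range y) = t.ncard ∧ ∀ i, y i ∈ acl (k ∪ y '' t) := by
  obtain ⟨s, hs, hsi, hS⟩ := exists_isBasis k (Set.range y)
  choose g hg using fun a : s => hs a.2
  have hginj : Function.Injective g := fun a b h => Subtype.ext (by rw [← hg a, ← hg b, h])
  have himg : y '' Set.range g = s := by
    rw [← Set.range_comp]
    have : y ∘ g = (↑) := funext hg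
    rw [this, Subtype.range_coe]
  refine ⟨Set.range g, ?_, ?_, fun i => by rw [himg]; exact hS ⟨i, rfl⟩⟩
  · have h2 := hsi.comp _ (Equiv.ofInjective g hginj).symm.injective
    convert h2 using 1
    funext ⟨_, a, rfl⟩
    simp [hg]
  · have : Finite s := Finite.of_injective g hginj
    rw [trdegOver_eq_mk hsi (hs.trans (subset_closure_union _ _)) hS, ← Nat.card_coe_set_eq,
      Nat.card_range_of_injective hginj, Nat.cast_card]

theorem ncard_le_trdegOver [Finite ι] {k : Subfield K} {y : ι → K} {t : Set ι}
    (ht : AlgebraicIndependent k (fun i : t => y i)) {S : Set K} (hS : y '' t ⊆ acl (k ∪ S)) :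
    (t.ncard : Cardinal) ≤ trdegOver k S := by
  have h := mk_le_trdegOver ht.to_subtype_range (S := S) ?_
  · rw [← Nat.cast_card, Nat.card_range_of_injective ht.injective, Nat.card_coe_set_eq] at h
    exact h
  · rintro _ ⟨i, rfl⟩
    exact hS ⟨i, i.2, rfl⟩

theorem trdegOver_le_mk (k : Subfield K) (S : Set K) : trdegOver k S ≤ #S := by
  obtain ⟨s, hs, hsi, hS⟩ := exists_isBasis k S
  rw [trdegOver_eq_mk hsi (hs.trans (subset_closure_union _ _)) hS]
  exact Cardinal.mk_le_mk_of_subset hs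

/-- If `K` has infinite transcendence degree, then it does so over every finitely generated
subfield. -/
theorem exists_algebraicIndependent_of_finite
    (hK : ∃ x : ℕ → K, AlgebraicIndependent (⊥ : Subfield K) x) {A : Set K} (hA : A.Finite) :
    ∃ x : ℕ → K, AlgebraicIndependent (Subfield.closure A) x := by
  obtain ⟨x, hx⟩ := hK
  have hbot : Subfield.closure (((⊥ : Subfield K) : Set K) ∪ A) = Subfield.closure A := by
    rw [Subfield.closure_union, Subfield.closure_eq, bot_sup_eq]
  have h1 := trdegOver_add ⊥ A (Set.range x)
  have h2 : ℵ₀ ≤ trdegOver ⊥ (A ∪ Set.range x) := by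
    have : Infinite (Set.range x) := (Set.infinite_range_of_injective hx.injective).to_subtype
    refine (Cardinal.aleph0_le_mk (Set.range x)).trans ?_
    exact mk_le_trdegOver hx.to_subtype_range (Set.subset_union_right.trans (subset_acl_union _ _))
  have h3 : trdegOver ⊥ A < ℵ₀ := (trdegOver_le_mk _ _).trans_lt hA.lt_aleph0
  rw [h1, hbot] at h2
  have h4 : ℵ₀ ≤ trdegOver (Subfield.closure A) (Set.range x) := by
    by_contra h
    exact h2.not_gt (Cardinal.add_lt_aleph0 h3 (not_le.1 h))
  obtain ⟨s, hs, hsi, hS⟩ := exists_isBasis (Subfield.closure A) (Set.range x)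
  rw [trdegOver_eq_mk hsi (hs.trans (subset_closure_union _ _)) hS, Cardinal.aleph0_le_mk_iff] at h4
  exact ⟨_, hsi.comp _ (Infinite.natEmbedding s).injective⟩

theorem repr_self {R A ι : Type*} [CommRing R] [CommRing A] [Algebra R A] {x : ι → A}
    (hx : AlgebraicIndependent R x) (i : ι) :
    hx.repr ⟨x i, Algebra.subset_adjoin ⟨i, rfl⟩⟩ = MvPolynomial.X i := by
  have h : Function.Injective (MvPolynomial.aeval (R := R) x) := hx
  apply h
  rw [hx.aeval_repr, MvPolynomial.aeval_X]

/-- A map from a transcendence basis of a domain to an algebraically independent family in an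
algebraically closed field extends to an embedding. -/
theorem exists_algHom_of_isTranscendenceBasis {k D K ι : Type*} [Field k] [CommRing D] [IsDomain D]
    [Algebra k D] [Field K] [IsAlgClosed K] [Algebra k K] {X : ι → D} (hX : IsTranscendenceBasis k X)
    {x : ι → K} (hx : AlgebraicIndependent k x) :
    ∃ τ : D →ₐ[k] K, Function.Injective τ ∧ ∀ i, τ (X i) = x i := by
  let R := Algebra.adjoin k (Set.range X)
  let φ : R →ₐ[k] K := (MvPolynomial.aeval x).comp hX.1.repr
  have hφ : Function.Injective φ :=
    Function.Injective.comp (g := MvPolynomial.aeval x) hx hX.1.aevalEquiv.symm.injective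
  have hφX : ∀ i, φ ⟨X i, Algebra.subset_adjoin ⟨i, rfl⟩⟩ = x i := by
    intro i
    refine (congrArg (MvPolynomial.aeval x) (repr_self hX.1 i)).trans ?_
    exact MvPolynomial.aeval_X _ _
  let _ : Algebra R K := φ.toRingHom.toAlgebra
  have : IsScalarTower k R K := .of_algebraMap_eq fun a => (φ.commutes a).symm
  have : FaithfulSMul R K := (faithfulSMul_iff_algebraMap_injective R K).2 hφ
  have : Module.IsTorsionFree R K := Module.IsTorsionFree.trans_faithfulSMul R K K
  have : Algebra.IsAlgebraic R D := hX.isAlgebraic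
  let τ : D →ₐ[R] K := IsAlgClosed.lift
  have hτ : Function.Injective τ := by
    refine (injective_iff_map_eq_zero τ).2 fun a ha => by_contra fun h0 => ?_
    -- A non-zero element of the algebraic extension `D` divides a non-zero element of `R`, on which
    -- the map is already injective.
    obtain ⟨r, hr, b, hb⟩ := (Algebra.IsAlgebraic.isAlgebraic (R := R) a).exists_nonzero_dvd
      (mem_nonZeroDivisors_of_ne_zero h0)
    have h1 := congrArg τ hb
    rw [map_mul, ha, zero_mul, τ.commutes] at h1
    exact hr ((map_eq_zero_iff φ hφ).1 h1)
  exact ⟨τ.restrictScalars k, hτ, fun i =>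
    (τ.commutes (⟨X i, Algebra.subset_adjoin ⟨i, rfl⟩⟩ : R)).trans (hφX i)⟩

/-- A prime ideal over a small subfield has generic points in `K`, for which a given transcendence
basis of the coordinates stays independent over a given larger small subfield. -/
theorem exists_generic_point [IsAlgClosed K] [Finite ι] {k G : Subfield K} (hkG : k ≤ G)
    (hG : ∃ x : ℕ → K, AlgebraicIndependent G x) (I : Ideal (MvPolynomial ι k)) [I.IsPrime] {t : Set ι}
    (ht : IsTranscendenceBasis k (fun i : t => Ideal.Quotient.mk I (MvPolynomial.X i))) :
    ∃ p : ι → K, (∀ f : MvPolynomial ι k, MvPolynomial.aeval p f = 0 ↔ f ∈ I) ∧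
      AlgebraicIndependent G (fun i : t => p i) := by
  classical
  obtain ⟨x, hx⟩ := hG
  obtain ⟨e⟩ : Nonempty (t ↪ ℕ) := by
    obtain ⟨n, ⟨e⟩⟩ := Finite.exists_equiv_fin t
    exact ⟨e.toEmbedding.trans Fin.valEmbedding⟩
  have hy := hx.comp e e.injective
  have hyk := algebraicIndependent_of_le hkG hy
  obtain ⟨τ, hτ, hτX⟩ := exists_algHom_of_isTranscendenceBasis ht hyk
  have haev : ∀ f : MvPolynomial ι k, MvPolynomial.aeval
      (fun i => τ (Ideal.Quotient.mk I (MvPolynomial.X i))) f = τ (Ideal.Quotient.mk I f) := by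
    intro f
    have := MvPolynomial.comp_aeval_apply (R := k) (MvPolynomial.X (R := k) (σ := ι))
      (τ.comp (Ideal.Quotient.mkₐ k I)) f
    rw [MvPolynomial.aeval_X_left_apply] at this
    exact this.symm
  refine ⟨fun i => τ (Ideal.Quotient.mk I (MvPolynomial.X i)), fun f => ?_, ?_⟩
  · rw [haev, map_eq_zero_iff _ hτ, Ideal.Quotient.eq_zero_iff_mem]
  · convert hy using 1
    exact funext hτX

end Points
end ExpField

namespace ExpField

/-! ### Subvarieties of `𝔾ⁿ` and their images under integer matrices -/

section Varieties

open MvPolynomial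

variable {K : Type*} [Field K] {n : ℕ}

theorem aeval_map_inclusion {ι : Type*} {k k' : Subfield K} (h : k ≤ k') (x : ι → K)
    (f : MvPolynomial ι k) : aeval x (map (Subfield.inclusion h) f) = aeval x f := by
  rw [aeval_def, aeval_def, eval₂_map]
  rfl

theorem DefinedOver.mono {k k' : Subfield K} (h : k ≤ k') {V : Set (GPoint K n)}
    (hV : DefinedOver k V) : DefinedOver k' V := by
  obtain ⟨S, rfl⟩ := hV
  refine ⟨map (Subfield.inclusion h) '' S, ?_⟩
  ext p
  simp [aeval_map_inclusion h]

theorem exists_map_inclusion {ι : Type*} {k k' : Subfield K} (h : k ≤ k') (f : MvPolynomial ι k')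
    (hf : ∀ m, ((f.coeff m : k') : K) ∈ k) : ∃ g : MvPolynomial ι k, map (Subfield.inclusion h) g = f := by
  have : f ∈ Set.range (map (σ := ι) (Subfield.inclusion h)) := by
    rw [mem_range_map_iff_coeffs_subset]
    intro c hc
    obtain ⟨m, -, rfl⟩ := mem_coeffs_iff.1 hc
    exact ⟨⟨_, hf m⟩, rfl⟩
  exact this

/-- By Hilbert's basis theorem finitely many equations suffice, and irreducibility over `k` passes
to smaller fields of definition. Over a finitely generated field `K` has room for generic points. -/
theorem IrreducibleOver.exists_finite {k : Subfield K} {V : Set (GPoint K n)}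
    (hV : IrreducibleOver k V) :
    ∃ A : Set K, A.Finite ∧ IrreducibleOver (Subfield.closure A) V := by
  classical
  obtain ⟨⟨S, hS⟩, hne, hirr⟩ := hV
  obtain ⟨S', hS'S, hspan⟩ := (Submodule.fg_span_iff_fg_span_finset_subset S).1
    (IsNoetherian.noetherian (Submodule.span (MvPolynomial (Fin n ⊕ Fin n) k) S))
  let A : Set K := ⋃ f ∈ S', (fun c : k => (c : K)) '' (f.coeffs : Set k)
  have hA : A.Finite := S'.finite_toSet.biUnion fun f _ => (Finset.finite_toSet _).image _
  have hAk : Subfield.closure A ≤ k := by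
    rw [Subfield.closure_le]
    refine Set.iUnion₂_subset fun f _ => ?_
    rintro _ ⟨c, _, rfl⟩
    exact c.2
  refine ⟨A, hA, ?_, hne, fun V₁ V₂ h1 h2 h => hirr V₁ V₂ (h1.mono hAk) (h2.mono hAk) h⟩
  have hex : ∀ f ∈ S', ∃ g, map (Subfield.inclusion hAk) g = f := by
    intro f hf
    refine exists_map_inclusion hAk f fun m => ?_
    by_cases hm : f.coeff m = 0
    · rw [hm]; exact zero_mem _
    · exact Subfield.subset_closure (Set.mem_biUnion hf ⟨_, coeff_mem_coeffs m hm, rfl⟩)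
  refine ⟨{g | map (Subfield.inclusion hAk) g ∈ S'}, ?_⟩
  rw [hS]
  ext p
  constructor
  · intro hp g hg
    rw [← aeval_map_inclusion hAk]
    exact hp _ (hS'S hg)
  · intro hp f hf
    have h1 : S ⊆ (RingHom.ker (aeval (R := k) (coords p)) : Set _) := by
      have : Submodule.span (MvPolynomial (Fin n ⊕ Fin n) k) (S' : Set _) ≤
          RingHom.ker (aeval (R := k) (coords p)) := by
        rw [Submodule.span_le]
        intro f hf
        obtain ⟨g, rfl⟩ := hex f hf
        have := hp g hf
        rwa [← aeval_map_inclusion hAk] at this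
      rw [← hspan] at this
      exact Submodule.subset_span.trans this
    exact h1 hf

/-- A Laurent polynomial function is a polynomial function divided by a monomial. -/
theorem exists_aeval_matAct {m : ℕ} (M : Matrix (Fin m) (Fin n) ℤ) {k : Subfield K}
    (P : MvPolynomial (Fin m ⊕ Fin m) k) :
    ∃ (N : ℕ) (Q : MvPolynomial (Fin n ⊕ Fin n) k), ∀ q : GPoint K n,
      aeval (coords (matAct M q)) P * (∏ j, ((q j).2 : K)) ^ N = aeval (coords q) Q := by
  induction P using MvPolynomial.induction_on with
  | C a => exact ⟨0, C a, fun q => by simp⟩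
  | add f g hf hg =>
    obtain ⟨N1, Q1, h1⟩ := hf
    obtain ⟨N2, Q2, h2⟩ := hg
    let w : MvPolynomial (Fin n ⊕ Fin n) k := ∏ j, X (Sum.inr j)
    have hw : ∀ q : GPoint K n, aeval (coords q) w = ∏ j, ((q j).2 : K) := by
      intro q; simp [w, map_prod, coords]
    refine ⟨N1 + N2, Q1 * w ^ N2 + Q2 * w ^ N1, fun q => ?_⟩
    rw [map_add, map_add, map_mul, map_mul, map_pow, map_pow, hw, ← h1, ← h2]
    ring
  | mul_X f i hf =>
    obtain ⟨N, Q, h⟩ := hf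
    rcases i with i | i
    · refine ⟨N, Q * ∑ j, C (M i j : k) * X (Sum.inl j), fun q => ?_⟩
      rw [map_mul, map_mul, aeval_X, ← h]
      have : coords (matAct M q) (Sum.inl i) = aeval (coords q) (∑ j, C (M i j : k) * X (Sum.inl j)) := by
        simp [coords, matAct, map_sum]
      rw [← this]
      ring
    · let N' := ∑ j, (M i j).natAbs
      have hnn : ∀ j, 0 ≤ M i j + N' := by
        intro j
        have : (M i j).natAbs ≤ N' := Finset.single_le_sum (f := fun j => (M i j).natAbs) (fun _ _ => Nat.zero_le _) (Finset.mem_univ j)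
        omega
      let w : MvPolynomial (Fin n ⊕ Fin n) k := ∏ j, X (Sum.inr j) ^ (M i j + N').toNat
      refine ⟨N + N', Q * w, fun q => ?_⟩
      rw [map_mul, map_mul, aeval_X, ← h]
      have : coords (matAct M q) (Sum.inr i) * (∏ j, ((q j).2 : K)) ^ N' = aeval (coords q) w := by
        simp only [coords, matAct, w, map_prod, map_pow, aeval_X, Sum.elim_inr, Units.coe_prod,
          Units.val_zpow_eq_zpow_val]
        rw [← Finset.prod_pow, ← Finset.prod_mul_distrib]
        refine Finset.prod_congr rfl fun j _ => ?_
        rw [← zpow_natCast, ← zpow_natCast, Int.toNat_of_nonneg (hnn j), zpow_add₀ (q j).2.ne_zero]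
      rw [← this]
      ring

theorem exists_coords_eq {f : Fin n ⊕ Fin n → K} (hf : ∀ j, f (Sum.inr j) ≠ 0) :
    ∃ q : GPoint K n, coords q = f := by
  refine ⟨fun j => (f (Sum.inl j), Units.mk0 _ (hf j)), ?_⟩
  ext (j | j) <;> simp [coords]

theorem coords_inr_ne_zero (q : GPoint K n) (j : Fin n) : coords q (Sum.inr j) ≠ 0 :=
  (q j).2.ne_zero

/-- The ideal of a variety, over a subfield. -/
def idealOver (k : Subfield K) (V : Set (GPoint K n)) : Ideal (MvPolynomial (Fin n ⊕ Fin n) k) :=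
  vanishingIdeal k (coords '' V)

theorem mem_idealOver {k : Subfield K} {V : Set (GPoint K n)} {f : MvPolynomial (Fin n ⊕ Fin n) k} :
    f ∈ idealOver k V ↔ ∀ q ∈ V, aeval (coords q) f = 0 := by
  simp [idealOver, mem_vanishingIdeal_iff]

theorem IrreducibleOver.isPrime {k : Subfield K} {V : Set (GPoint K n)} (hV : IrreducibleOver k V) :
    (idealOver k V).IsPrime := by
  obtain ⟨⟨S, hS⟩, ⟨p, hp⟩, hirr⟩ := hV
  refine Ideal.isPrime_iff.2 ⟨fun h => ?_, fun {f g} hfg => ?_⟩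
  · have : (1 : MvPolynomial (Fin n ⊕ Fin n) k) ∈ idealOver k V := h ▸ Submodule.mem_top
    simpa using mem_idealOver.1 this p hp
  · have hdef : ∀ f : MvPolynomial (Fin n ⊕ Fin n) k,
        DefinedOver k {q | q ∈ V ∧ aeval (coords q) f = 0} := by
      intro f
      refine ⟨insert f S, ?_⟩
      rw [hS]
      ext q
      simp [and_comm]
    have := hirr _ _ (hdef f) (hdef g) (by
      ext q
      constructor
      · intro hq
        have := mem_idealOver.1 hfg q hq
        rw [map_mul, mul_eq_zero] at this
        exact this.imp (fun h => ⟨hq, h⟩) fun h => ⟨hq, h⟩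
      · rintro (h | h) <;> exact h.1)
    refine this.imp (fun h => ?_) fun h => ?_
    all_goals
      rw [mem_idealOver]
      intro q hq
      rw [h] at hq
      exact hq.2

theorem mem_of_forall_idealOver {k : Subfield K} {V : Set (GPoint K n)} (hV : DefinedOver k V)
    {q : GPoint K n} (h : ∀ f ∈ idealOver k V, aeval (coords q) f = 0) : q ∈ V := by
  obtain ⟨S, rfl⟩ := hV
  exact fun f hf => h f (mem_idealOver.2 fun q hq => hq f hf)

theorem aeval_comp_val {k : Subfield K} {ι : Type*} {t : Set ι} (p : ι → K) (f : MvPolynomial t k) :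
    aeval (fun i : t => p i) f = aeval p (rename (↑) f) := by
  rw [aeval_rename]
  rfl

section Domain

variable {k D L ι : Type*} [Field k] [CommRing D] [Algebra k D] [Field L] [Algebra k L]

theorem isAlgebraic_map_of_isTranscendenceBasis {x : ι → D} (hx : IsTranscendenceBasis k x)
    {τ : D →ₐ[k] L} (hτ : Function.Injective τ) (a : D) :
    IsAlgebraic (Algebra.adjoin k (Set.range (τ ∘ x))) (τ a) := by
  have hmap : (Algebra.adjoin k (Set.range x)).map τ = Algebra.adjoin k (Set.range (τ ∘ x)) := by
    rw [AlgHom.map_adjoin, ← Set.range_comp]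
  let f : Algebra.adjoin k (Set.range x) →ₐ[k] Algebra.adjoin k (Set.range (τ ∘ x)) :=
    (τ.comp (Algebra.adjoin k (Set.range x)).val).codRestrict _ fun b => by
      rw [← hmap]
      exact ⟨b, b.2, rfl⟩
  refine (hx.isAlgebraic.isAlgebraic a).ringHom_of_comp_eq f.toRingHom τ.toRingHom ?_ ?_
  · exact fun a b h => Subtype.ext (hτ (congrArg Subtype.val h))
  · rfl

variable [IsDomain D]

theorem exists_isTranscendenceBasis_subfamily (x : ι → D) (hx : Algebra.adjoin k (Set.range x) = ⊤) :
    ∃ t : Set ι, IsTranscendenceBasis k (fun i : t => x i) := by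
  have : Algebra.IsAlgebraic (Algebra.adjoin k (Set.range x)) D :=
    ⟨fun a => isAlgebraic_algebraMap (⟨a, hx ▸ Algebra.mem_top⟩ : Algebra.adjoin k (Set.range x))⟩
  obtain ⟨u, hu, hub⟩ := exists_isTranscendenceBasis_subset (R := k) (Set.range x)
  choose g hg using fun a : u => hu a.2
  have hginj : Function.Injective g := fun a b h => Subtype.ext (by rw [← hg a, ← hg b, h])
  refine ⟨Set.range g, ?_⟩
  have h2 := hub.comp_equiv (Equiv.ofInjective g hginj).symm
  convert h2 using 1
  funext ⟨_, a, rfl⟩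
  simp [← hg]

/-- A non-zero element of the kernel would divide a non-zero polynomial in the basis, which would
then vanish at the independent image family. -/
theorem algHom_injective_of_isTranscendenceBasis {x : ι → D} (hx : IsTranscendenceBasis k x)
    (τ : D →ₐ[k] L) (hτ : AlgebraicIndependent k (τ ∘ x)) : Function.Injective τ := by
  refine (injective_iff_map_eq_zero τ).2 fun a ha => by_contra fun h0 => ?_
  obtain ⟨r, hr, b, hb⟩ := (hx.isAlgebraic.isAlgebraic a).exists_nonzero_dvd
    (mem_nonZeroDivisors_of_ne_zero h0)
  have h1 := congrArg τ hb
  rw [map_mul, ha, zero_mul] at h1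
  apply hr
  rw [← map_eq_zero_iff hx.1.repr hx.1.aevalEquiv.symm.injective]
  have h2 : Function.Injective (aeval (R := k) (τ ∘ x)) := hτ
  apply h2
  rw [map_zero]
  exact ((comp_aeval_apply x τ _).symm.trans (congrArg τ (hx.1.aeval_repr r))).trans h1

theorem isTranscendenceBasis_of_ncard_le [Finite ι] {x : ι → D} {s t : Set ι}
    (hs : IsTranscendenceBasis k (fun i : s => x i))
    (ht : AlgebraicIndependent k (fun i : t => x i)) (h : s.ncard ≤ t.ncard) :
    IsTranscendenceBasis k (fun i : t => x i) := by
  refine ht.isTranscendenceBasis_of_lift_trdeg_le_of_finite ?_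
  rw [← hs.lift_cardinalMk_eq_trdeg, Cardinal.lift_le, ← Nat.cast_card, ← Nat.cast_card,
    Nat.card_coe_set_eq, Nat.card_coe_set_eq]
  exact_mod_cast h

end Domain

theorem adjoin_range_mk_X {ι k : Type*} [Field k] (I : Ideal (MvPolynomial ι k)) :
    Algebra.adjoin k (Set.range fun i => Ideal.Quotient.mk I (X i)) = ⊤ := by
  have : (Set.range fun i => Ideal.Quotient.mk I (X i)) = Ideal.Quotient.mkₐ k I '' Set.range X := by
    rw [← Set.range_comp]; rfl
  rw [this, ← AlgHom.map_adjoin, adjoin_range_X, Algebra.map_top, AlgHom.range_eq_top]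
  exact Ideal.Quotient.mkₐ_surjective k I

theorem exists_isTranscendenceBasis_X {ι k : Type*} [Field k] (I : Ideal (MvPolynomial ι k))
    [I.IsPrime] : ∃ t : Set ι, IsTranscendenceBasis k (fun i : t => Ideal.Quotient.mk I (X i)) :=
  exists_isTranscendenceBasis_subfamily (fun i => Ideal.Quotient.mk I (X i)) (adjoin_range_mk_X I)

/-- The coordinates are algebraic over a transcendence basis contained in them. -/
theorem mem_acl_of_isTranscendenceBasis {ι : Type*} {k : Subfield K} {p : ι → K} {t : Set ι}
    {I : Ideal (MvPolynomial ι k)} (hp : ∀ f : MvPolynomial ι k, aeval p f = 0 ↔ f ∈ I)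
    (ht : IsTranscendenceBasis k (fun i : t => Ideal.Quotient.mk I (X i))) (i : ι) :
    p i ∈ acl (k ∪ p '' t) := by
  let τ : (MvPolynomial ι k ⧸ I) →ₐ[k] K := Ideal.Quotient.liftₐ I (aeval p) fun f hf => (hp f).2 hf
  have hτ : ∀ f, τ (Ideal.Quotient.mk I f) = aeval p f := fun f => rfl
  have hτi : Function.Injective τ := by
    rw [injective_iff_map_eq_zero]
    intro a ha
    obtain ⟨f, rfl⟩ := Ideal.Quotient.mk_surjective a
    exact Ideal.Quotient.eq_zero_iff_mem.2 ((hp f).1 ha)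
  have h1 := isAlgebraic_map_of_isTranscendenceBasis ht hτi (Ideal.Quotient.mk I (X i))
  have h2 : Set.range (τ ∘ fun i : t => Ideal.Quotient.mk I (X i)) = p '' t := by
    rw [Set.image_eq_range]
    congr 1
    funext i
    exact aeval_X p i.1
  rw [h2, hτ, aeval_X] at h1
  exact isAlgebraic_adjoin_iff_mem_acl.1 h1

theorem trdegOver_range_le {ι : Type} [Finite ι] {k : Subfield K} {p : ι → K} {t : Set ι}
    (h : ∀ i, p i ∈ acl (k ∪ p '' t)) : trdegOver k (Set.range p) ≤ t.ncard := by
  have h1 : Set.range p ⊆ acl (k ∪ p '' t) := by rintro _ ⟨i, rfl⟩; exact h i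
  refine (trdegOver_le h1).trans ((trdegOver_le_mk _ _).trans ?_)
  rw [← Nat.cast_card, Nat.card_coe_set_eq]
  exact_mod_cast Set.ncard_image_le (Set.toFinite t)

/-- Ensures that a generic zero of the ideal, found in affine space, is a point of `𝔾ⁿ`. -/
theorem inr_ne_zero_of_ker {k : Subfield K} {V : Set (GPoint K n)} (hV : V.Nonempty)
    {f : Fin n ⊕ Fin n → K} (hf : ∀ P : MvPolynomial (Fin n ⊕ Fin n) k, aeval f P = 0 ↔ P ∈ idealOver k V)
    (j : Fin n) : f (Sum.inr j) ≠ 0 := by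
  obtain ⟨q, hq⟩ := hV
  intro h
  have h1 := (hf (X (Sum.inr j))).1 (by rw [aeval_X, h])
  have h2 := mem_idealOver.1 h1 q hq
  rw [aeval_X] at h2
  exact coords_inr_ne_zero q j h2

/-- The dimension of a variety bounds the transcendence degree of its generic points. -/
theorem ncard_le_dimG [IsAlgClosed K] (hK : ∃ x : ℕ → K, AlgebraicIndependent (⊥ : Subfield K) x)
    {A : Set K} (hA : A.Finite) {V : Set (GPoint K n)} (hV : IrreducibleOver (Subfield.closure A) V)
    {t : Set (Fin n ⊕ Fin n)} (ht : IsTranscendenceBasis (Subfield.closure A)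
      (fun i : t => Ideal.Quotient.mk (idealOver (Subfield.closure A) V) (X i))) :
    (t.ncard : Cardinal) ≤ dimG V := by
  let x : t → MvPolynomial (Fin n ⊕ Fin n) K ⧸ vanishingIdeal K (coords '' V) :=
    fun i => Ideal.Quotient.mkₐ K _ (X i)
  have hx : ∀ Q, aeval x Q = Ideal.Quotient.mkₐ K (vanishingIdeal K (coords '' V)) (rename (↑) Q) := by
    intro Q
    rw [← aeval_X_left_apply (rename _ Q), aeval_rename, comp_aeval_apply]
    rfl
  by_cases h : AlgebraicIndependent K x
  · have := h.lift_cardinalMk_le_trdeg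
    rw [← Nat.cast_card, Nat.card_coe_set_eq, Cardinal.lift_natCast, Cardinal.lift_uzero] at this
    exact this
  · exfalso
    rw [algebraicIndependent_iff] at h
    push Not at h
    obtain ⟨Q, hQ, hQ0⟩ := h
    have hQ1 : ∀ q ∈ V, aeval (coords q) (rename (↑) Q : MvPolynomial (Fin n ⊕ Fin n) K) = 0 := by
      rw [hx] at hQ
      have := Ideal.Quotient.eq_zero_iff_mem.1 hQ
      rw [mem_vanishingIdeal_iff] at this
      exact fun q hq => this _ ⟨q, hq, rfl⟩
    -- A relation over `K` has finitely many coefficients. It would hold at a point of `V` whose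
    -- chosen coordinates are independent even over these coefficients.
    let A' : Set K := A ∪ Q.coeffs
    have hA' : A'.Finite := hA.union (Finset.finite_toSet _)
    have := hV.isPrime
    obtain ⟨f, hf, hft⟩ := exists_generic_point (Subfield.closure_mono (Set.subset_union_left : A ⊆ A'))
      (exists_algebraicIndependent_of_finite hK hA') (idealOver (Subfield.closure A) V) ht
    obtain ⟨q, rfl⟩ := exists_coords_eq (inr_ne_zero_of_ker hV.2.1 hf)
    have hq : q ∈ V := mem_of_forall_idealOver hV.1 fun P hP => (hf P).2 hP
    have hQ' : Q ∈ Set.range (map (σ := t) (Subfield.closure A').subtype) := by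
      rw [mem_range_map_iff_coeffs_subset]
      intro c hc
      exact ⟨⟨c, Subfield.subset_closure (Or.inr hc)⟩, rfl⟩
    obtain ⟨Q', hQ'⟩ := hQ'
    apply hQ0
    have h1 := hQ1 q hq
    rw [← hQ', aeval_rename, aeval_def, eval₂_map] at h1
    have : Q' = 0 := (algebraicIndependent_iff.1 hft) Q' h1
    rw [← hQ', this, map_zero]

theorem coords_matAct_mem {m : ℕ} (M : Matrix (Fin m) (Fin n) ℤ) {F : Subfield K} {q : GPoint K n}
    (hq : ∀ i, coords q i ∈ F) (i : Fin m ⊕ Fin m) : coords (matAct M q) i ∈ F := by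
  rcases i with i | i
  · have : coords (matAct M q) (Sum.inl i) = ∑ j, (M i j : K) * (q j).1 := by
      simp [coords, matAct]
    rw [this]
    exact sum_mem fun j _ => mul_mem (intCast_mem _ _) (hq (Sum.inl j))
  · have : coords (matAct M q) (Sum.inr i) = ∏ j, ((q j).2 : K) ^ M i j := by
      simp [coords, matAct]
    rw [this]
    exact prod_mem fun j _ => zpow_mem (hq (Sum.inr j)) _

/-- Pulled back along `M`, a polynomial becomes a Laurent polynomial; its monomial denominator does
not vanish on `𝔾ⁿ`, so equations at `p` specialise to `V` in the pulled back form too. -/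
theorem aeval_matAct_eq_zero_transfer {m : ℕ} (M : Matrix (Fin m) (Fin n) ℤ) {k : Subfield K}
    {p : GPoint K n} {V : Set (GPoint K n)}
    (h : ∀ f : MvPolynomial (Fin n ⊕ Fin n) k, aeval (coords p) f = 0 → ∀ q ∈ V, aeval (coords q) f = 0)
    (P : MvPolynomial (Fin m ⊕ Fin m) k) (hP : aeval (coords (matAct M p)) P = 0) :
    ∀ q ∈ V, aeval (coords (matAct M q)) P = 0 := by
  obtain ⟨N, Q, hQ⟩ := exists_aeval_matAct M P
  intro q hq
  have h1 := h Q (by rw [← hQ, hP, zero_mul]) q hq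
  rw [← hQ, mul_eq_zero] at h1
  refine h1.resolve_right (pow_ne_zero _ (Finset.prod_ne_zero_iff.2 fun j _ => (q j).2.ne_zero))

/-- The field `C` of definition and the field `k₀` of irreducibility of `V` are unrelated. Therefore
`p` is replaced by a point `p'` with the same equations over `C` and the same degree over the
compositum `G`. Its degree is at least `dim V`, so `p'` is generic over `k₀`, and coordinates of `M
· V` that are independent as functions are independent over `k₀` at `M · p'`. -/
theorem dimG_matAct_image_le [IsAlgClosed K]
    (hK : ∃ x : ℕ → K, AlgebraicIndependent (⊥ : Subfield K) x) {V : Set (GPoint K n)}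
    (hV : IsIrreducibleVariety V) {N : ℕ} (hN : dimG V = N) {A : Set K} (hA : A.Finite)
    (hVA : DefinedOver (Subfield.closure A) V) {p : GPoint K n} (hp : p ∈ V)
    (hpN : (N : Cardinal) ≤ trdegOver (Subfield.closure A) (Set.range (coords p))) {m : ℕ}
    (M : Matrix (Fin m) (Fin n) ℤ) :
    dimG (matAct M '' V) ≤
      trdegOver (Subfield.closure A) (Set.range (coords (matAct M p))) := by
  obtain ⟨k, hk⟩ := hV
  obtain ⟨A₀, hA₀, hirr⟩ := hk.exists_finite
  set C := Subfield.closure A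
  set k₀ := Subfield.closure A₀
  set G := Subfield.closure (A₀ ∪ A)
  have hk₀G : k₀ ≤ G := Subfield.closure_mono Set.subset_union_left
  have hCG : C ≤ G := Subfield.closure_mono Set.subset_union_right
  have hG := exists_algebraicIndependent_of_finite hK (hA₀.union hA)
  -- a generic copy of `p`
  let J : Ideal (MvPolynomial (Fin n ⊕ Fin n) C) := RingHom.ker (aeval (R := C) (coords p))
  have hJ : ∀ f : MvPolynomial (Fin n ⊕ Fin n) C, aeval (coords p) f = 0 ↔ f ∈ J := fun f => Iff.rfl
  have : J.IsPrime := RingHom.ker_isPrime _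
  obtain ⟨t, ht⟩ := exists_isTranscendenceBasis_X J
  obtain ⟨f, hf, hft⟩ := exists_generic_point hCG hG J ht
  obtain ⟨p', rfl⟩ : ∃ q : GPoint K n, coords q = f := by
    refine exists_coords_eq fun j hj => coords_inr_ne_zero p j ?_
    have := (hf (X (Sum.inr j))).1 (by rw [aeval_X, hj])
    rwa [← hJ, aeval_X] at this
  have hp' : p' ∈ V := by
    obtain ⟨S, rfl⟩ := hVA
    exact fun f hfS => (hf f).2 ((hJ f).1 (hp f hfS))
  have hNt : N ≤ t.ncard := by
    exact_mod_cast hpN.trans (trdegOver_range_le (mem_acl_of_isTranscendenceBasis hJ ht))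
  -- it is generic over `k₀`
  have := hirr.isPrime
  obtain ⟨t₀, ht₀⟩ := exists_isTranscendenceBasis_X (idealOver k₀ V)
  have ht₀N : t₀.ncard ≤ N := by
    have := ncard_le_dimG hK hA₀ hirr ht₀
    rw [hN] at this
    exact_mod_cast this
  let τ : (MvPolynomial (Fin n ⊕ Fin n) k₀ ⧸ idealOver k₀ V) →ₐ[k₀] K :=
    Ideal.Quotient.liftₐ _ (aeval (coords p')) fun f hf => mem_idealOver.1 hf p' hp'
  have hτX : ∀ i, τ (Ideal.Quotient.mk _ (X i)) = coords p' i := fun i => aeval_X _ i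
  have hgen : ∀ f : MvPolynomial (Fin n ⊕ Fin n) k₀, aeval (coords p') f = 0 ↔ f ∈ idealOver k₀ V := by
    have hind : AlgebraicIndependent k₀ (τ ∘ fun i : t => Ideal.Quotient.mk _ (X i)) := by
      have := algebraicIndependent_of_le hk₀G hft
      convert this using 1
      exact funext fun i => hτX i
    have hb : IsTranscendenceBasis k₀
        (fun i : t => Ideal.Quotient.mk (idealOver k₀ V) (X i)) :=
      isTranscendenceBasis_of_ncard_le (x := fun i => Ideal.Quotient.mk (idealOver k₀ V) (X i)) ht₀
        (AlgebraicIndependent.of_comp τ hind) (ht₀N.trans hNt)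
    have hτi := algHom_injective_of_isTranscendenceBasis hb τ hind
    intro f
    rw [← Ideal.Quotient.eq_zero_iff_mem, ← map_eq_zero_iff τ hτi]
    rfl
  -- independent coordinates of the image
  have hne : (coords '' (matAct M '' V)).Nonempty := (hirr.2.1.image _).image _
  have : Nontrivial (MvPolynomial (Fin m ⊕ Fin m) K ⧸ vanishingIdeal K (coords '' (matAct M '' V))) := by
    refine Ideal.Quotient.nontrivial_iff.2 fun h => ?_
    obtain ⟨q, hq⟩ := hne
    have : (1 : MvPolynomial (Fin m ⊕ Fin m) K) ∈ vanishingIdeal K (coords '' (matAct M '' V)) :=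
      h ▸ Submodule.mem_top
    simpa using mem_vanishingIdeal_iff.1 this q hq
  let y : Fin m ⊕ Fin m → MvPolynomial (Fin m ⊕ Fin m) K ⧸ vanishingIdeal K (coords '' (matAct M '' V)) :=
    fun i => Ideal.Quotient.mkₐ K _ (X i)
  have hy : Algebra.adjoin K (Set.range y) = ⊤ := by
    have : Set.range y = Ideal.Quotient.mkₐ K _ '' Set.range X := by rw [← Set.range_comp]; rfl
    rw [this, ← AlgHom.map_adjoin, adjoin_range_X, Algebra.map_top, AlgHom.range_eq_top]
    exact Ideal.Quotient.mkₐ_surjective K _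
  obtain ⟨t', ht', hdim⟩ := exists_trdeg_le_ncard y hy
  refine le_trans hdim ?_
  set g := coords (matAct M p') with hg
  have hgind : AlgebraicIndependent k₀ (fun i : t' => g i) := by
    rw [algebraicIndependent_iff]
    intro P hP
    rw [aeval_comp_val] at hP
    have h1 := aeval_matAct_eq_zero_transfer M (fun f hf => mem_idealOver.1 ((hgen f).1 hf)) _ hP
    have h2 : aeval (fun i : t' => y i) (map k₀.subtype P) = 0 := by
      have h3 : aeval (fun i : t' => y i) (map k₀.subtype P) =
          Ideal.Quotient.mkₐ K (vanishingIdeal K (coords '' (matAct M '' V)))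
            (rename (↑) (map k₀.subtype P)) := by
        rw [← aeval_X_left_apply (rename _ (map _ P)), aeval_rename, comp_aeval_apply]
        rfl
      rw [h3]
      refine Ideal.Quotient.eq_zero_iff_mem.2 (mem_vanishingIdeal_iff.2 ?_)
      rintro _ ⟨_, ⟨q, hq, rfl⟩, rfl⟩
      rw [aeval_rename, aeval_def, eval₂_map]
      have := h1 q hq
      rw [← aeval_comp_val] at this
      exact this
    have h4 := algebraicIndependent_iff.1 ht' _ h2
    exact map_injective k₀.subtype Subtype.val_injective (by rw [h4, map_zero])
  -- the image coordinates stay independent over `G`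
  have hgS : ∀ (F : Subfield K), g '' t' ⊆ acl ((F : Set K) ∪ Set.range (coords p')) := by
    rintro F _ ⟨i, -, rfl⟩
    exact coords_matAct_mem M (fun i => subset_acl_union F (Set.range (coords p')) (Set.mem_range_self i)) i
  have hle : (t'.ncard : Cardinal) ≤ trdegOver G (g '' t') := by
    -- Here `c` is the degree of `p'` over the independent image coordinates. Their number plus `c`
    -- is at most `N`, while `N` is at most their degree over `G` plus `c`; the finite cardinal `c`
    -- cancels.
    set c := trdegOver (Subfield.closure ((k₀ : Set K) ∪ g '' t')) (Set.range (coords p')) with hc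
    have h1 : (t'.ncard : Cardinal) + c ≤ N := by
      refine (add_le_add_left (ncard_le_trdegOver hgind (subset_acl_union _ _)) _).trans ?_
      rw [hc, ← trdegOver_add]
      refine (trdegOver_le (Set.union_subset (hgS _) (subset_acl_union _ _))).trans ?_
      refine (trdegOver_range_le (mem_acl_of_isTranscendenceBasis hgen ht₀)).trans ?_
      exact_mod_cast ht₀N
    have h2 : (N : Cardinal) ≤ trdegOver G (g '' t') + c := by
      have h3 : (t.ncard : Cardinal) ≤ trdegOver G (Set.range (coords p')) :=
        ncard_le_trdegOver hft ((Set.image_subset_range _ _).trans (subset_acl_union _ _))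
      refine le_trans (by exact_mod_cast hNt) (h3.trans ?_)
      refine (trdegOver_le (T := g '' t' ∪ Set.range (coords p'))
        (Set.subset_union_right.trans (subset_acl_union _ _))).trans ?_
      rw [trdegOver_add]
      gcongr
      exact trdegOver_anti (Subfield.closure_mono (Set.union_subset_union_left _ hk₀G)) _
    have hcfin : c < ℵ₀ := (le_add_self.trans h1).trans_lt (Cardinal.natCast_lt_aleph0)
    exact (Cardinal.add_le_add_iff_of_lt_aleph0 hcfin).1 (h1.trans h2)
  refine hle.trans ((trdegOver_anti hCG _).trans ?_)
  refine (trdegOver_le ((Set.image_subset_range g t').trans (subset_acl_union _ _))).trans ?_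
  -- Back to `p`: independence over `C` of coordinates of the image depends only on the equations
  -- over `C`, which `p` and `p'` share.
  obtain ⟨s, hs, hs', -⟩ := exists_isBasis_index C g
  rw [hs']
  refine ncard_le_trdegOver (y := coords (matAct M p)) ?_
    ((Set.image_subset_range _ _).trans (subset_acl_union _ _))
  rw [algebraicIndependent_iff] at hs ⊢
  intro P hP
  refine hs P ?_
  rw [aeval_comp_val] at hP ⊢
  exact aeval_matAct_eq_zero_transfer M (V := {p'})
    (fun f h q hq => by rw [Set.mem_singleton_iff.1 hq]; exact (hf f).2 h) _ hP p' rfl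

end Varieties
end ExpField

/-! ### Integer matrices and the Countable Closure Property -/

namespace ExpField

/-- Rotundity uses the rank over `ℤ`, the dimension count uses rational subspaces. Columns that are
independent over `ℚ` are independent over `ℤ`. -/
theorem rank_map_intCast_le {m n : ℕ} (M : Matrix (Fin m) (Fin n) ℤ) :
    (M.map (Int.cast : ℤ → ℚ)).rank ≤ M.rank := by
  rw [Matrix.rank_eq_finrank_span_cols, Matrix.rank_eq_finrank_span_cols]
  obtain ⟨κ, a, ha, hspan, hli⟩ := exists_linearIndependent' ℚ (M.map (Int.cast : ℤ → ℚ)).col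
  have : Finite κ := .of_injective a ha
  have := Fintype.ofFinite κ
  rw [← hspan, finrank_span_eq_card hli]
  let f : (Fin m → ℤ) →ₗ[ℤ] (Fin m → ℚ) := (Int.castAddHom ℚ).toIntLinearMap.compLeft (Fin m)
  have h1 : LinearIndependent ℤ (f ∘ (M.col ∘ a)) :=
    hli.restrict_scalars (by simpa using Int.cast_injective)
  have h2 := h1.of_comp f
  rw [← finrank_span_eq_card h2]
  exact Submodule.finrank_mono (Submodule.span_mono (Set.range_comp_subset_range _ _))

/-- A rational subspace is spanned by the rows of an integer matrix. -/
theorem exists_matrix_rows_mem {n : ℕ} (N : Submodule ℚ (Fin n → ℚ)) :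
    ∃ M : Matrix (Fin n) (Fin n) ℤ, (∀ i, (fun j => (M i j : ℚ)) ∈ N) ∧
      Module.finrank ℚ N ≤ M.rank := by
  let v := Module.finBasis ℚ N
  have he : Module.finrank ℚ N ≤ n := by simpa using Submodule.finrank_le N
  obtain ⟨⟨d, hd⟩, hint⟩ := IsLocalization.exist_integer_multiples_of_finite (nonZeroDivisors ℤ)
    (fun p : Fin (Module.finrank ℚ N) × Fin n => (v p.1 : Fin n → ℚ) p.2)
  choose g hg using hint
  have hg' : ∀ i, (fun j => (g (i, j) : ℚ)) = (d : ℚ) • (v i : Fin n → ℚ) := fun i => by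
    funext j
    have := hg (i, j)
    simpa using this
  have hd0 : (d : ℚ) ≠ 0 := by exact_mod_cast nonZeroDivisors.ne_zero hd
  -- Basis vectors cleared of denominators, padded with zero rows because rotundity is stated for
  -- square matrices.
  let M : Matrix (Fin n) (Fin n) ℤ := Function.extend (Fin.castLE he) (fun i j => g (i, j)) 0
  have hM : ∀ i, M (Fin.castLE he i) = fun j => g (i, j) := fun i =>
    (Fin.castLE_injective he).extend_apply _ _ i
  refine ⟨M, fun i => ?_, le_trans ?_ (rank_map_intCast_le M)⟩
  · by_cases hi : ∃ k, Fin.castLE he k = i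
    · obtain ⟨k, rfl⟩ := hi
      simp_rw [hM, hg']
      exact N.smul_mem _ (v k).2
    · have : M i = 0 := Function.extend_apply' _ _ _ hi
      simp_rw [this]
      convert N.zero_mem using 1
      funext j
      simp
  · rw [Matrix.rank_eq_finrank_span_row]
    refine Submodule.finrank_mono fun x hx => ?_
    have h1 := congrArg N.subtype (v.sum_repr ⟨x, hx⟩)
    rw [map_sum] at h1
    change _ = x at h1
    rw [← h1]
    refine Submodule.sum_mem _ fun i _ => ?_
    rw [map_smul]
    refine Submodule.smul_mem _ _ ?_
    have h2 : ((d : ℚ) • (v i : Fin n → ℚ)) ∈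
        Submodule.span ℚ (Set.range (M.map (Int.cast : ℤ → ℚ)).row) := by
      rw [← hg']
      refine Submodule.subset_span ⟨Fin.castLE he i, ?_⟩
      funext j
      simp [Matrix.row, hM]
    exact (Submodule.smul_mem_iff _ hd0).1 h2

section Countable

variable {K : Type*} [Field K]

theorem acl_countable {S : Set K} (hS : S.Countable) : (acl S : Set K).Countable := by
  have h1 : (Subfield.closure S : Set K).Countable := by
    rw [← Cardinal.le_aleph0_iff_set_countable]
    have := Subfield.cardinalMk_closure_le_max S
    exact this.trans (max_le (Cardinal.le_aleph0_iff_set_countable.2 hS) le_rfl)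
  have := h1.to_subtype
  have h2 : Countable (Subfield.closure S) := this
  have h3 := Algebra.IsAlgebraic.cardinalMk_le_max (Subfield.closure S)
    (algebraicClosure (Subfield.closure S) K)
  rw [← Cardinal.le_aleph0_iff_set_countable]
  exact h3.trans (max_le (Cardinal.mk_le_aleph0) le_rfl)

/-- Each non-empty fibre is a coset of the kernel. -/
theorem AxE.countable_preimage {E : K → Kˣ} (hE : AxE E) (hker : {x | E x = 1}.Countable) {S : Set K}
    (hS : S.Countable) : {x | (E x : K) ∈ S}.Countable := by
  have : {x | (E x : K) ∈ S} = ⋃ s ∈ S, {x | (E x : K) = s} := by ext; simp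
  rw [this]
  refine hS.biUnion fun s _ => ?_
  by_cases h : ∃ x, (E x : K) = s
  · obtain ⟨x, rfl⟩ := h
    refine (hker.image (x + ·)).mono ?_
    intro y hy
    have hy' : E y = E x := Units.ext hy
    refine ⟨y - x, ?_, by simp⟩
    rw [Set.mem_ofPred_eq, sub_eq_add_neg, hE, hE.map_neg, hy', mul_inv_cancel]
  · convert Set.countable_empty
    rw [Set.eq_empty_iff_forall_notMem]
    exact fun x hx => h ⟨x, hx⟩

variable [CharZero K]

namespace TriangularExp

variable {Λ D : Type*} [LinearOrder Λ] (T : TriangularExp K Λ D)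

theorem exists_countable_support (v : K) : {γ | ∃ d, T.b.repr v d ≠ 0 ∧ T.ρ d = γ}.Countable := by
  have : {γ | ∃ d, T.b.repr v d ≠ 0 ∧ T.ρ d = γ} = T.ρ '' (T.b.repr v).support := by
    ext; simp
  rw [this]
  exact ((Finset.finite_toSet _).image _).countable

theorem exists_countable_subset_acl (hθ : ∀ x, x ∈ acl (Set.range T.θ)) {S : Set K} (hS : S.Countable) :
    ∃ Y : Set Λ, Y.Countable ∧ S ⊆ acl (T.θ '' Y) := by
  have h : ∀ x, ∃ Y : Set Λ, Y.Countable ∧ x ∈ acl (T.θ '' Y) := fun x => by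
    obtain ⟨t, ht, hf, hx⟩ := exists_finite_mem_acl (hθ x)
    choose g hg using fun a : t => ht a.2
    have := hf.to_subtype
    refine ⟨Set.range g, Set.countable_range g, acl_mono (fun a ha => ?_) hx⟩
    exact ⟨g ⟨a, ha⟩, ⟨_, rfl⟩, hg ⟨a, ha⟩⟩
  choose Y hY hx using h
  exact ⟨⋃ x ∈ S, Y x, hS.biUnion fun x _ => hY x, fun x hxS =>
    acl_mono (Set.image_mono (Set.subset_biUnion_of_mem hxS)) (hx x)⟩

/-- The support of a vector. -/
def indexSupport (v : K) : Set Λ := {γ | ∃ d, T.b.repr v d ≠ 0 ∧ T.ρ d = γ}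

theorem mem_spanOf_iff_indexSupport {Y : Set Λ} {v : K} : v ∈ T.spanOf Y ↔ T.indexSupport v ⊆ Y := by
  rw [mem_spanOf]
  exact ⟨fun h γ ⟨d, hd, e⟩ => e ▸ h d hd, fun h d hd => h ⟨d, hd, rfl⟩⟩

/-- Closing off `ω` times: each round adds the generators needed for the pairs already present and
the supports of all vectors whose value or exponential is already algebraic. Countability survives
because `acl` of a countable set and preimages of countable sets under `E` are countable. Every
element of the final closure appears at a finite round. -/
theorem exists_countable_closed (hθ : ∀ x, x ∈ acl (Set.range T.θ)) (hker : {x | T.E x = 1}.Countable)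
    {S : Set K} (hS : S.Countable) :
    ∃ Y : Set Λ, Y.Countable ∧ S ⊆ T.spanOf Y ∧ T.IsClosed Y ∧
      ∀ v, v ∈ acl (T.θ '' Y) ∨ (T.E v : K) ∈ acl (T.θ '' Y) → v ∈ T.spanOf Y := by
  have step : ∀ Y : Set Λ, ∃ Y' : Set Λ, Y ⊆ Y' ∧ (Y.Countable → Y'.Countable ∧
      (∀ d, T.ρ d ∈ Y → T.b d ∈ acl (T.θ '' Y') ∧ (T.E (T.b d) : K) ∈ acl (T.θ '' Y')) ∧
      ∀ v, v ∈ acl (T.θ '' Y) ∨ (T.E v : K) ∈ acl (T.θ '' Y) → v ∈ T.spanOf Y') := by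
    intro Y
    by_cases hY : Y.Countable
    swap
    · exact ⟨Y, le_rfl, fun h => absurd h hY⟩
    have h1 := acl_countable (hY.image T.θ)
    have h2 := T.hE.countable_preimage hker h1
    have h3 : (T.ρ ⁻¹' Y).Countable := hY.preimage T.ρ_inj
    obtain ⟨Y₁, hY₁, hY₁'⟩ := T.exists_countable_subset_acl hθ
      ((h3.image T.b).union (h3.image fun d => (T.E (T.b d) : K)))
    refine ⟨Y ∪ Y₁ ∪ ⋃ v ∈ ((acl (T.θ '' Y) : Set K) ∪ {x | (T.E x : K) ∈ acl (T.θ '' Y)}),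
      T.indexSupport v, Set.subset_union_left.trans Set.subset_union_left, fun _ => ⟨?_, ?_, ?_⟩⟩
    · exact (hY.union hY₁).union ((h1.union h2).biUnion fun v _ => T.exists_countable_support v)
    · intro d hd
      have h4 : acl (T.θ '' Y₁) ≤ acl (T.θ '' (Y ∪ Y₁ ∪ ⋃ v ∈ ((acl (T.θ '' Y) : Set K) ∪
          {x | (T.E x : K) ∈ acl (T.θ '' Y)}), T.indexSupport v)) :=
        acl_mono (Set.image_mono (Set.subset_union_right.trans Set.subset_union_left))
      exact ⟨h4 (hY₁' (Or.inl ⟨d, hd, rfl⟩)), h4 (hY₁' (Or.inr ⟨d, hd, rfl⟩))⟩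
    · intro v hv
      rw [mem_spanOf_iff_indexSupport]
      exact (Set.subset_biUnion_of_mem (u := fun v => T.indexSupport v) hv).trans Set.subset_union_right
  choose G hG hG' using step
  let Y₀ : Set Λ := ⋃ v ∈ S, T.indexSupport v
  have hY₀ : Y₀.Countable := hS.biUnion fun v _ => T.exists_countable_support v
  let Y : ℕ → Set Λ := fun n => G^[n] Y₀
  have hYs : ∀ n, Y (n + 1) = G (Y n) := fun n => Function.iterate_succ_apply' G n Y₀
  have hYc : ∀ n, (Y n).Countable := fun n => by
    induction n with
    | zero => exact hY₀
    | succ n ih => rw [hYs]; exact (hG' _ ih).1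
  have hYm : Monotone Y := monotone_nat_of_le_succ fun n => by rw [hYs]; exact hG _
  have hfin : ∀ x, x ∈ acl (T.θ '' ⋃ n, Y n) → ∃ n, x ∈ acl (T.θ '' Y n) := by
    intro x hx
    obtain ⟨t, ht, hf, hx⟩ := exists_finite_mem_acl hx
    rw [Set.image_iUnion] at ht
    obtain ⟨n, hn⟩ := (hYm.directed_le.mono_comp (· ≤ ·) (g := fun Y => T.θ '' Y)
      (fun _ _ h => Set.image_mono h)).exists_mem_subset_of_finset_subset_biUnion (s := hf.toFinset)
      (by simpa using ht)
    exact ⟨n, acl_mono (by simpa using hn) hx⟩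
  refine ⟨⋃ n, Y n, Set.countable_iUnion hYc, fun v hv => ?_, fun d hd => ?_, fun v hv => ?_⟩
  · refine T.mem_spanOf_iff_indexSupport.2 (Set.Subset.trans ?_ (Set.subset_iUnion Y 0))
    exact Set.subset_biUnion_of_mem (u := fun v => T.indexSupport v) hv
  · obtain ⟨n, hn⟩ := Set.mem_iUnion.1 hd
    have h1 : acl (T.θ '' Y (n + 1)) ≤ acl (T.θ '' ⋃ n, Y n) :=
      acl_mono (Set.image_mono (Set.subset_iUnion Y _))
    have h2 := (hG' _ (hYc n)).2.1 d hn
    rw [← hYs] at h2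
    exact ⟨h1 h2.1, h1 h2.2⟩
  · obtain ⟨n, hn⟩ : ∃ n, v ∈ acl (T.θ '' Y n) ∨ (T.E v : K) ∈ acl (T.θ '' Y n) := by
      rcases hv with hv | hv
      · exact (hfin _ hv).imp fun _ => Or.inl
      · exact (hfin _ hv).imp fun _ => Or.inr
    have h2 := (hG' _ (hYc n)).2.2 v hn
    rw [← hYs, mem_spanOf_iff_indexSupport] at h2
    exact T.mem_spanOf_iff_indexSupport.2 (h2.trans (Set.subset_iUnion Y _))

/-- All generic solutions have their coordinates in the countable space `U`. Otherwise, let `r` be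
the dimension of the rational relations that place combinations of `z` in `U`. Rotundity gives these
combinations and their exponentials, which lie in `F`, degree at least `r`; the remaining `n - r`
dimensions have degree at least `n - r + 1` over `F`. The total exceeds `n = dim V`. -/
theorem axCCP [IsAlgClosed K] (hK : ∃ x : ℕ → K, AlgebraicIndependent (⊥ : Subfield K) x)
    (hθ : ∀ x, x ∈ acl (Set.range T.θ)) (hker : {x | T.E x = 1}.Countable) : AxCCP T.E := by
  intro n _ V _ hrot hdim m c hdef
  obtain ⟨Y, hYc, hcY, hY, hY'⟩ := T.exists_countable_closed hθ hker (Set.finite_range c).countable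
  have hYle := T.spanOf_le_of_closed hY
  set F := acl (T.θ '' Y) with hF
  set U := T.spanOf Y with hU
  have hUc : (U : Set K).Countable := (acl_countable (hYc.image T.θ)).mono fun x hx => (hYle hx).1
  refine (Set.countable_univ_pi (fun _ : Fin n => hUc)).mono ?_
  intro z hz i _
  by_contra hzi
  obtain ⟨hzV, hzt⟩ := hz
  set A := withExp T.E c with hA
  have hAfin : A.Finite := (Set.finite_range _).union (Set.finite_range _)
  have hAF : Subfield.closure A ≤ F := by
    rw [Subfield.closure_le, hA, withExp_eq, hF, addExp_subset_iff T.hE, Submodule.span_le]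
    exact fun x hx => hYle (hcY hx)
  let Z : (Fin n → ℚ) →ₗ[ℚ] K := Fintype.linearCombination ℚ z
  have hZ : ∀ a, Z a = ∑ j, a j • z j := fun a => Fintype.linearCombination_apply _ _ _
  obtain ⟨M, hMN, hMr⟩ := exists_matrix_rows_mem (U.comap Z)
  set p := graphPoint T.E z with hp
  have hrange : Set.range (coords p) = withExp T.E z := Set.Sum.elim_range _ _
  have hMu : ∀ i, ∑ j, (M i j : K) * z j ∈ U := fun i => by
    have : Z (fun j => (M i j : ℚ)) = ∑ j, (M i j : K) * z j := by simp [hZ, Rat.smul_def]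
    rw [← this]
    exact hMN i
  have hMF : Set.range (coords (matAct M p)) ⊆ F := by
    rintro _ ⟨i | i, rfl⟩
    · have : coords (matAct M p) (Sum.inl i) = ∑ j, (M i j : K) * z j := by
        simp [coords, matAct, hp, graphPoint]
      rw [this]
      exact (hYle (hMu i)).1
    · have : coords (matAct M p) (Sum.inr i) = T.E (∑ j, (M i j : K) * z j) := by
        rw [T.hE.map_sum]
        simp [coords, matAct, hp, graphPoint, T.hE.map_zsmul]
      rw [this]
      exact (hYle (hMu i)).2
  have h1 : (Module.finrank ℚ (U.comap Z) : Cardinal) ≤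
      trdegOver (Subfield.closure A) (Set.range (coords (matAct M p))) := by
    refine le_trans (le_trans (by exact_mod_cast hMr) (hrot.2 M)) ?_
    refine dimG_matAct_image_le hK hrot.1 hdim hAfin
      (hdef.mono (Subfield.closure_mono Set.subset_union_left)) hzV ?_ M
    rw [hrange, hzt, hdim]
  -- On a complement of the relations, `Z` is injective and its image meets `U` only in `0`.
  obtain ⟨N', hN'⟩ := Submodule.exists_isCompl (U.comap Z)
  have hN'Z : Function.Injective (Z.domRestrict N') := by
    rw [← LinearMap.ker_eq_bot, Submodule.eq_bot_iff]
    intro a ha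
    have : (a : Fin n → ℚ) ∈ U.comap Z := by
      rw [Submodule.mem_comap, show Z a = 0 from ha]
      exact zero_mem _
    exact Subtype.ext (Submodule.disjoint_def.1 hN'.disjoint _ this a.2)
  have hmap : N'.map Z = LinearMap.range (Z.domRestrict N') := by
    rw [LinearMap.range_domRestrict]
  have hfr : Module.finrank ℚ (N'.map Z) = Module.finrank ℚ N' := by
    rw [hmap, LinearMap.finrank_range_of_inj hN'Z]
  have hdisj : Disjoint (N'.map Z) U := by
    rw [Submodule.disjoint_def]
    rintro _ ⟨a, ha, rfl⟩ h
    rw [Submodule.disjoint_def.1 hN'.disjoint a h ha, map_zero]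
  have hne : N'.map Z ≠ ⊥ := by
    intro h
    have hb : N' = ⊥ := by
      rw [← Submodule.finrank_eq_zero (R := ℚ), ← hfr, h, finrank_bot]
    have htop : U.comap Z = ⊤ := by
      have := hN'.codisjoint.eq_top
      rwa [hb, sup_bot_eq] at this
    have : Pi.single i (1 : ℚ) ∈ U.comap Z := htop ▸ Submodule.mem_top
    rw [Submodule.mem_comap] at this
    apply hzi
    simpa [Z] using this
  have h2 := T.finrank_add_one_le_trdegOver hY hY' (N'.map Z) hdisj hne
  have hsum : Module.finrank ℚ (U.comap Z) + Module.finrank ℚ N' = n := by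
    rw [Submodule.finrank_add_eq_of_isCompl hN', Module.finrank_fin_fun]
  have hle : trdegOver F (addExp T.E (N'.map Z : Submodule ℚ K)) ≤ trdegOver F (withExp T.E z) := by
    refine trdegOver_le ?_
    rw [withExp_eq]
    refine (addExp_mono ?_).trans (addExp_span_subset T.hE (subset_acl_union F (addExp T.E (Set.range z))))
    rintro _ ⟨a, -, rfl⟩
    rw [hZ]
    exact Submodule.sum_mem _ fun j _ => Submodule.smul_mem _ _ (Submodule.subset_span ⟨j, rfl⟩)
  have hclo : Subfield.closure ((Subfield.closure A : Set K) ∪ Set.range (coords (matAct M p))) ≤ F :=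
    Subfield.closure_le.2 (Set.union_subset hAF hMF)
  have h3 : (Module.finrank ℚ (U.comap Z) : Cardinal) + (Module.finrank ℚ N' + 1) ≤ n := by
    rw [← hfr]
    refine (add_le_add h1 ((h2.trans hle).trans (trdegOver_anti hclo _))).trans ?_
    rw [← trdegOver_add, ← hdim, ← hzt]
    refine trdegOver_le (Set.union_subset ?_ (subset_acl_union _ _))
    rintro _ ⟨i, rfl⟩
    refine coords_matAct_mem M (fun i => ?_) i
    rw [← hrange]
    exact subset_acl_union _ (Set.range (coords p)) (Set.mem_range_self i)
  have h4 : Module.finrank ℚ (U.comap Z) + (Module.finrank ℚ N' + 1) ≤ n := by exact_mod_cast h3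
  omega

end TriangularExp

end Countable

end ExpField

/-! ### Saturation yields a transcendence basis of full size -/

namespace ExpField

open FirstOrder FirstOrder.Language FirstOrder.Ring

/-- In a saturated infinite field, elements avoiding all algebraic equations over a small set exist. -/
theorem exists_not_isAlgebraic_of_isSaturated {K : Type*} [Field K] [Infinite K]
    (hK : IsSaturatedField K) {A : Set K} (hA : #A < #K) :
    ∃ x : K, x ∉ acl A := by
  let _ := compatibleRingOfRing K
  have hK' : Language.ring.IsSaturated K := hK
  -- Formulas see only integer polynomials in the parameters and the variable; `φ g` says that such
  -- a polynomial does not vanish.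
  let Q : FreeCommRing (A ⊕ Unit) →+* Polynomial K :=
    FreeCommRing.lift (Sum.elim (fun a => Polynomial.C a.1) fun _ => Polynomial.X)
  let φ : FreeCommRing (A ⊕ Unit) → (Language.ring.withConstants A).Formula Unit := fun g =>
    ((termOfFreeCommRing g).varsToConstants.equal (termOfFreeCommRing 0).varsToConstants).not
  have hφ : ∀ g x, (φ g).Realize (fun _ => x) ↔ (Q g).eval x ≠ 0 := by
    intro g x
    have h1 : ∀ g, (termOfFreeCommRing g).realize
        (Sum.elim (fun a => (((Language.ring.con a : (Language.ring.withConstants A).Constants)) : K))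
          fun _ : Unit => x) = (Q g).eval x := by
      intro g
      rw [realize_termOfFreeCommRing]
      have : FreeCommRing.lift (Sum.elim (fun a : A =>
          (((Language.ring.con a : (Language.ring.withConstants A).Constants)) : K)) fun _ : Unit => x) =
          (Polynomial.evalRingHom x).comp Q := by
        apply FreeCommRing.hom_ext
        rintro (a | a) <;> simp [Q]
      rw [this]
      rfl
    rw [Formula.realize_not, Formula.realize_equal, Term.realize_varsToConstants,
      Term.realize_varsToConstants, h1, h1, map_zero, Polynomial.eval_zero]
  obtain ⟨x, hx⟩ := hK' A hA (φ '' {g | Q g ≠ 0}) (by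
    intro q hq
    have hq' : ∀ ψ ∈ q, ∃ g, Q g ≠ 0 ∧ φ g = ψ := fun ψ h => hq h
    choose! g hg hgφ using hq'
    -- Finitely many non-zero polynomials have a common non-root, since their product is non-zero
    -- and the field is infinite.
    have hne : ∏ ψ ∈ q, Q (g ψ) ≠ 0 := Finset.prod_ne_zero_iff.2 hg
    obtain ⟨x, hx⟩ : ∃ x, (∏ ψ ∈ q, Q (g ψ)).eval x ≠ 0 := by
      by_contra! h
      exact hne (Polynomial.funext (by simpa using h))
    refine ⟨x, fun ψ hψ => ?_⟩
    rw [← hgφ ψ hψ, hφ]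
    rw [Polynomial.eval_prod] at hx
    exact Finset.prod_ne_zero_iff.1 hx ψ hψ)
  refine ⟨x, fun hxA => ?_⟩
  obtain ⟨q, hq, hqx⟩ := mem_acl.1 hxA
  have hC : ∀ a ∈ Subring.closure A, Polynomial.C a ∈ Q.range := by
    intro a ha
    have : Subring.closure A ≤ Q.range.comap Polynomial.C :=
      Subring.closure_le.2 fun a ha => ⟨FreeCommRing.of (Sum.inl ⟨a, ha⟩), by simp [Q]⟩
    exact this ha
  have hX : Polynomial.X ∈ Q.range := ⟨FreeCommRing.of (Sum.inr ()), by simp [Q]⟩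
  choose f hf d hd hfd using fun i => Subfield.mem_closure_iff.1 (q.coeff i).2
  -- Denominators for the coefficients: an equation over the field generated by `A` must become one
  -- over the ring generated by `A`.
  have hd0 : ∀ i, ∃ e ∈ Subring.closure A, e ≠ 0 ∧ e * q.coeff i ∈ Subring.closure A := fun i => by
    by_cases h : d i = 0
    · exact ⟨1, one_mem _, one_ne_zero, by rw [← hfd, h]; simp [zero_mem]⟩
    · exact ⟨d i, hd i, h, by rw [← hfd, mul_div_cancel₀ _ h]; exact hf i⟩
  choose e he he0 hec using hd0
  obtain ⟨g, hg⟩ : Polynomial.C (∏ i ∈ Finset.range (q.natDegree + 1), e i) *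
      q.map (algebraMap _ K) ∈ Q.range := by
    rw [Polynomial.map, Polynomial.eval₂_eq_sum_range, Finset.mul_sum]
    refine sum_mem fun i hi => ?_
    rw [← Finset.prod_erase_mul _ _ hi, ← mul_assoc, map_mul, RingHom.comp_apply, mul_assoc (Polynomial.C _),
      ← map_mul]
    refine mul_mem (mul_mem (hC _ (prod_mem fun j _ => he j)) (hC _ (hec i))) (pow_mem hX i)
  have h1 := hx (φ g) ⟨g, by
    rw [Set.mem_ofPred_eq, hg]
    refine mul_ne_zero (Polynomial.C_ne_zero.2 (Finset.prod_ne_zero_iff.2 fun i _ => he0 i)) ?_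
    exact (Polynomial.map_ne_zero_iff (FaithfulSMul.algebraMap_injective _ _)).2 hq, rfl⟩
  rw [hφ, hg, Polynomial.eval_mul, Polynomial.eval_map_algebraMap, hqx, mul_zero] at h1
  exact h1 rfl

theorem mem_acl_of_isAlgebraic_adjoin_rat {K : Type*} [Field K] [CharZero K] {s : Set K} {x : K}
    (hx : IsAlgebraic (Algebra.adjoin ℚ s) x) : x ∈ acl s := by
  rw [← IntermediateField.isAlgebraic_adjoin_iff] at hx
  have h1 : (IntermediateField.adjoin ℚ s).toSubfield = Subfield.closure s := by
    refine le_antisymm ?_ (Subfield.closure_le.2 (IntermediateField.subset_adjoin ℚ s))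
    refine Subfield.closure_le.2 (Set.union_subset ?_ Subfield.subset_closure)
    rintro _ ⟨q, rfl⟩
    rw [eq_ratCast]
    exact SubfieldClass.ratCast_mem _ q
  rw [mem_acl, ← h1]
  exact hx

/-- A saturated algebraically closed field has a transcendence basis indexed by itself. -/
theorem exists_isTranscendenceBasis_of_isSaturated {K : Type*} [Field K] [IsAlgClosed K] [CharZero K]
    (hK : IsSaturatedField K) : ∃ x : K → K, IsTranscendenceBasis ℚ x := by
  obtain ⟨s, hs⟩ := exists_isTranscendenceBasis ℚ K
  have hcard : #K = #s := by
    rcases lt_or_ge ℵ₀ #K with h | h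
    · simpa using IsAlgClosed.cardinal_eq_cardinal_transcendence_basis_of_aleph0_lt _ hs
        Cardinal.mk_le_aleph0 h
    · have hK0 : #K = ℵ₀ := le_antisymm h (Cardinal.aleph0_le_mk K)
      -- Only a countable `K` needs saturation: a finite transcendence basis would be small, so some
      -- element would be transcendental over it.
      rcases lt_or_ge #s ℵ₀ with h' | h'
      · exfalso
        obtain ⟨x, hx⟩ := exists_not_isAlgebraic_of_isSaturated hK (A := s) (by rwa [hK0])
        have h1 := hs.isAlgebraic.isAlgebraic x
        rw [Subtype.range_coe] at h1
        exact hx (mem_acl_of_isAlgebraic_adjoin_rat h1)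
      · exact le_antisymm (hK0.trans_le h') (Cardinal.mk_set_le s)
  obtain ⟨e⟩ := Cardinal.eq.1 hcard
  exact ⟨_, hs.comp_equiv e⟩

end ExpField

/-! ### The nonstandard complex numbers -/

namespace ExpField

/-- An exponential field with a norm to an ordered field, like the nonstandard complex numbers, in
which positive elements can be found below the norms of any non-zero elements that are not more
than those of `Y`. -/
structure HyperComplex (Y Ω R : Type*) [Field Ω] [CharZero Ω] [Field R] [LinearOrder R]
    [IsStrictOrderedRing R] where
  conj : Ω ≃+* Ω
  conj_conj : ∀ x, conj (conj x) = x
  I : Ω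
  I_mul_I : I * I = -1
  conj_I : conj I = -I
  norm : Ω →*₀ R
  norm_nonneg : ∀ x, 0 ≤ norm x
  norm_add_le : ∀ x y, norm (x + y) ≤ norm x + norm y
  norm_conj : ∀ x, norm (conj x) = norm x
  ofReal : R →+* Ω
  norm_ofReal : ∀ r, norm (ofReal r) = |r|
  conj_ofReal : ∀ r, conj (ofReal r) = ofReal r
  exists_ofReal : ∀ x, conj x = x → ∃ r, ofReal r = x
  exists_mul_self : ∀ r : R, 0 ≤ r → ∃ s, s * s = r
  exp : Ω → Ω
  exp_zero : exp 0 = 1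
  exp_add : ∀ x y, exp (x + y) = exp x * exp y
  exp_surj : ∀ y, y ≠ 0 → ∃ x, exp x = y
  conj_exp : ∀ x, conj (exp x) = exp (conj x)
  eq_zero_of_real : ∀ x, conj x = x → exp x = 1 → x = 0
  eq_zero_of_small : ∀ x, norm x ≤ 1 → exp x = 1 → x = 0
  norm_exp_sub_one_le : ∀ x, norm x ≤ 1 → norm (exp x - 1) ≤ 2 * norm x
  period : Ω
  conj_period : conj period = -period
  exp_rat_mul_period : ∀ q : ℚ, exp (q * period) = 1 ↔ ∃ m : ℤ, q = m
  exists_small : ∀ A : Set Ω, 0 ∉ A → Nonempty (A ↪ Y) →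
    ∃ r : R, 0 < r ∧ ∀ a ∈ A, r < norm a

section Germ

open Filter

variable {J : Type*} (φ : Ultrafilter J)

/-- A monic polynomial over germs lifts to a monic polynomial of the same degree over functions, and
roots are chosen index by index. -/
theorem isAlgClosed_germ {k : Type*} [Field k] [IsAlgClosed k] : IsAlgClosed (Germ (φ : Filter J) k) := by
  refine .of_exists_root _ fun p hp hirr => ?_
  let Φ : (J → k) →+* Germ (φ : Filter J) k := Germ.coeRingHom _
  have hΦ : Function.Surjective Φ := fun x => x.inductionOn fun f => ⟨f, rfl⟩
  obtain ⟨P, hP, hdeg, hPm⟩ := Polynomial.lifts_and_natDegree_eq_and_monic (f := Φ) (p := p)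
    (by rw [Polynomial.lifts_iff_coeff_lifts]; exact fun i => hΦ _) hp
  have hroot : ∀ i, ∃ z, (P.map (Pi.evalRingHom (fun _ : J => k) i)).eval z = 0 := fun i => by
    refine IsAlgClosed.exists_root _ fun h => ?_
    rw [Polynomial.degree_eq_natDegree (hPm.map _).ne_zero, hPm.natDegree_map, hdeg] at h
    exact hirr.natDegree_pos.ne' (by exact_mod_cast h)
  choose z hz using hroot
  have hz' : P.eval z = 0 := by
    funext i
    exact (Polynomial.eval_map_apply (Pi.evalRingHom (fun _ : J => k) i) z).symm.trans (hz i)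
  refine ⟨Φ z, ?_⟩
  rw [← hP, Polynomial.eval_map_apply, hz', map_zero]

/-- The entrywise extension of a ring homomorphism to germs. -/
def germMap {A B : Type*} [Semiring A] [Semiring B] (f : A →+* B) :
    Germ (φ : Filter J) A →+* Germ (φ : Filter J) B where
  toFun := Germ.map f
  map_zero' := congrArg (Germ.ofFun (l := (φ : Filter J))) (funext fun _ => map_zero f)
  map_one' := congrArg (Germ.ofFun (l := (φ : Filter J))) (funext fun _ => map_one f)
  map_add' x y := Germ.inductionOn₂ x y fun _ _ => congrArg Germ.ofFun (funext fun _ => map_add f _ _)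
  map_mul' x y := Germ.inductionOn₂ x y fun _ _ => congrArg Germ.ofFun (funext fun _ => map_mul f _ _)

instance charZero_germ {k : Type*} [Field k] [CharZero k] : CharZero (Germ (φ : Filter J) k) :=
  charZero_of_injective_ringHom (f := (algebraMap k (J → k)).comp (RingHom.id k) |> (Germ.coeRingHom (φ : Filter J)).comp)
    (RingHom.injective _)

open Complex in
/-- The nonstandard complex numbers. -/
noncomputable def hyperComplex (Y : Type*) (φ : Ultrafilter (Finset Y)) (hφ : (φ : Filter (Finset Y)) ≤ atTop) :
    HyperComplex Y (Germ (φ : Filter (Finset Y)) ℂ) (Germ (φ : Filter (Finset Y)) ℝ) where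
  conj := RingEquiv.ofRingHom (germMap φ (starRingEnd ℂ)) (germMap φ (starRingEnd ℂ))
    (RingHom.ext fun x => x.inductionOn fun f => congrArg Germ.ofFun (funext fun i => conj_conj (f i)))
    (RingHom.ext fun x => x.inductionOn fun f => congrArg Germ.ofFun (funext fun i => conj_conj (f i)))
  conj_conj x := x.inductionOn fun f => congrArg Germ.ofFun (funext fun i => conj_conj (f i))
  I := ↑(I : ℂ)
  I_mul_I := congrArg (Germ.ofFun (l := (φ : Filter (Finset Y)))) (funext fun _ => I_mul_I)
  conj_I := congrArg (Germ.ofFun (l := (φ : Filter (Finset Y)))) (funext fun _ => conj_I)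
  norm :=
    { toFun := Germ.map norm
      map_zero' := congrArg (Germ.ofFun (l := (φ : Filter (Finset Y)))) (funext fun _ => norm_zero)
      map_one' := congrArg (Germ.ofFun (l := (φ : Filter (Finset Y)))) (funext fun _ => norm_one)
      map_mul' := fun x y => Germ.inductionOn₂ x y fun _ _ =>
        congrArg Germ.ofFun (funext fun _ => norm_mul _ _) }
  norm_nonneg x := x.inductionOn fun f => Germ.coe_le.2 (Eventually.of_forall fun i => norm_nonneg (f i))
  norm_add_le x y := Germ.inductionOn₂ x y fun f g =>
    Germ.coe_le.2 (Eventually.of_forall fun i => norm_add_le (f i) (g i))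
  norm_conj x := x.inductionOn fun f => congrArg Germ.ofFun (funext fun i => norm_conj (f i))
  ofReal := germMap φ ofRealHom
  norm_ofReal r := r.inductionOn fun f => congrArg Germ.ofFun (funext fun i => norm_real (f i))
  conj_ofReal r := r.inductionOn fun f => congrArg Germ.ofFun (funext fun i => conj_ofReal (f i))
  exists_ofReal x := x.inductionOn fun f hf => ⟨↑fun i => (f i).re, Germ.coe_eq.2 <|
    (Germ.coe_eq.1 hf).mono fun i hi => conj_eq_iff_re.1 hi⟩
  exists_mul_self r := r.inductionOn fun f hf => ⟨↑fun i => √(f i), Germ.coe_eq.2 <|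
    (Germ.coe_le.1 hf).mono fun i hi => Real.mul_self_sqrt hi⟩
  exp := Germ.map exp
  exp_zero := congrArg (Germ.ofFun (l := (φ : Filter (Finset Y)))) (funext fun _ => exp_zero)
  exp_add x y := Germ.inductionOn₂ x y fun f g => congrArg Germ.ofFun (funext fun i => exp_add (f i) (g i))
  exp_surj y := y.inductionOn fun f hf => ⟨↑fun i => log (f i), Germ.coe_eq.2 <|
    (Ultrafilter.eventually_not.2 fun h => hf (Germ.coe_eq.2 h)).mono fun i hi => exp_log hi⟩
  conj_exp x := x.inductionOn fun f => congrArg Germ.ofFun (funext fun i => (exp_conj (f i)).symm)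
  eq_zero_of_real x := x.inductionOn fun f hf he => Germ.coe_eq.2 <| by
    filter_upwards [Germ.coe_eq.1 hf, Germ.coe_eq.1 he] with i h1 h2
    obtain ⟨r, hr⟩ := conj_eq_iff_real.1 h1
    change exp (f i) = 1 at h2
    rw [hr, ← ofReal_exp, ofReal_eq_one, Real.exp_eq_one_iff] at h2
    simp [hr, h2]
  eq_zero_of_small x := x.inductionOn fun f hf he => Germ.coe_eq.2 <| by
    filter_upwards [Germ.coe_le.1 hf, Germ.coe_eq.1 he] with i h1 h2
    change exp (f i) = 1 at h2
    change ‖f i‖ ≤ 1 at h1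
    obtain ⟨n, hn⟩ := exp_eq_one_iff.1 h2
    rw [hn] at h1
    have h3 : ‖(n : ℂ) * (2 * Real.pi * I)‖ = |(n : ℝ)| * (2 * Real.pi) := by
      simp [abs_of_pos Real.pi_pos]
    rw [h3] at h1
    by_contra h0
    have hn0 : n ≠ 0 := by rintro rfl; simp [hn] at h0
    have : (1 : ℝ) ≤ |(n : ℝ)| := by exact_mod_cast Int.one_le_abs hn0
    nlinarith [Real.pi_gt_three]
  norm_exp_sub_one_le x := x.inductionOn fun f hf => Germ.coe_le.2 <| by
    filter_upwards [Germ.coe_le.1 hf] with i h1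
    exact norm_exp_sub_one_le h1
  period := ↑(2 * Real.pi * I : ℂ)
  conj_period := congrArg (Germ.ofFun (l := (φ : Filter (Finset Y)))) (funext fun _ => by
    simp [map_ofNat])
  exp_rat_mul_period q := by
    have h1 : (q : Germ (φ : Filter (Finset Y)) ℂ) = Germ.ofFun fun _ => (q : ℂ) :=
      (map_ratCast ((algebraMap ℂ (Finset Y → ℂ)) |> (Germ.coeRingHom (φ : Filter (Finset Y))).comp) q).symm
    rw [h1]
    have h2 : Germ.map exp ((Germ.ofFun fun _ => (q : ℂ) : Germ (φ : Filter (Finset Y)) ℂ) *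
        (Germ.ofFun fun _ => (2 * Real.pi * I : ℂ))) = 1 ↔
      ∀ᶠ i in (φ : Filter (Finset Y)), exp (q * (2 * Real.pi * I)) = 1 := Germ.coe_eq
    change Germ.map exp ((Germ.ofFun fun _ => (q : ℂ) : Germ (φ : Filter (Finset Y)) ℂ) *
        (Germ.ofFun fun _ => (2 * Real.pi * I : ℂ))) = 1 ↔ _
    rw [h2, eventually_const, exp_eq_one_iff]
    refine exists_congr fun n => ?_
    have : (2 * Real.pi * I : ℂ) ≠ 0 := by simp [Real.pi_ne_zero]
    rw [mul_left_inj' this]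
    exact_mod_cast Iff.rfl
  exists_small A h0 hA := by
    obtain ⟨g⟩ := hA
    choose f hf using fun a : A => a.1.inductionOn (p := fun x => ∃ f : Finset Y → ℂ, ↑f = x) fun f => ⟨f, rfl⟩
    classical
    let h : Y → Finset Y → ℝ := fun y i => if hy : ∃ a, g a = y then ‖f hy.choose i‖⁻¹ else 0
    have hh0 : ∀ y i, 0 ≤ h y i := fun y i => by
      dsimp only [h]; split_ifs <;> positivity
    have hh : ∀ a i, h (g a) i = ‖f a i‖⁻¹ := fun a i => by
      have hex : ∃ a', g a' = g a := ⟨a, rfl⟩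
      dsimp only [h]
      rw [dif_pos hex, g.injective hex.choose_spec]
    have hpos : ∀ i : Finset Y, 0 < 1 + ∑ y ∈ i, h y i := fun i =>
      add_pos_of_pos_of_nonneg one_pos (Finset.sum_nonneg fun y _ => hh0 y i)
    -- At the index `i` this bound is below the non-zero values `‖f a i‖` with `g a ∈ i`. Since the
    -- ultrafilter refines `atTop`, a given `g a` lies in almost every `i`. The summand `1` keeps
    -- the denominator positive.
    refine ⟨↑fun i : Finset Y => (1 + ∑ y ∈ i, h y i)⁻¹,
      Germ.coe_pos.2 (Eventually.of_forall fun i => inv_pos.2 (hpos i)), fun a ha => ?_⟩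
    rw [show a = ↑(f ⟨a, ha⟩) from (hf ⟨a, ha⟩).symm]
    refine Germ.coe_lt.2 ?_
    have h1 : ∀ᶠ i in (φ : Filter (Finset Y)), f ⟨a, ha⟩ i ≠ 0 := by
      refine Ultrafilter.eventually_not.2 fun h => h0 ?_
      have : a = 0 := by
        rw [show a = ↑(f ⟨a, ha⟩) from (hf ⟨a, ha⟩).symm]
        exact Germ.coe_eq.2 h
      exact this ▸ ha
    filter_upwards [h1, hφ (mem_atTop {g ⟨a, ha⟩})] with i hi1 hi2
    have h2 : ‖f ⟨a, ha⟩ i‖⁻¹ < 1 + ∑ y ∈ i, h y i := by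
      rw [← hh]
      have := Finset.single_le_sum (f := fun y => h y i) (fun y _ => hh0 y i)
        (show g ⟨a, ha⟩ ∈ i from hi2 (Finset.mem_singleton_self _))
      linarith
    exact (inv_lt_comm₀ (hpos i) (norm_pos_iff.2 hi1)).2 h2

end Germ

end ExpField

/-! ### Bases adapted to filtrations of rational vector spaces -/

namespace ExpField

section LinearAlgebra

variable {V : Type*} [AddCommGroup V] [Module ℚ V]

/-- The family `v` is linearly independent modulo `X`. -/
def LinIndepMod {ι : Type*} (X : Submodule ℚ V) (v : ι → V) : Prop :=
  LinearIndependent ℚ (X.mkQ ∘ v)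

theorem linIndepMod_iff {ι : Type*} {X : Submodule ℚ V} {v : ι → V} :
    LinIndepMod X v ↔ ∀ f : ι →₀ ℚ, Finsupp.linearCombination ℚ v f ∈ X → f = 0 := by
  rw [LinIndepMod, linearIndependent_iff]
  refine forall_congr' fun f => ?_
  rw [← Finsupp.apply_linearCombination, Submodule.mkQ_apply, Submodule.Quotient.mk_eq_zero]

theorem LinIndepMod.mono {ι : Type*} {X X' : Submodule ℚ V} {v : ι → V} (h : LinIndepMod X' v)
    (hX : X ≤ X') : LinIndepMod X v :=
  linIndepMod_iff.2 fun f hf => linIndepMod_iff.1 h f (hX hf)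

theorem LinIndepMod.comp {ι κ : Type*} {X : Submodule ℚ V} {v : ι → V} (h : LinIndepMod X v)
    {g : κ → ι} (hg : Function.Injective g) : LinIndepMod X (v ∘ g) :=
  LinearIndependent.comp h g hg

theorem LinIndepMod.eq_zero {ι : Type*} {X : Submodule ℚ V} {v : ι → V} (h : LinIndepMod X v) {x : V}
    (hx : x ∈ Submodule.span ℚ (Set.range v)) (hX : x ∈ X) : x = 0 := by
  obtain ⟨f, rfl⟩ := Finsupp.mem_span_range_iff_exists_finsupp.1 hx
  have := linIndepMod_iff.1 h f hX
  simp [this]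

theorem linIndepMod_of_disjoint {ι : Type*} {X : Submodule ℚ V} {v : ι → V} (hv : LinearIndependent ℚ v)
    (h : Disjoint (Submodule.span ℚ (Set.range v)) X) : LinIndepMod X v := by
  rw [linIndepMod_iff]
  intro f hf
  refine linearIndependent_iff.1 hv f ?_
  exact Submodule.disjoint_def.1 h _ (Finsupp.mem_span_range_iff_exists_finsupp.2 ⟨f, rfl⟩) hf

/-- In a non-trivial relation modulo `X`, the vector of largest index would lie in its own `P (ρ i)`
together with all the others. -/
theorem linIndepMod_of_triangular {ι Λ : Type*} [LinearOrder Λ] {X : Submodule ℚ V} {v : ι → V}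
    {ρ : ι → Λ} (hρ : Function.Injective ρ) (P : Λ → Submodule ℚ V) (hX : ∀ i, X ≤ P (ρ i))
    (hv : ∀ i, v i ∉ P (ρ i)) (hlt : ∀ i j, ρ i < ρ j → v i ∈ P (ρ j)) : LinIndepMod X v := by
  classical
  rw [linIndepMod_iff]
  intro f hf
  by_contra h0
  obtain ⟨i, hi, hmax⟩ := f.support.exists_max_image ρ (Finsupp.support_nonempty_iff.2 h0)
  apply hv i
  have h1 := hX i hf
  rw [Finsupp.linearCombination_apply, Finsupp.sum, ← Finset.add_sum_erase _ _ hi] at h1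
  have h2 : ∑ j ∈ f.support.erase i, f j • v j ∈ P (ρ i) := by
    refine Submodule.sum_mem _ fun j hj => Submodule.smul_mem _ _ (hlt j i ?_)
    rw [Finset.mem_erase] at hj
    exact (hmax j hj.2).lt_of_ne fun h => hj.1 (hρ h)
  exact (Submodule.smul_mem_iff _ (Finsupp.mem_support_iff.1 hi)).1 ((Submodule.add_mem_iff_left _ h2).1 h1)

/-- The part of highest degree of a relation is a relation modulo the stage of that degree. -/
theorem linIndepMod_of_filtered {ι : Type*} {X : ℕ → Submodule ℚ V} (hX : Monotone X) {v : ι → V}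
    {deg : ι → ℕ} (hv : ∀ i, v i ∈ X (deg i + 1))
    (h : ∀ n, LinIndepMod (X n) fun i : {i // deg i = n} => v i) : LinIndepMod (X 0) v := by
  classical
  rw [linIndepMod_iff]
  intro f hf
  by_contra h0
  obtain ⟨i, hi, hmax⟩ := f.support.exists_max_image deg (Finsupp.support_nonempty_iff.2 h0)
  have h1 := hX (Nat.zero_le (deg i)) hf
  rw [Finsupp.linearCombination_apply, Finsupp.sum,
    ← Finset.sum_filter_add_sum_filter_not _ (fun j => deg j = deg i)] at h1
  have h2 : ∑ j ∈ f.support.filter (fun j => ¬ deg j = deg i), f j • v j ∈ X (deg i) := by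
    refine Submodule.sum_mem _ fun j hj => Submodule.smul_mem _ _ (hX ?_ (hv j))
    rw [Finset.mem_filter] at hj
    exact (hmax j hj.1).lt_of_ne hj.2
  have h3 := (Submodule.add_mem_iff_left _ h2).1 h1
  have h4 := linIndepMod_iff.1 (h (deg i)) (f.subtypeDomain (fun j => deg j = deg i)) (by
    convert h3 using 1
    rw [Finsupp.linearCombination_apply, Finsupp.sum, Finsupp.support_subtypeDomain]
    exact Finset.sum_subtype_eq_sum_filter (s := f.support) (fun j => f j • v j))
  exact Finsupp.mem_support_iff.1 hi (DFunLike.congr_fun h4 ⟨i, rfl⟩)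

theorem le_span_of_filtered {ι : Type*} {X : ℕ → Submodule ℚ V} {v : ι → V} {deg : ι → ℕ}
    (h : ∀ n, X (n + 1) ≤ X n ⊔ Submodule.span ℚ (v '' {i | deg i = n})) (n : ℕ) :
    X n ≤ X 0 ⊔ Submodule.span ℚ (Set.range v) := by
  induction n with
  | zero => exact le_sup_left
  | succ n ih =>
    refine (h n).trans (sup_le ih (le_sup_of_le_right (Submodule.span_mono ?_)))
    exact Set.image_subset_range _ _

theorem LinIndepMod.sup_span {Y : Type*} {X : Submodule ℚ V} {w : Bool → Y → V}
    (h : LinIndepMod X fun p : Bool × Y => w p.1 p.2) :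
    LinIndepMod (X ⊔ Submodule.span ℚ (Set.range (w false))) (w true) := by
  classical
  rw [linIndepMod_iff] at h ⊢
  intro f hf
  obtain ⟨x, hx, y, hy, hxy⟩ := Submodule.mem_sup.1 hf
  obtain ⟨g, rfl⟩ := Finsupp.mem_span_range_iff_exists_finsupp.1 hy
  have h1 := h (f.mapDomain (fun y => (true, y)) - g.mapDomain (fun y => (false, y))) (by
    rw [map_sub, Finsupp.linearCombination_mapDomain, Finsupp.linearCombination_mapDomain]
    convert hx using 1
    rw [sub_eq_iff_eq_add, Finsupp.linearCombination_apply ℚ g]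
    exact hxy.symm)
  ext y
  have h2 := DFunLike.congr_fun h1 (true, y)
  rw [Finsupp.sub_apply, Finsupp.mapDomain_apply (Prod.mk_right_injective _),
    Finsupp.mapDomain_of_notMem_range _ _ (by simp), sub_zero] at h2
  exact h2

/-- A complement that is compatible with a finite filtration. -/
theorem exists_adapted_compl (S : Submodule ℚ V) (N : ℕ) (G : ℕ → Submodule ℚ V) (hG : Antitone G)
    (hN : ∀ m, N ≤ m → G m = ⊥) :
    ∃ D ≤ G 0, Disjoint D S ∧ ∀ m, G m ≤ (G m ⊓ S) ⊔ D := by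
  induction N generalizing G with
  | zero => exact ⟨⊥, bot_le, disjoint_bot_left, fun m => by rw [hN m (Nat.zero_le _)]; exact bot_le⟩
  | succ N ih =>
    obtain ⟨D₁, hD₁, hdis, had⟩ := ih (fun m => G (m + 1)) (fun a b h => hG (Nat.succ_le_succ h))
      fun m hm => hN _ (Nat.succ_le_succ hm)
    -- By the modular law, `T ⊓ G 0` complements `(G 0 ⊓ S) ⊔ D₁` inside `G 0`. The finer steps are
    -- already handled by `D₁`.
    obtain ⟨T, hT⟩ := Submodule.exists_isCompl ((G 0 ⊓ S) ⊔ D₁)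
    have hD₁0 : D₁ ≤ G 0 := hD₁.trans (hG (Nat.zero_le _))
    have hle : (G 0 ⊓ S) ⊔ D₁ ≤ G 0 := sup_le inf_le_left hD₁0
    refine ⟨D₁ ⊔ (T ⊓ G 0), sup_le hD₁0 inf_le_right, ?_, fun m => ?_⟩
    · rw [Submodule.disjoint_def]
      intro x hx hxS
      obtain ⟨d₁, h₁, d₂, h₂, rfl⟩ := Submodule.mem_sup.1 hx
      have h3 : d₁ + d₂ ∈ G 0 ⊓ S := ⟨add_mem (hD₁0 h₁) h₂.2, hxS⟩
      have h4 : d₂ ∈ (G 0 ⊓ S) ⊔ D₁ := by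
        have := sub_mem (Submodule.mem_sup_left (T := D₁) h3) (Submodule.mem_sup_right (S := G 0 ⊓ S) h₁)
        rwa [add_sub_cancel_left] at this
      have h5 := Submodule.disjoint_def.1 hT.disjoint d₂ h4 h₂.1
      rw [h5, add_zero] at hxS ⊢
      exact Submodule.disjoint_def.1 hdis d₁ h₁ hxS
    · rcases m with _ | m
      · have h1 : G 0 ≤ ((G 0 ⊓ S) ⊔ D₁) ⊔ (T ⊓ G 0) := by
          rw [← sup_inf_assoc_of_le T hle, hT.codisjoint.eq_top, top_inf_eq]
        rwa [sup_assoc] at h1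
      · exact (had m).trans (sup_le_sup_left le_sup_left _)

end LinearAlgebra

universe u

variable {V Y : Type u} [AddCommGroup V] [Module ℚ V]

theorem mk_le_rank_of_linIndepMod {S D : Submodule ℚ V}
    {r : Y → V} (hr : LinIndepMod S r) (h : ∀ y, r y ∈ S ⊔ D) :
    #Y ≤ Module.rank ℚ D := by
  have h' : ∀ y, ∃ d : D, S.mkQ (r y) = S.mkQ d := fun y => by
    obtain ⟨s, hs, d, hd, hsd⟩ := Submodule.mem_sup.1 (h y)
    refine ⟨⟨d, hd⟩, ?_⟩
    rw [← hsd, map_add, Submodule.mkQ_apply, (Submodule.Quotient.mk_eq_zero S).2 hs, zero_add]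
  choose d hd using h'
  have h1 : LinearIndependent ℚ ((S.mkQ ∘ₗ D.subtype) ∘ d) := by
    have : (S.mkQ ∘ₗ D.subtype) ∘ d = S.mkQ ∘ r := funext fun y => (hd y).symm
    rw [this]
    exact hr
  exact (h1.of_comp).cardinal_le_rank

/-- The first part of a step of a filtration with a distinguished family in each degree. -/
def stepSpan (X : ℕ → Submodule ℚ V) (w : ℕ → Bool → Y → V) : ℕ → Submodule ℚ V
  | 0 => X 0
  | n + 1 => X (n + 1) ⊔ Submodule.span ℚ (Set.range (w (n + 1) false))

/-- A family in each degree of a filtration, linearly independent modulo the previous degree, can be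
completed to a basis by complementary families of the same size, compatible with filtrations `G`. -/
theorem exists_filtered_basis {X : ℕ → Submodule ℚ V} (hX : Monotone X) (w : ℕ → Bool → Y → V)
    (hwX : ∀ n r y, w n r y ∈ X (n + 1))
    (hw : ∀ n, LinIndepMod (X n) fun p : Bool × Y => w n p.1 p.2)
    (G : ℕ → ℕ → Submodule ℚ V) (hG : ∀ n, Antitone (G n)) (hG0 : ∀ n, G n 0 = X (n + 1))
    (N : ℕ → ℕ) (hN : ∀ n m, N n ≤ m → G n m = ⊥)
    (hcard : ∀ n D, D ≤ X (n + 1) → Disjoint D (stepSpan X w n) →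
      (∀ m, G n m ≤ (G n m ⊓ stepSpan X w n) ⊔ D) → Module.rank ℚ D ≤ #Y) :
    ∃ b : ℕ → Y → V, (∀ n y, b n y ∈ X (n + 1)) ∧
      (∀ n m, G n m ≤ (G n m ⊓ stepSpan X w n) ⊔ Submodule.span ℚ (Set.range (b n))) ∧
      LinIndepMod (X 0) (Sum.elim (fun p : ℕ × Y => w (p.1 + 1) false p.2) fun p : ℕ × Y => b p.1 p.2) ∧
      ∀ n, X n ≤ X 0 ⊔ Submodule.span ℚ
        (Set.range (Sum.elim (fun p : ℕ × Y => w (p.1 + 1) false p.2) fun p : ℕ × Y => b p.1 p.2)) := by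
  have hS : ∀ n, X n ≤ stepSpan X w n := fun n => by
    cases n
    exacts [le_rfl, le_sup_left]
  have hS' : ∀ n, stepSpan X w n ≤ X (n + 1) := fun n => by
    cases n with
    | zero => exact hX (Nat.zero_le _)
    | succ n =>
      refine sup_le (hX (Nat.le_succ _)) (Submodule.span_le.2 ?_)
      rintro _ ⟨y, rfl⟩
      exact hwX _ _ _
  have key : ∀ n, ∃ b : Y → V, LinearIndependent ℚ b ∧ (∀ y, b y ∈ X (n + 1)) ∧
      Disjoint (Submodule.span ℚ (Set.range b)) (stepSpan X w n) ∧
      ∀ m, G n m ≤ (G n m ⊓ stepSpan X w n) ⊔ Submodule.span ℚ (Set.range b) := by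
    intro n
    obtain ⟨D, hD, hdis, had⟩ := exists_adapted_compl (stepSpan X w n) (N n) (G n) (hG n) (hN n)
    rw [hG0] at hD
    -- The reserve vectors `w n true` stay independent modulo `stepSpan X w n`, which forces the
    -- complement to have rank at least `#Y`. Exact equality lets its basis be indexed by `Y` and
    -- later be matched with generators.
    have hr : Module.rank ℚ D = #Y := by
      refine le_antisymm (hcard n D hD hdis had) ?_
      have h1 : LinIndepMod (stepSpan X w n) (w n true) := by
        cases n with
        | zero => exact (hw 0).comp (Prod.mk_right_injective true)
        | succ n => exact (hw (n + 1)).sup_span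
      have h2 := mk_le_rank_of_linIndepMod (D := D) h1 fun y => by
        have := had 0 (by rw [hG0]; exact hwX n true y)
        exact (sup_le_sup inf_le_right le_rfl : G n 0 ⊓ stepSpan X w n ⊔ D ≤ stepSpan X w n ⊔ D) this
      exact h2
    let B := Module.Basis.ofVectorSpace ℚ D
    have hB : #(Module.Basis.ofVectorSpaceIndex ℚ D) = #Y := B.mk_eq_rank''.trans hr
    obtain ⟨e⟩ := Cardinal.eq.1 hB
    let B' := B.reindex e
    have hspan : Submodule.span ℚ (Set.range fun y => (B' y : V)) = D := by
      have : (Set.range fun y => (B' y : V)) = D.subtype '' Set.range B' := by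
        rw [← Set.range_comp]; rfl
      rw [this, Submodule.span_image, B'.span_eq, Submodule.map_top, Submodule.range_subtype]
    refine ⟨fun y => B' y, ?_, fun y => hD (B' y).2, ?_, ?_⟩
    · exact B'.linearIndependent.map' D.subtype (Submodule.ker_subtype D)
    · rwa [hspan]
    · rwa [hspan]
  choose b hb hbX hdis had using key
  refine ⟨b, hbX, had, ?_⟩
  -- The stages are interleaved with the half-steps `stepSpan`: the vectors `b n` get degree `2n`,
  -- the distinguished vectors `w (n + 1) false` degree `2n + 1`.
  let X' : ℕ → Submodule ℚ V := fun m => if m % 2 = 0 then stepSpan X w (m / 2) else X (m / 2 + 1)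
  have hX'0 : ∀ n, X' (2 * n) = stepSpan X w n := fun n => by
    simp [X']
  have hX'1 : ∀ n, X' (2 * n + 1) = X (n + 1) := fun n => by
    have h1 : (2 * n + 1) / 2 = n := by omega
    simp [X', h1]
  have hX'm : Monotone X' := monotone_nat_of_le_succ fun m => by
    obtain ⟨n, rfl | rfl⟩ := Nat.even_or_odd' m
    · rw [hX'0, hX'1]; exact hS' n
    · rw [hX'1, show 2 * n + 1 + 1 = 2 * (n + 1) by ring, hX'0]; exact hS (n + 1)
  let deg : (ℕ × Y) ⊕ (ℕ × Y) → ℕ := Sum.elim (fun p => 2 * p.1 + 1) fun p => 2 * p.1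
  set v : (ℕ × Y) ⊕ (ℕ × Y) → V :=
    Sum.elim (fun p : ℕ × Y => w (p.1 + 1) false p.2) fun p : ℕ × Y => b p.1 p.2 with hv
  have hX00 : X' 0 = X 0 := hX'0 0
  have hwspan : ∀ n y, w (n + 1) false y ∈ stepSpan X w (n + 1) := fun n y =>
    Submodule.mem_sup_right (Submodule.subset_span ⟨y, rfl⟩)
  constructor
  · rw [← hX00]
    refine linIndepMod_of_filtered hX'm (deg := deg) ?_ fun m => ?_
    · rintro (⟨n, y⟩ | ⟨n, y⟩)
      · have : deg (Sum.inl (n, y)) + 1 = 2 * (n + 1) := by simp only [deg, Sum.elim_inl]; ring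
        rw [this, hX'0]
        exact hwspan n y
      · have : deg (Sum.inr (n, y)) + 1 = 2 * n + 1 := by simp only [deg, Sum.elim_inr]
        rw [this, hX'1]
        exact hbX n y
    · obtain ⟨n, rfl | rfl⟩ := Nat.even_or_odd' m
      · rw [hX'0]
        have h1 : ∀ i : {i // deg i = 2 * n}, ∃ y, i.1 = Sum.inr (n, y) := by
          rintro ⟨⟨k, y⟩ | ⟨k, y⟩, h⟩
          · simp only [deg, Sum.elim_inl] at h; omega
          · simp only [deg, Sum.elim_inr] at h
            obtain rfl : k = n := by omega
            exact ⟨y, rfl⟩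
        choose g hg using h1
        have hginj : Function.Injective g := fun i j h => Subtype.ext (by rw [hg, hg, h])
        have h2 := (linIndepMod_of_disjoint (hb n) (hdis n)).comp hginj
        convert h2 using 1
        funext i
        rw [hg i]
        rfl
      · rw [hX'1]
        have h1 : ∀ i : {i // deg i = 2 * n + 1}, ∃ y, i.1 = Sum.inl (n, y) := by
          rintro ⟨⟨k, y⟩ | ⟨k, y⟩, h⟩
          · simp only [deg, Sum.elim_inl] at h
            obtain rfl : k = n := by omega
            exact ⟨y, rfl⟩
          · simp only [deg, Sum.elim_inr] at h; omega
        choose g hg using h1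
        have hginj : Function.Injective g := fun i j h => Subtype.ext (by rw [hg, hg, h])
        have h2 := (hw (n + 1)).comp ((Prod.mk_right_injective false).comp hginj)
        convert h2 using 1
        funext i
        rw [hg i]
        rfl
  · intro n
    rw [← hX00]
    have h1 := le_span_of_filtered (X := X') (v := v) (deg := deg) fun m => by
      obtain ⟨n, rfl | rfl⟩ := Nat.even_or_odd' m
      · rw [hX'0, hX'1, ← hG0]
        refine (had n 0).trans (sup_le_sup inf_le_right (Submodule.span_mono ?_))
        rintro _ ⟨y, rfl⟩
        exact ⟨Sum.inr (n, y), rfl, rfl⟩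
      · rw [hX'1, show 2 * n + 1 + 1 = 2 * (n + 1) by ring, hX'0]
        refine sup_le_sup le_rfl (Submodule.span_mono ?_)
        rintro _ ⟨y, rfl⟩
        exact ⟨Sum.inl (n, y), rfl, rfl⟩
    refine le_trans ?_ (h1 (2 * n + 1))
    rw [hX'1]
    exact hX (Nat.le_succ n)

end ExpField

/-! ### Infinitesimals relative to a subfield, and the tower of generators -/

namespace ExpField

section Acl

variable {K L : Type*} [Field K] [Field L]

theorem map_mem_acl_iff (f : K →+* L) {S : Set K} {x : K} : f x ∈ acl (f '' S) ↔ x ∈ acl S := by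
  rw [mem_acl, mem_acl, ← RingHom.map_field_closure]
  exact isAlgebraic_ringHom_iff_of_comp_eq
    ((Subfield.closure S).equivMapOfInjective f f.injective) f f.injective rfl

/-- Exchange: in a dependence of `θ γ` on finitely many others, a needed generator with largest
index above `γ` would itself depend on generators below it. -/
theorem notMem_acl_compl_of_notMem_Iio {Λ : Type*} [LinearOrder Λ] {θ : Λ → K}
    (h : ∀ γ, θ γ ∉ acl (θ '' Set.Iio γ)) (γ : Λ) : θ γ ∉ acl (θ '' {γ}ᶜ) := by
  have key : ∀ T : Finset Λ, γ ∉ T → θ γ ∉ acl (θ '' T) := by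
    intro T
    induction T using Finset.induction_on_max with
    | empty => exact fun _ hγ => h γ (acl_mono (Set.image_mono (by simp)) hγ)
    | insert m s hm ih =>
      intro hγ hmem
      rw [Finset.mem_insert, not_or] at hγ
      rcases lt_or_gt_of_ne hγ.1 with h1 | h1
      · have h2 := ih hγ.2
        rw [Finset.coe_insert, Set.image_insert_eq] at hmem
        simp only [← SetLike.mem_coe, ← matroid_bot_closure_eq] at h2 hmem
        have h3 := (Matroid.closure_exchange ⟨hmem, h2⟩).1
        rw [matroid_bot_closure_eq] at h3
        refine h m (acl_mono ?_ h3)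
        rw [← Set.image_insert_eq]
        refine Set.image_mono (Set.insert_subset h1 fun x hx => hm x hx)
      · refine h γ (acl_mono (Set.image_mono fun x hx => ?_) hmem)
        rw [Finset.coe_insert] at hx
        rcases hx with rfl | hx
        exacts [h1, (hm x hx).trans h1]
  intro hγ
  obtain ⟨t, ht, hf, hx⟩ := exists_finite_mem_acl hγ
  classical
  choose g hg hgθ using fun x : t => ht x.2
  have := hf.fintype
  refine key (Finset.univ.image g) ?_ (acl_mono ?_ hx)
  · simp only [Finset.mem_image, Finset.mem_univ, true_and, not_exists]
    exact fun x => hg x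
  · intro x hx'
    exact ⟨g ⟨x, hx'⟩, by simp, hgθ ⟨x, hx'⟩⟩

theorem mk_acl_le (S : Set K) : #(acl S) ≤ max #S ℵ₀ := by
  have h1 := Subfield.cardinalMk_closure_le_max S
  have h3 := Algebra.IsAlgebraic.cardinalMk_le_max (Subfield.closure S)
    (algebraicClosure (Subfield.closure S) K)
  exact h3.trans (max_le h1 (le_max_right _ _))

end Acl

universe u

namespace HyperComplex

variable {Y Ω R : Type u} [Field Ω] [CharZero Ω] [Field R] [LinearOrder R] [IsStrictOrderedRing R]
  (H : HyperComplex Y Ω R)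

theorem norm_ratCast (q : ℚ) : H.norm (q : Ω) = |(q : R)| := by
  rw [← map_ratCast H.ofReal, H.norm_ofReal]

theorem norm_natCast (n : ℕ) : H.norm (n : Ω) = n := by
  have := H.norm_ratCast n
  simpa using this

theorem norm_neg (x : Ω) : H.norm (-x) = H.norm x := by
  have := H.norm_ratCast (-1)
  rw [neg_eq_neg_one_mul, map_mul]
  push_cast at this
  rw [this]
  simp

theorem norm_I : H.norm H.I = 1 := by
  have h1 : H.norm H.I * H.norm H.I = 1 := by
    rw [← map_mul, H.I_mul_I, H.norm_neg, map_one]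
  rcases mul_self_eq_one_iff.1 h1 with h | h
  · exact h
  · have := H.norm_nonneg H.I
    rw [h] at this
    linarith

theorem I_ne_zero : H.I ≠ 0 := fun h => by simpa [h] using H.I_mul_I

theorem I_mem_acl (S : Set Ω) : H.I ∈ acl S :=
  mem_acl_of_pow_mem (n := 2) two_pos (by rw [pow_two, H.I_mul_I]; exact neg_mem (one_mem _))

theorem exp_ne_zero (x : Ω) : H.exp x ≠ 0 := fun h => by
  have := H.exp_add x (-x)
  rw [add_neg_cancel, H.exp_zero, h, zero_mul] at this
  exact one_ne_zero this

/-- The exponential as a map to the units. -/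
def expU (x : Ω) : Ωˣ := Units.mk0 (H.exp x) (H.exp_ne_zero x)

@[simp]
theorem val_expU (x : Ω) : (H.expU x : Ω) = H.exp x := rfl

theorem axE_expU : AxE H.expU := fun x y => Units.ext (H.exp_add x y)

theorem exp_neg (x : Ω) : H.exp (-x) = (H.exp x)⁻¹ := by
  have := congrArg Units.val (H.axE_expU.map_neg x)
  rwa [Units.val_inv_eq_inv_val] at this

theorem period_ne_zero : H.period ≠ 0 := fun h => by
  have h1 := (H.exp_rat_mul_period (1 / 2)).1 (by rw [h, mul_zero, H.exp_zero])
  obtain ⟨m, hm⟩ := h1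
  have : (2 * m : ℚ) = 1 := by rw [← hm]; norm_num
  have h2 : 2 * m = 1 := by exact_mod_cast this
  omega

/-- The elements whose norm is below those of all non-zero elements of `F`. -/
def small (F : Subfield Ω) : Submodule ℚ Ω where
  carrier := {x | ∀ f ∈ F, f ≠ 0 → H.norm x < H.norm f}
  zero_mem' f _ hf := by
    rw [map_zero]
    exact (H.norm_nonneg f).lt_of_ne' ((map_ne_zero H.norm).2 hf)
  add_mem' {x y} hx hy f hf hf0 := by
    have h2 : f / 2 ∈ F := div_mem hf (ofNat_mem F 2)
    have h20 : f / 2 ≠ 0 := div_ne_zero hf0 two_ne_zero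
    have h3 : H.norm f = H.norm (f / 2) + H.norm (f / 2) := by
      have h4 : H.norm f = H.norm (f / 2) * H.norm ((2 : ℕ) : Ω) := by
        rw [← map_mul]; congr 1; push_cast; field_simp
      rw [h4, H.norm_natCast]; push_cast; ring
    rw [h3]
    exact (H.norm_add_le x y).trans_lt (add_lt_add (hx _ h2 h20) (hy _ h2 h20))
  smul_mem' q x hx f hf hf0 := by
    by_cases hq : q = 0
    · rw [hq, zero_smul, map_zero]
      exact (H.norm_nonneg f).lt_of_ne' ((map_ne_zero H.norm).2 hf0)
    have hq' : (q : Ω) ≠ 0 := by exact_mod_cast hq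
    have h1 : H.norm f = H.norm (q : Ω) * H.norm (f / q) := by
      rw [← map_mul]; congr 1; field_simp
    rw [Rat.smul_def, map_mul, h1]
    refine mul_lt_mul_of_pos_left ?_ ((H.norm_nonneg _).lt_of_ne' ((map_ne_zero H.norm).2 hq'))
    exact hx _ (div_mem hf (SubfieldClass.ratCast_mem F q)) (div_ne_zero hf0 hq')

theorem mem_small {F : Subfield Ω} {x : Ω} :
    x ∈ H.small F ↔ ∀ f ∈ F, f ≠ 0 → H.norm x < H.norm f := Iff.rfl

theorem small_anti {F G : Subfield Ω} (h : F ≤ G) : H.small G ≤ H.small F :=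
  fun _ hx f hf => hx f (h hf)

theorem eq_zero_of_mem_small {F : Subfield Ω} {x : Ω} (hx : x ∈ H.small F) (hF : x ∈ F) : x = 0 :=
  by_contra fun h => lt_irrefl _ (hx x hF h)

theorem norm_lt_one {F : Subfield Ω} {x : Ω} (hx : x ∈ H.small F) : H.norm x < 1 := by
  have := hx 1 (one_mem F) one_ne_zero
  rwa [map_one] at this

theorem mul_mem_small {F : Subfield Ω} {g x : Ω} (hg : g ∈ F) (hx : x ∈ H.small F) :
    g * x ∈ H.small F := by
  by_cases h0 : g = 0
  · rw [h0, zero_mul]; exact zero_mem _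
  intro f hf hf0
  have h1 : H.norm f = H.norm g * H.norm (f / g) := by
    rw [← map_mul]; congr 1; field_simp
  rw [map_mul, h1]
  refine mul_lt_mul_of_pos_left ?_ ((H.norm_nonneg _).lt_of_ne' ((map_ne_zero H.norm).2 h0))
  exact hx _ (div_mem hf hg) (div_ne_zero hf0 h0)

theorem mem_small_of_norm_le {F : Subfield Ω} {x y : Ω} (hx : x ∈ H.small F)
    (h : H.norm y ≤ H.norm x) : y ∈ H.small F := fun f hf hf0 => h.trans_lt (hx f hf hf0)

theorem conj_mem_small {F : Subfield Ω} {x : Ω} (hx : x ∈ H.small F) : H.conj x ∈ H.small F :=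
  H.mem_small_of_norm_le hx (H.norm_conj x).le

theorem exp_sub_one_mem_small {F : Subfield Ω} {x : Ω} (hx : x ∈ H.small F) :
    H.exp x - 1 ∈ H.small F := by
  refine H.mem_small_of_norm_le (H.mul_mem_small (ofNat_mem F 2) hx) ?_
  have h2 : H.norm (2 : Ω) = 2 := by exact_mod_cast H.norm_natCast 2
  rw [map_mul, h2]
  exact H.norm_exp_sub_one_le x (H.norm_lt_one hx).le

/-- The element `exp x - 1` is small relative to `F` and lies in `F`, so it vanishes; and `exp` has
no non-trivial kernel in the unit ball. -/
theorem eq_zero_of_exp_mem {F : Subfield Ω} {x : Ω} (hx : x ∈ H.small F) (h : H.exp x ∈ F) : x = 0 := by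
  refine H.eq_zero_of_small x (H.norm_lt_one hx).le ?_
  exact sub_eq_zero.1 (H.eq_zero_of_mem_small (H.exp_sub_one_mem_small hx) (sub_mem h (one_mem F)))

/-- The elements of finite norm. -/
def bounded : Submodule ℚ Ω where
  carrier := {x | ∃ n : ℕ, H.norm x ≤ n}
  zero_mem' := ⟨0, by simp⟩
  add_mem' := by
    rintro x y ⟨n, hn⟩ ⟨m, hm⟩
    exact ⟨n + m, (H.norm_add_le x y).trans (by push_cast; exact add_le_add hn hm)⟩
  smul_mem' := by
    rintro q x ⟨n, hn⟩
    refine ⟨⌈|q|⌉₊ * n, ?_⟩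
    rw [Rat.smul_def, map_mul, H.norm_ratCast]
    push_cast
    refine mul_le_mul ?_ hn (H.norm_nonneg x) (Nat.cast_nonneg _)
    exact_mod_cast (Rat.cast_le (K := R)).2 (Nat.le_ceil |q|)

theorem small_le_bounded (F : Subfield Ω) : H.small F ≤ H.bounded :=
  fun _ hx => ⟨1, by simpa using (H.norm_lt_one hx).le⟩

/-- The real (`false`) and the imaginary (`true`) elements. -/
def part (s : Bool) : Submodule ℚ Ω where
  carrier := {x | H.conj x = if s then -x else x}
  zero_mem' := by simp
  add_mem' {x y} hx hy := by
    cases s <;> simp_all [add_comm]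
  smul_mem' q x hx := by
    cases s <;> simp_all [Rat.smul_def]

theorem mem_part_false {x : Ω} : x ∈ H.part false ↔ H.conj x = x := Iff.rfl

theorem mem_part_true {x : Ω} : x ∈ H.part true ↔ H.conj x = -x := Iff.rfl

/-- A generator of the real or imaginary elements over the real ones. -/
def dir (s : Bool) : Ω := if s then H.I else 1

theorem dir_ne_zero (s : Bool) : H.dir s ≠ 0 := by
  cases s
  exacts [one_ne_zero, H.I_ne_zero]

theorem norm_dir (s : Bool) : H.norm (H.dir s) = 1 := by
  cases s
  exacts [map_one _, H.norm_I]

theorem dir_mem_acl (s : Bool) (S : Set Ω) : H.dir s ∈ acl S := by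
  cases s
  exacts [one_mem _, H.I_mem_acl S]

theorem dir_mul_mem_part (s : Bool) {x : Ω} (hx : x ∈ H.part false) : H.dir s * x ∈ H.part s := by
  rw [mem_part_false] at hx
  cases s
  · rw [mem_part_false, map_mul, hx]; simp [dir]
  · rw [mem_part_true, map_mul, hx]; simp [dir, H.conj_I]

theorem ofReal_mem_part (r : R) : H.ofReal r ∈ H.part false := H.conj_ofReal r

theorem disjoint_part : Disjoint (H.part false) (H.part true) := by
  rw [Submodule.disjoint_def]
  intro x h1 h2
  rw [mem_part_false] at h1
  rw [mem_part_true, h1] at h2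
  exact self_eq_neg.1 h2

/-- The real or imaginary component. -/
def comp (s : Bool) (x : Ω) : Ω := (x + if s then -H.conj x else H.conj x) / 2

theorem comp_mem_part (s : Bool) (x : Ω) : H.comp s x ∈ H.part s := by
  cases s
  · rw [mem_part_false]; simp [comp, H.conj_conj, add_comm, map_ofNat]
  · rw [mem_part_true]; simp [comp, H.conj_conj, map_ofNat]; ring

theorem comp_add_comp (x : Ω) : H.comp false x + H.comp true x = x := by
  simp only [comp, Bool.false_eq_true, if_false, if_true]
  field_simp
  ring

theorem comp_mem_small {F : Subfield Ω} {x : Ω} (hx : x ∈ H.small F) (s : Bool) :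
    H.comp s x ∈ H.small F := by
  have h1 : H.comp s x = ((1 : ℚ) / 2) • (x + if s then -H.conj x else H.conj x) := by
    rw [comp, Rat.smul_def]; push_cast; ring
  rw [h1]
  refine Submodule.smul_mem _ _ (add_mem hx ?_)
  cases s
  exacts [H.conj_mem_small hx, neg_mem (H.conj_mem_small hx)]

theorem comp_mem_of_conj_mem {F : Subfield Ω} {x : Ω} (hx : x ∈ F) (hx' : H.conj x ∈ F) (s : Bool) :
    H.comp s x ∈ F := by
  refine div_mem (add_mem hx ?_) (ofNat_mem F 2)
  cases s
  exacts [hx', neg_mem hx']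

end HyperComplex

/-- The indices of the construction. -/
@[ext]
structure Idx (Y : Type u) where
  level : ℕ
  /-- whether the element is an exponential -/
  kind : Bool
  sgn : Bool
  reserve : Bool
  elt : Y

theorem mk_idx (Y : Type u) [Infinite Y] : #(Idx Y) = #Y := by
  let e : Idx Y ≃ (ℕ × Bool × Bool × Bool) × Y :=
    { toFun := fun γ => ((γ.level, γ.kind, γ.sgn, γ.reserve), γ.elt)
      invFun := fun p => ⟨p.1.1, p.1.2.1, p.1.2.2.1, p.1.2.2.2, p.2⟩
      left_inv := fun _ => rfl
      right_inv := fun _ => rfl }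
  rw [Cardinal.mk_congr e, Cardinal.mk_prod, Cardinal.mk_eq_aleph0 (ℕ × Bool × Bool × Bool),
    Cardinal.lift_aleph0, Cardinal.lift_uzero]
  exact Cardinal.aleph0_mul_eq (Cardinal.aleph0_le_mk Y)

/-- A well-order compared lexicographically after the level: all generators of lower levels precede
those of higher ones. -/
theorem exists_linearOrder_idx (Y : Type u) : ∃ _ : LinearOrder (Idx Y), WellFoundedLT (Idx Y) ∧
    ∀ γ δ : Idx Y, γ < δ → γ.level ≤ δ.level := by
  obtain ⟨o, hwf⟩ := exists_wellFoundedLT (Idx Y)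
  let f : Idx Y → ℕ ×ₗ Idx Y := fun γ => toLex (γ.level, γ)
  have hf : Function.Injective f := fun γ δ h => (Prod.ext_iff.1 (toLex.injective h)).2
  refine ⟨LinearOrder.lift' f hf, ⟨InvImage.wf f wellFounded_lt⟩, fun γ δ h => ?_⟩
  have h1 : f γ < f δ := h
  rw [Prod.Lex.lt_iff] at h1
  rcases h1 with h1 | h1
  exacts [h1.le, h1.1.le]

theorem mk_acl_image_le {Y Ω : Type u} [Field Ω] [Infinite Y] (θ : Idx Y → Ω) (S : Set (Idx Y)) : #(acl (θ '' S)) ≤ #Y := by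
  refine (mk_acl_le _).trans (max_le ?_ (Cardinal.aleph0_le_mk Y))
  exact (Cardinal.mk_image_le).trans ((Cardinal.mk_set_le S).trans (mk_idx Y).le)

namespace HyperComplex

variable {Y Ω R : Type u} [Field Ω] [CharZero Ω] [Field R] [LinearOrder R] [IsStrictOrderedRing R]
  (H : HyperComplex Y Ω R)

/-- The element of the construction that belongs to the small number `r`. -/
def val (γ : Idx Y) (r : R) : Ω := if γ.kind then H.exp (H.dir γ.sgn * H.ofReal r) else (H.ofReal r)⁻¹

/-- A sequence of positive numbers, each of which is below everything algebraic over the elements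
that belong to the previous ones. -/
structure Tower [LinearOrder (Idx Y)] where
  u : Idx Y → R
  u_pos : ∀ γ, 0 < u γ
  u_lt : ∀ γ, ∀ f ∈ acl ((fun μ => H.val μ (u μ)) '' Set.Iio γ), f ≠ 0 → u γ < H.norm f
  le_level : ∀ γ δ : Idx Y, γ < δ → γ.level ≤ δ.level

/-- Transfinite recursion: at most `#Y` elements are algebraic over the earlier generators, so
`exists_small` provides the next value. -/
theorem nonempty_tower [Infinite Y] [LinearOrder (Idx Y)] [WellFoundedLT (Idx Y)]
    (hlev : ∀ γ δ : Idx Y, γ < δ → γ.level ≤ δ.level) : Nonempty H.Tower := by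
  have step : ∀ (γ : Idx Y) (u : Idx Y → R), ∃ r, 0 < r ∧
      ∀ f ∈ acl ((fun μ => H.val μ (u μ)) '' Set.Iio γ), f ≠ 0 → r < H.norm f := by
    intro γ u
    obtain ⟨r, hr, h⟩ := H.exists_small
      ((acl ((fun μ => H.val μ (u μ)) '' Set.Iio γ) : Set Ω) \ {0}) (by simp) (by
        rw [← Cardinal.le_def]
        exact (Cardinal.mk_le_mk_of_subset Set.sdiff_subset).trans (mk_acl_image_le _ _))
    exact ⟨r, hr, fun f hf hf0 => h f ⟨hf, hf0⟩⟩
  choose r hr hrlt using step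
  classical
  -- The default `1` has no effect: the bound at `γ` involves only indices below `γ`.
  let u : Idx Y → R := wellFounded_lt.fix fun γ prev =>
    r γ fun μ => if h : μ < γ then prev μ h else 1
  have hu : ∀ γ, u γ = r γ fun μ => if μ < γ then u μ else 1 := fun γ => by
    have := wellFounded_lt.fix_eq (fun γ prev =>
      r γ fun μ => if h : μ < γ then prev μ h else 1) γ
    simpa using this
  refine ⟨⟨u, fun γ => ?_, fun γ f hf hf0 => ?_, hlev⟩⟩
  · rw [hu]; exact hr _ _
  · rw [hu]
    refine hrlt _ _ f ?_ hf0
    convert hf using 2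
    refine Set.image_congr fun μ hμ => ?_
    rw [if_pos (Set.mem_Iio.1 hμ)]

namespace Tower

variable {H} [LinearOrder (Idx Y)] (T : H.Tower)

/-- The algebraically independent generators. -/
def θ (γ : Idx Y) : Ω := H.val γ (T.u γ)

/-- A logarithm of a generator that is an exponential. -/
def arg (γ : Idx Y) : Ω := H.dir γ.sgn * H.ofReal (T.u γ)

/-- The stages of the construction. -/
noncomputable def F (n : ℕ) : Subfield Ω := acl (T.θ '' {γ | γ.level < n})

theorem θ_of_kind {γ : Idx Y} (h : γ.kind = true) : T.θ γ = H.exp (T.arg γ) := by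
  simp [θ, val, h, arg]

theorem θ_of_not_kind {γ : Idx Y} (h : γ.kind = false) : T.θ γ = (H.ofReal (T.u γ))⁻¹ := by
  simp [θ, val, h]

theorem ofReal_ne_zero (γ : Idx Y) : H.ofReal (T.u γ) ≠ 0 := (map_ne_zero _).2 (T.u_pos γ).ne'

theorem norm_ofReal_u (γ : Idx Y) : H.norm (H.ofReal (T.u γ)) = T.u γ := by
  rw [H.norm_ofReal, abs_of_pos (T.u_pos γ)]

theorem norm_arg (γ : Idx Y) : H.norm (T.arg γ) = T.u γ := by
  rw [arg, map_mul, H.norm_dir, one_mul, norm_ofReal_u]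

theorem arg_ne_zero (γ : Idx Y) : T.arg γ ≠ 0 := mul_ne_zero (H.dir_ne_zero _) (T.ofReal_ne_zero γ)

theorem arg_mem_part (γ : Idx Y) : T.arg γ ∈ H.part γ.sgn := H.dir_mul_mem_part _ (H.ofReal_mem_part _)

theorem arg_mem_small (γ : Idx Y) : T.arg γ ∈ H.small (acl (T.θ '' Set.Iio γ)) := fun f hf hf0 => by
  rw [norm_arg]
  exact T.u_lt γ f hf hf0

theorem norm_lt_inv (γ : Idx Y) {f : Ω} (hf : f ∈ acl (T.θ '' Set.Iio γ)) : H.norm f < (T.u γ)⁻¹ := by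
  by_cases h0 : f = 0
  · rw [h0, map_zero]; exact inv_pos.2 (T.u_pos γ)
  · have := T.u_lt γ f⁻¹ (inv_mem hf) (inv_ne_zero h0)
    rw [map_inv₀] at this
    exact (lt_inv_comm₀ (T.u_pos γ) ((H.norm_nonneg f).lt_of_ne' ((map_ne_zero H.norm).2 h0))).1 this

/-- The norm `1/u γ` exceeds twice the norm of every element algebraic over earlier generators and
twice every natural number. Allowing a bounded error is what later excludes these generators from
small elements. -/
theorem θ_notMem_sup_bounded {γ : Idx Y} (h : γ.kind = false) :
    T.θ γ ∉ aclSubmodule (T.θ '' Set.Iio γ) ⊔ H.bounded := by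
  intro hmem
  obtain ⟨a, ha, b, ⟨n, hn⟩, hab⟩ := Submodule.mem_sup.1 hmem
  have h1 : (T.u γ)⁻¹ ≤ H.norm a + H.norm b := by
    refine le_trans (le_of_eq ?_) (H.norm_add_le a b)
    rw [hab, T.θ_of_not_kind h, map_inv₀, norm_ofReal_u]
  have h2 := T.norm_lt_inv γ (mul_mem (natCast_mem _ 2) ha)
  have h3 := T.norm_lt_inv γ (mul_mem (natCast_mem _ 2) (natCast_mem _ n))
  rw [map_mul, H.norm_natCast] at h2 h3
  rw [H.norm_natCast] at h3
  push_cast at h2 h3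
  linarith

/-- Generators `1/u γ` are too large to be algebraic over the earlier ones; exponential generators
are too close to `1` without being equal to it. -/
theorem θ_notMem_Iio (γ : Idx Y) : T.θ γ ∉ acl (T.θ '' Set.Iio γ) := by
  intro hmem
  cases h : γ.kind
  · exact T.θ_notMem_sup_bounded h (Submodule.mem_sup_left hmem)
  · rw [T.θ_of_kind h] at hmem
    exact T.arg_ne_zero γ (H.eq_zero_of_exp_mem (T.arg_mem_small γ) hmem)

theorem θ_notMem (γ : Idx Y) : T.θ γ ∉ acl (T.θ '' {γ}ᶜ) :=
  notMem_acl_compl_of_notMem_Iio T.θ_notMem_Iio γ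

theorem subset_Iio (T : H.Tower) {γ : Idx Y} {n : ℕ} (h : n ≤ γ.level) : {μ : Idx Y | μ.level < n} ⊆ Set.Iio γ := by
  intro μ hμ
  rw [Set.mem_Iio]
  by_contra hle
  rw [not_lt] at hle
  rcases hle.lt_or_eq with h1 | rfl
  · exact absurd (T.le_level _ _ h1) (not_le.2 (lt_of_lt_of_le hμ h))
  · exact absurd hμ (not_lt.2 h)

theorem F_le_acl_Iio {γ : Idx Y} {n : ℕ} (h : n ≤ γ.level) : T.F n ≤ acl (T.θ '' Set.Iio γ) :=
  acl_mono (Set.image_mono (T.subset_Iio h))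

theorem θ_mem_F {γ : Idx Y} {n : ℕ} (h : γ.level < n) : T.θ γ ∈ T.F n :=
  subset_acl _ (Set.mem_image_of_mem T.θ h)

theorem F_mono : Monotone T.F := fun _ _ h =>
  acl_mono (Set.image_mono fun _ hγ => lt_of_lt_of_le hγ h)

theorem dir_mem_F (s : Bool) (n : ℕ) : H.dir s ∈ T.F n := H.dir_mem_acl s _

theorem arg_mem_small_F {γ : Idx Y} {n : ℕ} (h : n ≤ γ.level) : T.arg γ ∈ H.small (T.F n) :=
  H.small_anti (T.F_le_acl_Iio h) (T.arg_mem_small γ)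

theorem mk_F_le [Infinite Y] (n : ℕ) : #(T.F n) ≤ #Y := mk_acl_image_le _ _

theorem conj_θ_mem (γ : Idx Y) : H.conj (T.θ γ) ∈ acl {T.θ γ} := by
  have hself : T.θ γ ∈ acl {T.θ γ} := subset_acl _ rfl
  cases h : γ.kind
  · have : H.conj (T.θ γ) = T.θ γ := by
      rw [T.θ_of_not_kind h, map_inv₀, H.conj_ofReal]
    rwa [this]
  · have h1 := T.arg_mem_part γ
    rw [T.θ_of_kind h, H.conj_exp]
    rw [T.θ_of_kind h] at hself
    cases hs : γ.sgn
    · rw [hs, H.mem_part_false] at h1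
      rwa [h1]
    · rw [hs, H.mem_part_true] at h1
      rw [h1, H.exp_neg]
      exact inv_mem hself

theorem conj_mem_acl {S : Set (Idx Y)} {x : Ω} (hx : x ∈ acl (T.θ '' S)) :
    H.conj x ∈ acl (T.θ '' S) := by
  have h1 := (map_mem_acl_iff (H.conj : Ω →+* Ω)).2 hx
  refine acl_le ?_ h1
  rintro _ ⟨_, ⟨γ, hγ, rfl⟩, rfl⟩
  exact acl_mono (Set.singleton_subset_iff.2 (Set.mem_image_of_mem T.θ hγ)) (T.conj_θ_mem γ)

theorem linIndepMod_θ {ι : Type*} {g : ι → Idx Y} (hg : Function.Injective g) {n : ℕ}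
    (hk : ∀ i, (g i).kind = false) (hn : ∀ i, n ≤ (g i).level) :
    LinIndepMod (aclSubmodule (T.θ '' {γ | γ.level < n}) ⊔ H.bounded) (T.θ ∘ g) := by
  refine linIndepMod_of_triangular hg (fun γ => aclSubmodule (T.θ '' Set.Iio γ) ⊔ H.bounded)
    (fun i => sup_le_sup (T.F_le_acl_Iio (hn i)) le_rfl) (fun i => T.θ_notMem_sup_bounded (hk i))
    fun i j h => Submodule.mem_sup_left ?_
  exact mem_aclSubmodule.2 (subset_acl _ (Set.mem_image_of_mem T.θ (Set.mem_Iio.2 h)))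

/-- The elements whose exponential is in a stage. -/
noncomputable def logF (n : ℕ) : Submodule ℚ Ω := logSubmodule H.axE_expU (T.θ '' {γ | γ.level < n})

theorem mem_logF {n : ℕ} {x : Ω} : x ∈ T.logF n ↔ H.exp x ∈ T.F n := Iff.rfl

theorem linIndepMod_arg {ι : Type*} {g : ι → Idx Y} (hg : Function.Injective g) {n : ℕ}
    (hk : ∀ i, (g i).kind = true) (hn : ∀ i, n ≤ (g i).level) : LinIndepMod (T.logF n) (T.arg ∘ g) := by
  refine linIndepMod_of_triangular hg (fun γ => logSubmodule H.axE_expU (T.θ '' Set.Iio γ))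
    (fun i x hx => T.F_le_acl_Iio (hn i) hx) (fun i h => ?_) fun i j h => ?_
  · rw [Function.comp_apply, mem_logSubmodule, H.val_expU, ← T.θ_of_kind (hk i)] at h
    exact T.θ_notMem_Iio _ h
  · rw [Function.comp_apply, mem_logSubmodule, H.val_expU, ← T.θ_of_kind (hk i)]
    exact subset_acl _ (Set.mem_image_of_mem T.θ (Set.mem_Iio.2 h))

end Tower

end HyperComplex

end ExpField

/-! ### Bases of real elements and of real or imaginary logarithms -/

namespace ExpField

theorem LinIndepMod.linearIndependent {V ι : Type*} [AddCommGroup V] [Module ℚ V] {v : ι → V}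
    (h : LinIndepMod ⊥ v) : LinearIndependent ℚ v :=
  linearIndependent_iff.2 fun f hf => linIndepMod_iff.1 h f (by rw [hf]; exact zero_mem _)

/-- Combines real and imaginary families. As `X ≤ P'`, a relation modulo `X` has its `P`-component
in `P ⊓ P' = ⊥`. -/
theorem LinIndepMod.sumElim {V ι κ : Type*} [AddCommGroup V] [Module ℚ V] {P P' X : Submodule ℚ V}
    {v : ι → V} {w : κ → V} (hP : Disjoint P P') (hX : X ≤ P') (hv : LinearIndependent ℚ v)
    (hvP : ∀ i, v i ∈ P) (hw : LinIndepMod X w) (hwP : ∀ i, w i ∈ P') : LinIndepMod X (Sum.elim v w) := by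
  have hvs : Submodule.span ℚ (Set.range v) ≤ P := Submodule.span_le.2 (by rintro _ ⟨i, rfl⟩; exact hvP i)
  have hws : Submodule.span ℚ (Set.range w) ≤ P' := Submodule.span_le.2 (by rintro _ ⟨i, rfl⟩; exact hwP i)
  have hv' : LinIndepMod X v := linIndepMod_of_disjoint hv (hP.mono hvs hX)
  rw [LinIndepMod, Sum.comp_elim]
  refine LinearIndependent.sum_type hv' hw ?_
  rw [Set.range_comp, Set.range_comp, Submodule.span_image, Submodule.span_image, Submodule.disjoint_def]
  rintro _ ⟨a, ha, rfl⟩ ⟨b, hb, hab⟩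
  have h1 : b - a ∈ X := by
    rwa [← Submodule.Quotient.mk_eq_zero, Submodule.Quotient.mk_sub, sub_eq_zero]
  have h2 : a ∈ P' := by
    have := sub_mem (hws hb) (hX h1)
    rwa [sub_sub_cancel] at this
  rw [Submodule.disjoint_def.1 hP a (hvs ha) h2, map_zero]

universe u

namespace HyperComplex

variable {Y Ω R : Type u} [Field Ω] [CharZero Ω] [Field R] [LinearOrder R] [IsStrictOrderedRing R]
  {H : HyperComplex Y Ω R}

namespace Tower

variable [LinearOrder (Idx Y)] (T : H.Tower)

/-- The real parts of the stages. -/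
noncomputable def realStage : ℕ → Submodule ℚ Ω
  | 0 => ⊥
  | n + 1 => aclSubmodule (T.θ '' {γ | γ.level < n + 1}) ⊓ H.part false

theorem realStage_mono : Monotone T.realStage := monotone_nat_of_le_succ fun n => by
  cases n with
  | zero => exact bot_le
  | succ n => exact fun x hx => ⟨T.F_mono (Nat.le_succ _) hx.1, hx.2⟩

theorem realStage_le (n : ℕ) : T.realStage n ≤ aclSubmodule (T.θ '' {γ | γ.level < n}) := by
  cases n
  exacts [bot_le, inf_le_left]

theorem θ_mem_part {γ : Idx Y} (h : γ.kind = false) : T.θ γ ∈ H.part false := by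
  rw [H.mem_part_false, T.θ_of_not_kind h, map_inv₀, H.conj_ofReal]

/-- The infinite generators of positive level are completed by vectors `b n y` taken from the stage
just before the level `n + 1`. Complements adapted to smallness ensure that a real element small
relative to `F m` uses only `b p` with `p ≥ m`. -/
theorem exists_real_basis [Infinite Y] (s : Bool) : ∃ b : ℕ → Y → Ω,
    (∀ n y, b n y ∈ T.F (n + 1) ∧ b n y ∈ H.part false) ∧
    LinearIndependent ℚ (Sum.elim (fun p : ℕ × Y => T.θ ⟨p.1 + 1, false, s, false, p.2⟩)
      fun p : ℕ × Y => b p.1 p.2) ∧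
    (∀ n x, x ∈ T.F n → x ∈ H.part false → x ∈ Submodule.span ℚ (Set.range
      (Sum.elim (fun p : ℕ × Y => T.θ ⟨p.1 + 1, false, s, false, p.2⟩) fun p : ℕ × Y => b p.1 p.2))) ∧
    ∀ n m x, x ∈ T.F n → x ∈ H.part false → x ∈ H.small (T.F m) →
      x ∈ Submodule.span ℚ ((fun p : ℕ × Y => b p.1 p.2) '' {p | m ≤ p.1}) := by
  let w : ℕ → Bool → Y → Ω := fun n r y => T.θ ⟨n, false, s, r, y⟩
  -- Index `0` is the whole stage and index `m + 1` its elements small relative to `F m`; the latter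
  -- vanish once `m ≥ n + 1`, whence the bound `n + 2` below.
  let G : ℕ → ℕ → Submodule ℚ Ω := fun n m =>
    m.casesOn (T.realStage (n + 1)) fun m => H.small (T.F m) ⊓ T.realStage (n + 1)
  have hG0 : ∀ n, G n 0 = T.realStage (n + 1) := fun n => rfl
  have hG1 : ∀ n m, G n (m + 1) = H.small (T.F m) ⊓ T.realStage (n + 1) := fun n m => rfl
  have hsmall : ∀ n m, n ≤ m → H.small (T.F m) ⊓ T.realStage n = ⊥ := fun n m h => by
    rw [Submodule.eq_bot_iff]
    exact fun x hx => H.eq_zero_of_mem_small hx.1 (T.F_mono h (T.realStage_le n hx.2))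
  have hind : ∀ n, LinIndepMod (aclSubmodule (T.θ '' {γ | γ.level < n}) ⊔ H.bounded)
      fun p : Bool × Y => w n p.1 p.2 := fun n =>
    T.linIndepMod_θ (g := fun p : Bool × Y => ⟨n, false, s, p.1, p.2⟩)
      (fun p q h => by rw [Idx.ext_iff] at h; exact Prod.ext h.2.2.2.1 h.2.2.2.2)
      (fun _ => rfl) fun _ => le_rfl
  obtain ⟨b, hbX, had, hli, hspan⟩ := exists_filtered_basis T.realStage_mono w
    (fun n r y => ⟨T.θ_mem_F (Nat.lt_succ_self _), T.θ_mem_part rfl⟩)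
    (fun n => (hind n).mono ((T.realStage_le n).trans le_sup_left))
    G (fun n => antitone_nat_of_succ_le fun m => by
      cases m with
      | zero => exact inf_le_right
      | succ m => exact inf_le_inf_right _ (H.small_anti (T.F_mono (Nat.le_succ m)))) hG0
    (fun n => n + 2) (fun n m h => by
      obtain ⟨m, rfl⟩ := Nat.exists_eq_add_of_le' (Nat.le_of_add_left_le h : 1 ≤ m)
      rw [hG1]
      exact hsmall _ _ (by omega))
    (fun n D hD _ _ => by
      refine (rank_le_card ℚ D).trans (le_trans ?_ (T.mk_F_le (n + 1)))
      exact Cardinal.mk_le_mk_of_subset fun x hx => (hD hx).1)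
  refine ⟨b, fun n y => hbX n y, hli.linearIndependent, fun n x hx hx' => ?_, fun n => ?_⟩
  · have h1 := hspan (n + 1) (show x ∈ T.realStage (n + 1) from ⟨T.F_mono (Nat.le_succ n) hx, hx'⟩)
    rwa [show T.realStage 0 = ⊥ from rfl, bot_sup_eq] at h1
  · intro m x hx hx' hxm
    have key : ∀ n x, x ∈ T.realStage n → x ∈ H.small (T.F m) →
        x ∈ Submodule.span ℚ ((fun p : ℕ × Y => b p.1 p.2) '' {p | m ≤ p.1}) := by
      intro n
      induction n with
      | zero =>
        intro x hx _
        rw [show T.realStage 0 = ⊥ from rfl, Submodule.mem_bot] at hx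
        rw [hx]; exact zero_mem _
      | succ n ih =>
        intro x hx hxm
        rcases le_or_gt (n + 1) m with hnm | hnm
        · have : x ∈ H.small (T.F m) ⊓ T.realStage (n + 1) := ⟨hxm, hx⟩
          rw [hsmall _ _ hnm] at this
          rw [(Submodule.mem_bot ℚ).1 this]; exact zero_mem _
        have h1 := had n (m + 1) (show x ∈ G n (m + 1) from ⟨hxm, hx⟩)
        obtain ⟨y, ⟨⟨hym, hyn⟩, hyS⟩, z, hz, rfl⟩ := Submodule.mem_sup.1 h1
        refine add_mem (ih y ?_ hym) (Submodule.span_mono ?_ hz)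
        · cases n with
          | zero => exact hyS
          | succ n =>
            obtain ⟨c, hc, a, ha, rfl⟩ := Submodule.mem_sup.1 hyS
            -- The combination `a` of infinite generators equals a small, hence bounded, element
            -- minus one of the previous stage; independence modulo both kills it.
            have h2 : a ∈ aclSubmodule (T.θ '' {γ | γ.level < n + 1}) ⊔ H.bounded := by
              have h3 : c + a ∈ aclSubmodule (T.θ '' {γ | γ.level < n + 1}) ⊔ H.bounded :=
                Submodule.mem_sup_right (H.small_le_bounded _ hym)
              exact (Submodule.add_mem_iff_right _ (Submodule.mem_sup_left hc.1)).1 h3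
            have h4 := ((hind (n + 1)).comp (Prod.mk_right_injective false)).eq_zero ha h2
            rw [h4, add_zero]
            exact hc
        · rintro _ ⟨y, rfl⟩
          exact ⟨(n, y), Nat.lt_succ_iff.1 hnm, rfl⟩
    exact key (n + 1) x ⟨T.F_mono (Nat.le_succ n) hx, hx'⟩ hxm

/-- The real or imaginary logarithms of the stages, beginning with `Z`. -/
noncomputable def logStage (s : Bool) (Z : Submodule ℚ Ω) : ℕ → Submodule ℚ Ω
  | 0 => Z
  | n + 1 => T.logF (n + 1) ⊓ H.part s

theorem logF_mono : Monotone T.logF := fun _ _ h _ hx => T.F_mono h hx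

/-- The logarithms of a stage may outnumber `Y` because of nonstandard periods. Starting the
filtration at `Z` and keeping `P` in the complement of the first step leaves only a countable part
of the kernel, so each complement has rank at most `#Y`. -/
theorem exists_log_basis [Infinite Y] (s : Bool) {Z P : Submodule ℚ Ω} (hZ : Z ≤ T.logF 0 ⊓ H.part s)
    (hP : P ≤ T.logF 1 ⊓ H.part s) (hPZ : Disjoint P Z) (hker : ∀ x ∈ H.part s, H.exp x = 1 → x ∈ Z ⊔ P)
    (hPc : #P ≤ ℵ₀) : ∃ b : ℕ → Y → Ω,
    (∀ n y, H.exp (b n y) ∈ T.F (n + 1) ∧ b n y ∈ H.part s) ∧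
    LinIndepMod Z (Sum.elim (fun p : ℕ × Y => T.arg ⟨p.1 + 1, true, s, false, p.2⟩)
      fun p : ℕ × Y => b p.1 p.2) ∧
    (∀ n x, H.exp x ∈ T.F n → x ∈ H.part s → x ∈ Z ⊔ Submodule.span ℚ (Set.range
      (Sum.elim (fun p : ℕ × Y => T.arg ⟨p.1 + 1, true, s, false, p.2⟩) fun p : ℕ × Y => b p.1 p.2))) ∧
    P ≤ Submodule.span ℚ (Set.range
      (Sum.elim (fun p : ℕ × Y => T.arg ⟨p.1 + 1, true, s, false, p.2⟩) fun p : ℕ × Y => b p.1 p.2)) := by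
  let w : ℕ → Bool → Y → Ω := fun n r y => T.arg ⟨n, true, s, r, y⟩
  let X := T.logStage s Z
  have hX1 : ∀ n, X (n + 1) = T.logF (n + 1) ⊓ H.part s := fun n => rfl
  have hXm : Monotone X := monotone_nat_of_le_succ fun n => by
    cases n with
    | zero => exact hZ.trans (inf_le_inf_right _ (T.logF_mono (Nat.zero_le _)))
    | succ n => exact inf_le_inf_right _ (T.logF_mono (Nat.le_succ _))
  have hXl : ∀ n, X n ≤ T.logF n := fun n => by
    cases n
    exacts [hZ.trans inf_le_left, inf_le_left]
  -- Only the first step needs a finer filtration, which forces `P` into the span of `b 0`.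
  let G : ℕ → ℕ → Submodule ℚ Ω := fun n m => if m = 0 then X (n + 1) else if n = 0 ∧ m = 1 then P else ⊥
  have hG0 : ∀ n, G n 0 = X (n + 1) := fun n => if_pos rfl
  have hG01 : G 0 1 = P := by simp [G]
  have hGbot : ∀ n m, 2 ≤ m → G n m = ⊥ := fun n m h => by
    have h1 : m ≠ 0 := by omega
    have h2 : ¬ (n = 0 ∧ m = 1) := by omega
    simp only [G, if_neg h1, if_neg h2]
  have hPX : ∀ n, P ≤ X (n + 1) := fun n => hP.trans (hXm (Nat.succ_le_succ (Nat.zero_le n)) : X 1 ≤ X (n + 1))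
  obtain ⟨b, hbX, had, hli, hspan⟩ := exists_filtered_basis hXm w
    (fun n r y => ⟨by
      refine T.mem_logF.2 ?_
      rw [← T.θ_of_kind rfl]
      exact T.θ_mem_F (Nat.lt_succ_self _), T.arg_mem_part _⟩)
    (fun n => (T.linIndepMod_arg (g := fun p : Bool × Y => ⟨n, true, s, p.1, p.2⟩)
      (fun p q h => by rw [Idx.ext_iff] at h; exact Prod.ext h.2.2.2.1 h.2.2.2.2)
      (fun _ => rfl) fun _ => le_rfl).mono (hXl n))
    G (fun n => antitone_nat_of_succ_le fun m => by
      rcases m with _ | m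
      · rw [hG0]
        by_cases hn : n = 0
        · subst hn; rw [zero_add, hG01]; exact hPX 0
        · have : G n (0 + 1) = ⊥ := by simp [G, hn]
          rw [this]; exact bot_le
      · rw [hGbot n _ (by omega)]; exact bot_le) hG0 (fun _ => 2) (fun n m h => hGbot n m h)
    (fun n D hD hdis had => by
      have hDP : ∀ x ∈ D, H.exp x = 1 → x ∈ P := by
        intro x hx hx1
        have hxZP := hker x (hD hx).2 hx1
        cases n with
        | zero =>
          have hPD : P ≤ D := by
            have := had 1
            rw [hG01] at this
            refine this.trans (sup_le ?_ le_rfl)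
            rw [show stepSpan X w 0 = Z from rfl, hPZ.eq_bot]
            exact bot_le
          obtain ⟨z, hz, p, hp, rfl⟩ := Submodule.mem_sup.1 hxZP
          have hzD : z ∈ D := (Submodule.add_mem_iff_left _ (hPD hp)).1 hx
          rw [Submodule.disjoint_def.1 hdis z hzD hz, zero_add]
          exact hp
        | succ n =>
          have h1 : x ∈ stepSpan X w (n + 1) :=
            Submodule.mem_sup_left (sup_le (hXm (Nat.zero_le (n + 1)) : X 0 ≤ X (n + 1)) (hPX n) hxZP)
          rw [Submodule.disjoint_def.1 hdis x hx h1]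
          exact zero_mem _
      have hF : ∀ x : D, H.exp x ∈ T.F (n + 1) := fun x => (hD x.2).1
      -- With `c` choosing a logarithm in `D` of each exponential, `x` is recovered from `exp x` and
      -- `x - c (e x) ∈ P`. Thus `D` embeds in `T.F (n + 1) × P`.
      let e : D → T.F (n + 1) := fun x => ⟨H.exp x, hF x⟩
      let c : T.F (n + 1) → D := Function.invFun e
      have hc : ∀ x, e (c (e x)) = e x := fun x => Function.invFun_eq ⟨x, rfl⟩
      have hcP : ∀ x : D, (x - c (e x) : Ω) ∈ P := fun x => by
        refine hDP _ (sub_mem x.2 (c (e x)).2) ?_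
        have h1 : H.exp (c (e x)) = H.exp x := congrArg Subtype.val (hc x)
        rw [sub_eq_add_neg, H.exp_add, H.exp_neg, h1, mul_inv_cancel₀ (H.exp_ne_zero _)]
      have hinj : Function.Injective fun x : D => (e x, (⟨_, hcP x⟩ : P)) := by
        intro x y h
        obtain ⟨h1, h2⟩ := Prod.ext_iff.1 h
        have h3 : (x - c (e x) : Ω) = y - c (e y) := congrArg Subtype.val h2
        have h1' : e x = e y := h1
        rw [h1'] at h3
        exact Subtype.ext (sub_left_injective h3)
      refine (rank_le_card ℚ D).trans ((Cardinal.mk_le_of_injective hinj).trans ?_)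
      rw [Cardinal.mk_prod, Cardinal.lift_id, Cardinal.lift_id]
      refine (mul_le_mul' (T.mk_F_le (n + 1)) hPc).trans ?_
      rw [Cardinal.mul_aleph0_eq (Cardinal.aleph0_le_mk Y)])
  refine ⟨b, fun n y => hbX n y, hli, fun n x hx hx' => ?_, ?_⟩
  · exact hspan (n + 1) (show x ∈ X (n + 1) from ⟨T.F_mono (Nat.le_succ n) hx, hx'⟩)
  · have := had 0 1
    rw [hG01] at this
    refine this.trans (sup_le ?_ (Submodule.span_mono ?_))
    · rw [show stepSpan X w 0 = Z from rfl, hPZ.eq_bot]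
      exact bot_le
    · rintro _ ⟨y, rfl⟩
      exact ⟨Sum.inr (0, y), rfl⟩

end Tower

end HyperComplex

end ExpField

/-! ### Logarithms of roots of unity and the paired bases -/

namespace ExpField

universe u

namespace HyperComplex

variable {Y Ω R : Type u} [Field Ω] [CharZero Ω] [Field R] [LinearOrder R] [IsStrictOrderedRing R]

section Torsion

variable (H : HyperComplex Y Ω R)

theorem exp_natCast_mul (n : ℕ) (x : Ω) : H.exp (n * x) = H.exp x ^ n := by
  have := congrArg Units.val (H.axE_expU.map_nsmul n x)
  rwa [Units.val_pow_eq_pow_val] at this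

theorem exp_intCast_mul (n : ℤ) (x : Ω) : H.exp (n * x) = H.exp x ^ n := by
  have := congrArg Units.val (H.axE_expU.map_zsmul n x)
  rwa [Units.val_zpow_eq_zpow_val] at this

theorem mem_part_true_of_exp_eq_one {x : Ω} (hx : H.exp x = 1) : x ∈ H.part true := by
  have h1 : H.exp (x + H.conj x) = 1 := by rw [H.exp_add, ← H.conj_exp, hx, map_one, one_mul]
  have h2 := H.eq_zero_of_real _ (by rw [map_add, H.conj_conj, add_comm]) h1
  rw [H.mem_part_true]
  exact (neg_eq_of_add_eq_zero_right h2).symm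

/-- The logarithms of roots of unity. -/
def torsion : Submodule ℚ Ω where
  carrier := {x | x ∈ H.part true ∧ ∃ N : ℕ, N ≠ 0 ∧ H.exp (N * x) = 1}
  zero_mem' := ⟨zero_mem _, 1, one_ne_zero, by rw [mul_zero, H.exp_zero]⟩
  add_mem' := by
    rintro x y ⟨hx, n, hn, hxn⟩ ⟨hy, m, hm, hym⟩
    refine ⟨add_mem hx hy, n * m, mul_ne_zero hn hm, ?_⟩
    have : ((n * m : ℕ) : Ω) * (x + y) = m * (n * x) + n * (m * y) := by push_cast; ring
    rw [this, H.exp_add, H.exp_natCast_mul, hxn, H.exp_natCast_mul, hym, one_pow, one_pow, mul_one]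
  smul_mem' := by
    rintro q x ⟨hx, n, hn, hxn⟩
    refine ⟨Submodule.smul_mem _ _ hx, n * q.den, mul_ne_zero hn q.den_nz, ?_⟩
    have h1 : (q : Ω) * q.den = q.num := by exact_mod_cast Rat.mul_den_eq_num q
    have : ((n * q.den : ℕ) : Ω) * (q • x) = q.num * (n * x) := by
      rw [Rat.smul_def, ← h1]; push_cast; ring
    rw [this, H.exp_intCast_mul, hxn, one_zpow]

theorem period_mem_torsion : H.period ∈ H.torsion := by
  refine ⟨H.conj_period, 1, one_ne_zero, ?_⟩
  have := (H.exp_rat_mul_period 1).2 ⟨1, by norm_num⟩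
  simpa using this

theorem mem_torsion_of_exp_eq_one {x : Ω} (hx : H.exp x = 1) : x ∈ H.torsion :=
  ⟨H.mem_part_true_of_exp_eq_one hx, 1, one_ne_zero, by simpa using hx⟩

theorem exp_mem_acl_of_mem_torsion {x : Ω} (hx : x ∈ H.torsion) (S : Set Ω) : H.exp x ∈ acl S := by
  obtain ⟨-, N, hN, h⟩ := hx
  rw [H.exp_natCast_mul] at h
  exact mem_acl_of_pow_mem (Nat.pos_of_ne_zero hN) (h ▸ one_mem _)

/-- Roots of unity are standard: `exp (period / N)` is a primitive `N`-th root, and its powers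
exhaust the `N`-th roots of unity in a field. -/
theorem exists_exp_eq_of_mem_torsion {x : Ω} (hx : x ∈ H.torsion) :
    ∃ q : ℚ, H.exp x = H.exp (q * H.period) := by
  obtain ⟨-, N, hN, h⟩ := hx
  rw [H.exp_natCast_mul] at h
  have hpow : ∀ k : ℕ, H.exp (((1 / N : ℚ) : Ω) * H.period) ^ k = H.exp (((k / N : ℚ) : Ω) * H.period) := by
    intro k
    rw [← H.exp_natCast_mul]
    congr 1
    push_cast
    ring
  have hN' : (N : ℚ) ≠ 0 := by exact_mod_cast hN
  have hprim : IsPrimitiveRoot (H.exp (((1 / N : ℚ) : Ω) * H.period)) N := by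
    refine ⟨?_, fun k hk => ?_⟩
    · rw [hpow, H.exp_rat_mul_period]
      exact ⟨1, by rw [div_self hN']; norm_num⟩
    · rw [hpow, H.exp_rat_mul_period] at hk
      obtain ⟨m, hm⟩ := hk
      rw [div_eq_iff hN'] at hm
      have h1 : (k : ℤ) = m * N := by exact_mod_cast hm
      exact Int.natCast_dvd_natCast.1 ⟨m, by rw [h1, mul_comm]⟩
  have : NeZero N := ⟨hN⟩
  obtain ⟨i, -, hi⟩ := hprim.eq_pow_of_pow_eq_one h
  exact ⟨i / N, by rw [← hi, hpow]⟩

theorem exists_torsion_compl : ∃ Z ≤ H.torsion, Disjoint (Submodule.span ℚ {H.period}) Z ∧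
    H.torsion ≤ Z ⊔ Submodule.span ℚ {H.period} := by
  obtain ⟨C, hC⟩ := Submodule.exists_isCompl (Submodule.span ℚ {H.period})
  have hle : Submodule.span ℚ {H.period} ≤ H.torsion := by
    rw [Submodule.span_singleton_le_iff_mem]; exact H.period_mem_torsion
  refine ⟨C ⊓ H.torsion, inf_le_right, hC.disjoint.mono_right inf_le_left, ?_⟩
  rw [sup_comm, ← sup_inf_assoc_of_le C hle, hC.codisjoint.eq_top, top_inf_eq]

end Torsion

namespace Tower

variable {H : HyperComplex Y Ω R}

theorem I_inv_mul_mem_part {x : Ω} (hx : x ∈ H.part true) : H.I⁻¹ * x ∈ H.part false := by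
  rw [H.mem_part_true] at hx
  rw [H.mem_part_false, map_mul, map_inv₀, H.conj_I, hx, inv_neg, neg_mul_neg]

/-- The index set of the two bases. -/
abbrev Dir (Y : Type u) := ((ℕ × Y) ⊕ (ℕ × Y)) ⊕ ((ℕ × Y) ⊕ (ℕ × Y))

/-- The generator that belongs to a pair of basis vectors. -/
def rho : Dir Y → Idx Y :=
  Sum.elim
    (Sum.elim (fun p => ⟨p.1 + 1, false, false, false, p.2⟩) fun p => ⟨p.1 + 1, true, false, false, p.2⟩)
    (Sum.elim (fun p => ⟨p.1 + 1, false, true, false, p.2⟩) fun p => ⟨p.1 + 1, true, true, false, p.2⟩)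

theorem rho_injective : Function.Injective (rho : Dir Y → Idx Y) := by
  rintro ((⟨n, y⟩ | ⟨n, y⟩) | (⟨n, y⟩ | ⟨n, y⟩)) ((⟨m, z⟩ | ⟨m, z⟩) | (⟨m, z⟩ | ⟨m, z⟩)) h <;>
    simp_all [rho]

variable [LinearOrder (Idx Y)] (T : H.Tower)

theorem exists_mem_F {x : Ω} (hx : x ∈ acl (Set.range T.θ)) : ∃ n, x ∈ T.F n := by
  obtain ⟨t, ht, hf, hx⟩ := exists_finite_mem_acl hx
  have := hf.fintype
  choose g hg using fun a : t => ht a.2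
  refine ⟨Finset.univ.sup (fun a => (g a).level) + 1, acl_mono (fun a ha => ?_) hx⟩
  refine ⟨g ⟨a, ha⟩, ?_, hg ⟨a, ha⟩⟩
  exact Nat.lt_succ_of_le (Finset.le_sup (f := fun a => (g a).level) (Finset.mem_univ (⟨a, ha⟩ : t)))

theorem F_le_acl_range (n : ℕ) : T.F n ≤ acl (Set.range T.θ) := acl_mono (Set.image_subset_range _ _)

/-- A basis of the algebraic closure of the generators, and a family whose exponentials will be those
of the basis vectors. -/
theorem exists_dual_bases [Infinite Y] : ∃ (A M : Dir Y → Ω) (Z : Submodule ℚ Ω),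
    LinearIndependent ℚ A ∧
    (∀ n x, x ∈ T.F n → x ∈ Submodule.span ℚ (Set.range A)) ∧
    LinIndepMod Z M ∧
    (∀ n x, H.exp x ∈ T.F n → x ∈ Z ⊔ Submodule.span ℚ (Set.range M)) ∧
    Z ≤ H.torsion ∧ H.torsion ≤ Z ⊔ Submodule.span ℚ {H.period} ∧
    H.period ∈ Submodule.span ℚ (Set.range M) ∧
    (∀ d, ∃ s, A d ∈ H.part s ∧ M d ∈ H.part s) ∧
    (∀ d, ((∃ s, A d = H.dir s * T.θ (rho d)) ∧ H.exp (M d) ∈ acl (T.θ '' Set.Iio (rho d))) ∨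
      (H.exp (M d) = T.θ (rho d) ∧ A d ∈ acl (T.θ '' Set.Iio (rho d)))) ∧
    ∀ n m x, x ∈ T.F n → x ∈ H.small (T.F m) →
      x ∈ Submodule.span ℚ (A '' {d | M d ∈ H.small (T.F m)}) := by
  obtain ⟨Z, hZt, hZP, htZ⟩ := H.exists_torsion_compl
  choose b hb hbli hbspan hbsmall using T.exists_real_basis
  have htor : ∀ n, H.torsion ≤ T.logF n ⊓ H.part true := fun n x hx =>
    ⟨H.exp_mem_acl_of_mem_torsion hx _, hx.1⟩
  have hcount : #(Submodule.span ℚ {H.period}) ≤ ℵ₀ := by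
    have hs : Function.Surjective fun q : ℚ =>
        (⟨q • H.period, Submodule.mem_span_singleton.2 ⟨q, rfl⟩⟩ : Submodule.span ℚ {H.period}) := by
      rintro ⟨x, hx⟩
      obtain ⟨q, rfl⟩ := Submodule.mem_span_singleton.1 hx
      exact ⟨q, rfl⟩
    have := hs.countable
    exact Cardinal.mk_le_aleph0
  obtain ⟨c₀, hc₀, hc₀li, hc₀span, -⟩ := T.exists_log_basis false (Z := ⊥) (P := ⊥) bot_le bot_le
    disjoint_bot_left (fun x hx hx1 => by rw [H.eq_zero_of_real x hx hx1]; exact zero_mem _)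
    (by simp)
  obtain ⟨c₁, hc₁, hc₁li, hc₁span, hper⟩ := T.exists_log_basis true (Z := Z)
    (P := Submodule.span ℚ {H.period}) (hZt.trans (htor 0))
    (by rw [Submodule.span_singleton_le_iff_mem]; exact htor 1 H.period_mem_torsion)
    hZP (fun x _ hx1 => htZ (H.mem_torsion_of_exp_eq_one hx1)) hcount
  set A₀ : Bool → (ℕ × Y) ⊕ (ℕ × Y) → Ω := fun s =>
    Sum.elim (fun p : ℕ × Y => T.θ ⟨p.1 + 1, false, s, false, p.2⟩) fun p : ℕ × Y => b s p.1 p.2 with hA₀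
  set M₀ := Sum.elim (fun p : ℕ × Y => T.arg ⟨p.1 + 1, true, false, false, p.2⟩)
    fun p : ℕ × Y => c₀ p.1 p.2 with hM₀
  set M₁ := Sum.elim (fun p : ℕ × Y => T.arg ⟨p.1 + 1, true, true, false, p.2⟩)
    fun p : ℕ × Y => c₁ p.1 p.2 with hM₁
  let μ : Ω →ₗ[ℚ] Ω := LinearMap.mulLeft ℚ H.I
  have hμ : ∀ x, μ x = H.I * x := fun _ => rfl
  have hμI : ∀ x, μ (H.I⁻¹ * x) = x := fun x => by rw [hμ, mul_inv_cancel_left₀ H.I_ne_zero]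
  have hμk : LinearMap.ker μ = ⊥ := by
    rw [LinearMap.ker_eq_bot']
    exact fun x hx => (mul_eq_zero.1 hx).resolve_left H.I_ne_zero
  have hA₀p : ∀ s d, A₀ s d ∈ H.part false := by
    rintro s (p | p)
    exacts [T.θ_mem_part rfl, (hb s _ _).2]
  have hM₀p : ∀ d, M₀ d ∈ H.part false := by
    rintro (p | p)
    exacts [T.arg_mem_part _, (hc₀ _ _).2]
  have hM₁p : ∀ d, M₁ d ∈ H.part true := by
    rintro (p | p)
    exacts [T.arg_mem_part _, (hc₁ _ _).2]
  have hμp : ∀ x ∈ H.part false, μ x ∈ H.part true := fun x hx => H.dir_mul_mem_part true hx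
  have hsw : Function.Surjective (Sum.swap : (ℕ × Y) ⊕ (ℕ × Y) → _) :=
    (Equiv.sumComm (ℕ × Y) (ℕ × Y)).surjective
  have hswap₀ : Submodule.span ℚ (Set.range (M₀ ∘ Sum.swap)) = Submodule.span ℚ (Set.range M₀) := by
    rw [hsw.range_comp]
  have hswap₁ : Submodule.span ℚ (Set.range (M₁ ∘ Sum.swap)) = Submodule.span ℚ (Set.range M₁) := by
    rw [hsw.range_comp]
  have hswapi : Function.Injective (Sum.swap : (ℕ × Y) ⊕ (ℕ × Y) → _) :=
    (Equiv.sumComm (ℕ × Y) (ℕ × Y)).injective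
  have hIF : ∀ n, H.I⁻¹ ∈ T.F n := fun n => inv_mem (T.dir_mem_F true n)
  -- The swap crosses the pairing: an infinite generator is matched with a complementary logarithm,
  -- and a complementary element with the infinitesimal logarithm of an exponential generator. In
  -- both cases the complementary partner comes from an earlier stage.
  refine ⟨Sum.elim (A₀ false) (μ ∘ A₀ true), Sum.elim (M₀ ∘ Sum.swap) (M₁ ∘ Sum.swap), Z,
    ?_, ?_, ?_, ?_, hZt, htZ, ?_, ?_, ?_, ?_⟩
  · refine (LinIndepMod.sumElim H.disjoint_part bot_le (hbli false) (hA₀p false) ?_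
      fun d => hμp _ (hA₀p true d)).linearIndependent
    exact linIndepMod_of_disjoint ((hbli true).map' μ hμk) disjoint_bot_right
  · intro n x hx
    obtain ⟨k, hk⟩ := T.exists_mem_F (T.F_le_acl_range n hx)
    have hc : ∀ s, H.comp s x ∈ T.F n := H.comp_mem_of_conj_mem hx (T.conj_mem_acl hx)
    rw [← H.comp_add_comp x, Set.Sum.elim_range, Submodule.span_union]
    refine add_mem (Submodule.mem_sup_left (hbspan false n _ (hc false) (H.comp_mem_part false x))) ?_
    refine Submodule.mem_sup_right ?_
    have h1 := hbspan true n _ (mul_mem (hIF n) (hc true)) (I_inv_mul_mem_part (H.comp_mem_part true x))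
    have h2 := Submodule.mem_map_of_mem (f := μ) h1
    rwa [hμI, Submodule.map_span, ← Set.range_comp] at h2
  · exact LinIndepMod.sumElim H.disjoint_part (hZt.trans fun x hx => hx.1)
      (hc₀li.linearIndependent.comp _ hswapi) (fun d => hM₀p _) (hc₁li.comp hswapi) (fun d => hM₁p _)
  · intro n x hx
    have hx' : H.exp (H.conj x) ∈ T.F n := by rw [← H.conj_exp]; exact T.conj_mem_acl hx
    have hc : ∀ s, H.comp s x ∈ T.logF n := fun s => by
      have h1 : H.comp s x = ((1 : ℚ) / 2) • (x + if s then -H.conj x else H.conj x) := by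
        rw [comp, Rat.smul_def]; push_cast; ring
      rw [h1]
      refine Submodule.smul_mem _ _ (add_mem (T.mem_logF.2 hx) ?_)
      cases s
      exacts [T.mem_logF.2 hx', neg_mem (T.mem_logF.2 hx')]
    rw [← H.comp_add_comp x, Set.Sum.elim_range, Submodule.span_union, hswap₀, hswap₁]
    refine add_mem ?_ ?_
    · have h1 := hc₀span n _ (hc false) (H.comp_mem_part false x)
      rw [bot_sup_eq] at h1
      exact Submodule.mem_sup_right (Submodule.mem_sup_left h1)
    · exact (sup_le_sup le_rfl le_sup_right : Z ⊔ _ ≤ _) (hc₁span n _ (hc true) (H.comp_mem_part true x))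
  · rw [Set.Sum.elim_range, Submodule.span_union, hswap₁]
    exact Submodule.mem_sup_right (hper (Submodule.mem_span_singleton_self _))
  · rintro (d | d)
    exacts [⟨false, hA₀p false d, hM₀p _⟩, ⟨true, hμp _ (hA₀p true d), hM₁p _⟩]
  · rintro ((p | p) | (p | p))
    · exact Or.inl ⟨⟨false, (one_mul _).symm⟩, T.F_le_acl_Iio (γ := ⟨p.1 + 1, _, _, _, _⟩) le_rfl (hc₀ _ _).1⟩
    · exact Or.inr ⟨(T.θ_of_kind rfl).symm,
        T.F_le_acl_Iio (γ := ⟨p.1 + 1, _, _, _, _⟩) le_rfl (hb false _ _).1⟩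
    · exact Or.inl ⟨⟨true, rfl⟩, T.F_le_acl_Iio (γ := ⟨p.1 + 1, _, _, _, _⟩) le_rfl (hc₁ _ _).1⟩
    · exact Or.inr ⟨(T.θ_of_kind rfl).symm, mul_mem (H.I_mem_acl _)
        (T.F_le_acl_Iio (γ := ⟨p.1 + 1, _, _, _, _⟩) le_rfl (hb true _ _).1)⟩
  · intro n m x hx hxm
    have hc : ∀ s, H.comp s x ∈ T.F n := H.comp_mem_of_conj_mem hx (T.conj_mem_acl hx)
    rw [← H.comp_add_comp x]
    refine add_mem ?_ ?_
    · refine Submodule.span_mono ?_ (hbsmall false n m _ (hc false) (H.comp_mem_part false x)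
        (H.comp_mem_small hxm false))
      rintro _ ⟨p, hp, rfl⟩
      exact ⟨Sum.inl (Sum.inr p), T.arg_mem_small_F (Nat.le_succ_of_le hp), rfl⟩
    · have h1 := hbsmall true n m _ (mul_mem (hIF n) (hc true))
        (I_inv_mul_mem_part (H.comp_mem_part true x)) (H.mul_mem_small (hIF m) (H.comp_mem_small hxm true))
      have h2 := Submodule.mem_map_of_mem (f := μ) h1
      rw [hμI, Submodule.map_span] at h2
      refine Submodule.span_mono ?_ h2
      rintro _ ⟨_, ⟨p, hp, rfl⟩, rfl⟩
      exact ⟨Sum.inr (Sum.inr p), T.arg_mem_small_F (Nat.le_succ_of_le hp), rfl⟩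

end Tower

end HyperComplex

end ExpField

/-! ### Transport of the construction to `K` -/

namespace ExpField

universe u

theorem algebraicIndependent_of_notMem_acl {Ω Λ : Type*} [Field Ω] {θ : Λ → Ω}
    (h : ∀ γ, θ γ ∉ acl (θ '' {γ}ᶜ)) : AlgebraicIndependent (⊥ : Subfield Ω) θ := by
  have hinj : Function.Injective θ := fun γ δ hγδ => by
    by_contra hne
    exact h γ (subset_acl _ ⟨δ, Ne.symm hne, hγδ.symm⟩)
  have h1 : (AlgebraicIndependent.matroid (⊥ : Subfield Ω) Ω).Indep (Set.range θ) := by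
    rw [Matroid.indep_iff_forall_notMem_closure_sdiff]
    rintro _ ⟨γ, rfl⟩ hγ
    rw [matroid_bot_closure_eq] at hγ
    refine h γ (acl_mono ?_ hγ)
    rintro _ ⟨⟨δ, rfl⟩, hδ⟩
    exact ⟨δ, fun hne => hδ (congrArg θ hne), rfl⟩
  exact AlgebraicIndependent.of_subtype_range hinj h1

theorem mem_range_of_mem_acl_range {K Ω : Type u} [Field K] [Field Ω] [IsAlgClosed K] (j : K →+* Ω)
    {y : Ω} (hy : y ∈ acl (Set.range j)) : ∃ x, j x = y := by
  have : IsAlgClosed j.fieldRange := IsAlgClosed.of_ringEquiv K _ (RingEquiv.ofBijective (S := j.fieldRange)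
    j.rangeRestrictField ⟨j.rangeRestrictField.injective, fun ⟨_, x, hx⟩ => ⟨x, Subtype.ext hx⟩⟩)
  rw [← RingHom.coe_fieldRange, ← SetLike.mem_coe, SetLike.mem_coe, ← isAlgebraic_iff_mem_acl] at hy
  obtain ⟨⟨_, x, rfl⟩, hx⟩ := hy.isIntegral.mem_range_algebraMap_of_minpoly_splits
    (K := j.fieldRange) (IsAlgClosed.splits _)
  exact ⟨x, hx⟩

/-- An algebraically closed field with a transcendence basis of the same size embeds onto the
algebraic closure of an algebraically independent family. -/
theorem exists_ringHom_range_eq_acl {K Ω : Type u} {Λ : Type*} [Field K] [CharZero K] [IsAlgClosed K] [Field Ω]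
    [CharZero Ω] [IsAlgClosed Ω] {X : Λ → K} (hX : IsTranscendenceBasis ℚ X) {θ : Λ → Ω}
    (h : ∀ γ, θ γ ∉ acl (θ '' {γ}ᶜ)) :
    ∃ j : K →+* Ω, ∀ y, (∃ x, j x = y) ↔ y ∈ acl (Set.range θ) := by
  obtain ⟨τ, -, hτ⟩ := exists_algHom_of_isTranscendenceBasis hX
    ((algebraicIndependent_of_notMem_acl h).restrictScalars (algebraMap ℚ (⊥ : Subfield Ω)).injective)
  have hr : Set.range θ = (τ : K →+* Ω) '' Set.range X := by
    rw [← Set.range_comp]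
    exact congrArg Set.range (funext fun i => (hτ i).symm)
  refine ⟨τ, fun y => ⟨?_, fun hy => mem_range_of_mem_acl_range (τ : K →+* Ω) (acl_mono ?_ hy)⟩⟩
  · rintro ⟨x, rfl⟩
    rw [hr, map_mem_acl_iff]
    exact mem_acl_of_isAlgebraic_adjoin_rat (hX.isAlgebraic.isAlgebraic x)
  · rw [hr]
    exact Set.image_subset_range _ _

namespace HyperComplex

variable {K Ω R : Type u} [Field K] [CharZero K] [Field Ω] [CharZero Ω] [Field R] [LinearOrder R]
  [IsStrictOrderedRing R] {H : HyperComplex K Ω R} [LinearOrder (Idx K)]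

/-- A copy of `K` in `Ω`, with a linear map to logarithms of the exponential function of `K`. -/
structure ExpModel (T : H.Tower) where
  j : K →+* Ω
  mem_range : ∀ y, (∃ x, j x = y) ↔ y ∈ acl (Set.range T.θ)
  b : Module.Basis (Tower.Dir K) ℚ K
  φ : K →ₗ[ℚ] Ω
  Z : Submodule ℚ Ω
  eq_zero_of_mem : ∀ x, φ x ∈ Z → x = 0
  exists_eq : ∀ y, H.exp y ∈ acl (Set.range T.θ) → ∃ z ∈ Z, ∃ x, y = z + φ x
  Z_le : Z ≤ H.torsion
  torsion_le : H.torsion ≤ Z ⊔ Submodule.span ℚ {H.period}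
  ω : K
  φ_ω : φ ω = H.period
  part : ∀ d, ∃ s, j (b d) ∈ H.part s ∧ φ (b d) ∈ H.part s
  pair : ∀ d, ((∃ s, j (b d) = H.dir s * T.θ (Tower.rho d)) ∧
      H.exp (φ (b d)) ∈ acl (T.θ '' Set.Iio (Tower.rho d))) ∨
    (H.exp (φ (b d)) = T.θ (Tower.rho d) ∧ j (b d) ∈ acl (T.θ '' Set.Iio (Tower.rho d)))
  small : ∀ n x, j x ∈ H.small (T.F n) → φ x ∈ H.small (T.F n)

/-- Matching a transcendence basis of `K` with the generators embeds `K` onto their algebraic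
closure; `φ` is defined by sending the basis that corresponds to `A` to the family `M`. -/
theorem Tower.nonempty_expModel [IsAlgClosed K] [IsAlgClosed Ω] (T : H.Tower) {X : K → K}
    (hX : IsTranscendenceBasis ℚ X) : Nonempty (ExpModel T) := by
  obtain ⟨e⟩ := Cardinal.eq.1 (mk_idx K)
  obtain ⟨j, hj⟩ := exists_ringHom_range_eq_acl (hX.comp_equiv e) T.θ_notMem
  obtain ⟨A, M, Z, hA, hspan, hM, hexp, hZt, htZ, hper, hpart, hpair, hsmall⟩ := T.exists_dual_bases
  let J : K →ₗ[ℚ] Ω := j.toRatAlgHom.toLinearMap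
  have hJ : ∀ x, J x = j x := fun _ => rfl
  have hrho : ∀ d, T.θ (rho d) ∈ acl (Set.range T.θ) := fun d => subset_acl _ (Set.mem_range_self _)
  have hIio : ∀ d, acl (T.θ '' Set.Iio (rho d)) ≤ acl (Set.range T.θ) := fun d =>
    acl_mono (Set.image_subset_range _ _)
  have hA' : ∀ d, A d ∈ acl (Set.range T.θ) := fun d => by
    rcases hpair d with ⟨⟨s, hs⟩, -⟩ | ⟨-, hs⟩
    · rw [hs]
      exact mul_mem (H.dir_mem_acl s _) (hrho d)
    · exact hIio d hs
  choose a ha using fun d => (hj (A d)).2 (hA' d)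
  have hli : LinearIndependent ℚ a := LinearIndependent.of_comp J (by
    convert hA using 1
    exact funext ha)
  have himage : ∀ s : Set (Dir K), ∀ x, j x ∈ Submodule.span ℚ (A '' s) → x ∈ Submodule.span ℚ (a '' s) := by
    intro s x hx
    have h1 : A '' s = J '' (a '' s) := by
      rw [← Set.image_comp]
      exact Set.image_congr fun d _ => (ha d).symm
    rw [h1, Submodule.span_image] at hx
    obtain ⟨x', hx', hxx⟩ := hx
    rwa [← j.injective hxx]
  have hsp : ⊤ ≤ Submodule.span ℚ (Set.range a) := fun x _ => by
    obtain ⟨n, hn⟩ := T.exists_mem_F ((hj _).1 ⟨x, rfl⟩)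
    rw [← Set.image_univ]
    exact himage _ _ (by rw [Set.image_univ]; exact hspan n _ hn)
  let b := Module.Basis.mk hli hsp
  have hb : ∀ d, b d = a d := fun d => Module.Basis.mk_apply hli hsp d
  let φ : K →ₗ[ℚ] Ω := b.constr ℚ M
  have hφ : ∀ d, φ (b d) = M d := fun d => b.constr_basis ℚ M d
  have hrange : LinearMap.range φ = Submodule.span ℚ (Set.range M) := b.constr_range ℚ
  obtain ⟨ω, hω⟩ : H.period ∈ LinearMap.range φ := by rwa [hrange]
  refine ⟨⟨j, hj, b, φ, Z, fun x hx => ?_, fun y hy => ?_, hZt, htZ, ω, hω, fun d => ?_, fun d => ?_,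
    fun n x hx => ?_⟩⟩
  · have h1 : φ x = Finsupp.linearCombination ℚ M (b.repr x) := b.constr_apply ..
    rw [h1] at hx
    exact b.repr.map_eq_zero_iff.1 (linIndepMod_iff.1 hM _ hx)
  · obtain ⟨n, hn⟩ := T.exists_mem_F hy
    obtain ⟨z, hz, v, hv, rfl⟩ := Submodule.mem_sup.1 (hexp n y hn)
    rw [← hrange] at hv
    obtain ⟨x, rfl⟩ := hv
    exact ⟨z, hz, x, rfl⟩
  · rw [hφ, hb, ha]
    exact hpart d
  · rw [hφ, hb, ha]
    exact hpair d
  · obtain ⟨m, hm⟩ := T.exists_mem_F ((hj _).1 ⟨x, rfl⟩)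
    have h1 := himage _ _ (hsmall m n _ hm hx)
    have h2 : Submodule.span ℚ (a '' {d | M d ∈ H.small (T.F n)}) ≤ (H.small (T.F n)).comap φ := by
      rw [Submodule.span_le]
      rintro _ ⟨d, hd, rfl⟩
      rw [SetLike.mem_coe, Submodule.mem_comap, ← hb, hφ]
      exact hd
    exact h2 h1

end HyperComplex

end ExpField

/-! ### The exponential and the involution on `K` -/

namespace ExpField

universe u

namespace HyperComplex

variable {K Ω R : Type u} [Field K] [CharZero K] [Field Ω] [CharZero Ω] [Field R] [LinearOrder R]
  [IsStrictOrderedRing R] {H : HyperComplex K Ω R} [LinearOrder (Idx K)]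

namespace ExpModel

variable {T : H.Tower} (M : ExpModel T)

theorem j_mem_acl (x : K) : M.j x ∈ acl (Set.range T.θ) := (M.mem_range _).1 ⟨x, rfl⟩

theorem exp_φ_mem (x : K) : H.exp (M.φ x) ∈ acl (Set.range T.θ) := by
  have h1 : Submodule.span ℚ (Set.range M.b) ≤ (logSubmodule H.axE_expU (Set.range T.θ)).comap M.φ := by
    rw [Submodule.span_le]
    rintro _ ⟨d, rfl⟩
    change H.exp (M.φ (M.b d)) ∈ acl (Set.range T.θ)
    rcases M.pair d with ⟨-, h⟩ | ⟨h, -⟩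
    · exact acl_mono (Set.image_subset_range _ _) h
    · rw [h]
      exact subset_acl _ (Set.mem_range_self _)
  exact h1 (M.b.mem_span x)

theorem exists_j_eq (x : K) : ∃ y : Kˣ, M.j y = H.exp (M.φ x) := by
  obtain ⟨y, hy⟩ := (M.mem_range _).2 (M.exp_φ_mem x)
  exact ⟨Units.mk0 y fun h => H.exp_ne_zero (M.φ x) (by rw [← hy, h, map_zero]), hy⟩

/-- The exponential function. -/
noncomputable def E (x : K) : Kˣ := (M.exists_j_eq x).choose

theorem j_E (x : K) : M.j (M.E x) = H.exp (M.φ x) := (M.exists_j_eq x).choose_spec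

theorem axE : AxE M.E := fun x y => Units.ext <| M.j.injective <| by
  rw [Units.val_mul, map_mul, j_E, j_E, j_E, map_add, H.exp_add]

theorem E_eq_one_iff {x : K} : M.E x = 1 ↔ H.exp (M.φ x) = 1 := by
  rw [← j_E, ← M.j.map_one, M.j.injective.eq_iff, Units.val_eq_one]

theorem φ_rat_smul_ω (q : ℚ) : M.φ (q • M.ω) = q * H.period := by
  rw [map_smul, M.φ_ω, Rat.smul_def]

/-- A logarithm in `Ω` has the form `z + φ x` with `z ∈ Z`. As `exp z` is a root of unity, `z` may
be replaced by a rational multiple of the period, which is in the range of `φ`. -/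
theorem axLOG : AxLOG M.E := fun y => by
  obtain ⟨v, hv⟩ := H.exp_surj (M.j y) ((map_ne_zero M.j).2 y.ne_zero)
  obtain ⟨z, hz, x, rfl⟩ := M.exists_eq v (hv ▸ M.j_mem_acl y)
  obtain ⟨q, hq⟩ := H.exists_exp_eq_of_mem_torsion (M.Z_le hz)
  refine ⟨q • M.ω + x, Units.ext <| M.j.injective ?_⟩
  rw [j_E, ← hv, map_add, H.exp_add, H.exp_add, φ_rat_smul_ω, hq]

/-- If `exp (φ x) = 1`, then `φ x` is torsion, hence a rational multiple `q` of the period modulo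
`Z`. Independence modulo `Z` gives `x = q • ω`, and `q` must be an integer. -/
theorem axSTD : AxSTD M.E := by
  refine ⟨M.ω, fun h => H.period_ne_zero (by rw [← M.φ_ω, h, map_zero]), Set.ext fun x => ?_⟩
  rw [Set.mem_ofPred_eq, Set.mem_ofPred_eq, E_eq_one_iff]
  constructor
  · intro hx
    obtain ⟨z, hz, w, hw, hzw⟩ := Submodule.mem_sup.1 (M.torsion_le (H.mem_torsion_of_exp_eq_one hx))
    obtain ⟨q, rfl⟩ := Submodule.mem_span_singleton.1 hw
    have h1 : x - q • M.ω = 0 := M.eq_zero_of_mem _ (by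
      rwa [map_sub, φ_rat_smul_ω, ← hzw, Rat.smul_def, add_sub_cancel_right])
    rw [sub_eq_zero] at h1
    rw [h1, φ_rat_smul_ω] at hx
    obtain ⟨m, rfl⟩ := (H.exp_rat_mul_period q).1 hx
    exact ⟨m, by rw [h1, Rat.smul_def, Rat.cast_intCast, mul_comm]⟩
  · rintro ⟨m, rfl⟩
    have h1 : M.ω * m = (m : ℚ) • M.ω := by rw [Rat.smul_def, Rat.cast_intCast, mul_comm]
    rw [h1, φ_rat_smul_ω]
    exact (H.exp_rat_mul_period m).2 ⟨m, rfl⟩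

theorem countable_ker : {x | M.E x = 1}.Countable := by
  obtain ⟨ω, -, h⟩ := M.axSTD
  rw [h]
  exact (Set.countable_range fun m : ℤ => ω * m).mono (by rintro _ ⟨m, rfl⟩; exact ⟨m, rfl⟩)

theorem exists_conj (x : K) : ∃ y, M.j y = H.conj (M.j x) := by
  rw [M.mem_range, ← Set.image_univ]
  exact T.conj_mem_acl (by rw [Set.image_univ]; exact M.j_mem_acl x)

/-- The restriction of the conjugation of `Ω` to `K`. -/
noncomputable def σ : K ≃+* K where
  toFun x := (M.exists_conj x).choose
  invFun x := (M.exists_conj x).choose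
  left_inv x := M.j.injective <| by
    rw [(M.exists_conj _).choose_spec, (M.exists_conj x).choose_spec, H.conj_conj]
  right_inv x := M.j.injective <| by
    rw [(M.exists_conj _).choose_spec, (M.exists_conj x).choose_spec, H.conj_conj]
  map_add' x y := M.j.injective <| by
    rw [(M.exists_conj _).choose_spec, map_add, map_add, map_add, (M.exists_conj x).choose_spec,
      (M.exists_conj y).choose_spec]
  map_mul' x y := M.j.injective <| by
    rw [(M.exists_conj _).choose_spec, map_mul, map_mul, map_mul, (M.exists_conj x).choose_spec,
      (M.exists_conj y).choose_spec]

theorem j_σ (x : K) : M.j (M.σ x) = H.conj (M.j x) := (M.exists_conj x).choose_spec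

theorem σ_σ (x : K) : M.σ (M.σ x) = x := M.σ.left_inv x

theorem exists_j_eq_I : ∃ i, M.j i = H.I := (M.mem_range _).2 (H.I_mem_acl _)

theorem isInvolution_σ : IsInvolution M.σ := by
  refine orderOf_eq_prime (RingEquiv.ext fun x => ?_) fun h => ?_
  · rw [pow_two]
    exact M.σ_σ x
  · obtain ⟨i, hi⟩ := M.exists_j_eq_I
    have h1 := M.j_σ i
    rw [h, hi, H.conj_I] at h1
    exact H.I_ne_zero (self_eq_neg.1 (hi.symm.trans h1))

/-- On each basis vector the two conjugations act by the same sign. -/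
theorem φ_σ (x : K) : M.φ (M.σ x) = H.conj (M.φ x) := by
  have h1 : M.φ ∘ₗ (M.σ : K →+* K).toRatAlgHom.toLinearMap =
      (H.conj : Ω →+* Ω).toRatAlgHom.toLinearMap ∘ₗ M.φ := M.b.ext fun d => by
    change M.φ (M.σ (M.b d)) = H.conj (M.φ (M.b d))
    obtain ⟨s, hs, hs'⟩ := M.part d
    cases s
    · rw [mem_part_false, ← j_σ, M.j.injective.eq_iff] at hs
      rw [hs, H.mem_part_false.1 hs']
    · rw [mem_part_true, ← j_σ, ← map_neg, M.j.injective.eq_iff] at hs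
      rw [hs, map_neg, H.mem_part_true.1 hs']
  exact LinearMap.congr_fun h1 x

theorem σ_E (x : K) : M.σ (M.E x : K) = (M.E (M.σ x) : K) := M.j.injective <| by
  rw [j_σ, j_E, j_E, φ_σ, H.conj_exp]

theorem exists_j_eq_θ (γ : Idx K) : ∃ x, M.j x = T.θ γ :=
  (M.mem_range _).2 (subset_acl _ (Set.mem_range_self _))

theorem exists_triangularExp : ∃ S : TriangularExp K (Idx K) (Tower.Dir K),
    S.E = M.E ∧ ∀ x, x ∈ acl (Set.range S.θ) := by
  choose t ht using M.exists_j_eq_θ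
  have himage : ∀ S : Set (Idx K), T.θ '' S = M.j '' (t '' S) := fun S => by
    rw [← Set.image_comp]
    exact Set.image_congr fun γ _ => (ht γ).symm
  refine ⟨⟨M.E, M.axE, t, fun γ => ?_, M.b, Tower.rho, Tower.rho_injective, fun d => ?_⟩, rfl, fun x => ?_⟩
  · rw [← map_mem_acl_iff M.j, ← himage, ht]
    exact T.θ_notMem γ
  · rcases M.pair d with ⟨⟨s, hs⟩, h⟩ | ⟨h, h'⟩
    · left
      rw [← map_mem_acl_iff M.j, ← map_mem_acl_iff M.j, ← map_mem_acl_iff M.j (S := t '' _),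
        Set.image_singleton, Set.image_singleton, ← himage, j_E, ht]
      refine ⟨?_, ?_, h⟩
      · have h1 : T.θ (Tower.rho d) = (H.dir s)⁻¹ * M.j (M.b d) := by
          rw [hs, inv_mul_cancel_left₀ (H.dir_ne_zero s)]
        rw [h1]
        exact mul_mem (inv_mem (H.dir_mem_acl s _)) (subset_acl _ rfl)
      · rw [hs]
        exact mul_mem (H.dir_mem_acl s _) (subset_acl _ rfl)
    · right
      have h1 : (M.E (M.b d) : K) = t (Tower.rho d) := M.j.injective (by rw [j_E, ht, h])
      rw [h1, ← map_mem_acl_iff M.j (S := t '' _), ← himage]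
      exact ⟨subset_acl _ rfl, subset_acl _ rfl, h'⟩
  · change x ∈ acl (Set.range t)
    rw [← map_mem_acl_iff M.j, ← Set.image_univ, ← himage, Set.image_univ]
    exact M.j_mem_acl x

theorem axSP : AxSP M.E := by
  obtain ⟨S, hS, -⟩ := M.exists_triangularExp
  rw [← hS]
  exact S.axSP

theorem axCCP [IsAlgClosed K] : AxCCP M.E := by
  obtain ⟨S, hS, hθ⟩ := M.exists_triangularExp
  have hker := M.countable_ker
  rw [← hS] at hker ⊢
  -- Infinitely many independent generators provide the infinite transcendence degree needed for
  -- generic points.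
  obtain ⟨f⟩ : Nonempty (ℕ ↪ Idx K) := by
    have h1 : Function.Injective fun n : ℕ => (⟨n, true, true, true, 0⟩ : Idx K) := fun m n h =>
      congrArg Idx.level h
    exact ⟨⟨_, h1⟩⟩
  exact S.axCCP ⟨S.θ ∘ f, (algebraicIndependent_of_notMem_acl S.notMem_acl).comp f f.injective⟩ hθ hker

end ExpModel

end HyperComplex

end ExpField

/-! ### The topology of the involution and continuity -/

namespace ExpField

universe u

namespace HyperComplex

variable {K Ω R : Type u} [Field K] [CharZero K] [Field Ω] [CharZero Ω] [Field R] [LinearOrder R]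
  [IsStrictOrderedRing R] {H : HyperComplex K Ω R} [LinearOrder (Idx K)]

namespace ExpModel

variable {T : H.Tower} (M : ExpModel T)

theorem σ_coe (x : fixedField M.σ) : M.σ x = x := x.2

theorem exists_ofReal_eq (x : fixedField M.σ) : ∃ r, H.ofReal r = M.j x :=
  H.exists_ofReal _ (by rw [← j_σ, σ_coe])

theorem exists_fixedField_eq {x : K} {r : R} (h : M.j x = H.ofReal r) : ∃ y : fixedField M.σ, (y : K) = x :=
  ⟨⟨x, M.j.injective (by
    change M.j (M.σ x) = M.j x
    rw [j_σ, h, H.conj_ofReal])⟩, rfl⟩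

/-- Square roots of positive hyperreals exist in `R`, and the copy of `K` contains them by algebraic
closedness. -/
theorem fixedLT_iff {x y : fixedField M.σ} :
    fixedLT M.σ x y ↔ ∃ r, 0 < r ∧ H.ofReal r = M.j y - M.j x := by
  constructor
  · rintro ⟨t, ht, h⟩
    obtain ⟨s, hs⟩ := M.exists_ofReal_eq t
    have hs0 : s ≠ 0 := by
      rintro rfl
      rw [map_zero, eq_comm, map_eq_zero, ZeroMemClass.coe_eq_zero] at hs
      exact ht hs
    refine ⟨s ^ 2, by positivity, ?_⟩
    rw [map_pow, hs, ← map_sub, ← map_pow]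
    exact congrArg (fun z : fixedField M.σ => M.j z) h.symm
  · rintro ⟨r, hr, h⟩
    obtain ⟨s, rfl⟩ := H.exists_mul_self r hr.le
    have h1 : H.ofReal s ^ 2 ∈ acl (Set.range T.θ) := by
      rw [pow_two, ← map_mul, h]
      exact sub_mem (M.j_mem_acl _) (M.j_mem_acl _)
    obtain ⟨t, ht⟩ := (M.mem_range _).2 (mem_acl_of_pow_mem two_pos h1)
    obtain ⟨t, rfl⟩ := M.exists_fixedField_eq ht
    refine ⟨t, ?_, Subtype.ext (M.j.injective ?_)⟩
    · rintro rfl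
      rw [ZeroMemClass.coe_zero, map_zero, eq_comm, map_eq_zero] at ht
      simp [ht] at hr
    · change M.j (y - x) = M.j (t ^ 2)
      rw [map_pow, ht, map_sub, ← h, map_mul, pow_two]

/-- The distance from a point to the end of a ray lies in some stage `F n`, so elements small
relative to `F n` cannot cross it. Conversely, `1/θ γ = u γ` with `γ` of level `n` comes from `K`,
and the interval of this radius consists of small differences. -/
theorem isOpen_fixedTopology_iff {s : Set (fixedField M.σ)} :
    IsOpen[fixedTopology M.σ] s ↔
      ∀ x ∈ s, ∃ n, ∀ y : fixedField M.σ, M.j y - M.j x ∈ H.small (T.F n) → y ∈ s := by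
  constructor
  · intro hs
    induction hs with
    | basic s hs =>
      obtain ⟨a, rfl | rfl⟩ := hs <;> intro x hx <;> rw [Set.mem_ofPred_eq, fixedLT_iff] at hx <;>
        obtain ⟨r, hr, hxa⟩ := hx <;>
        obtain ⟨n, hn⟩ := T.exists_mem_F (sub_mem (M.j_mem_acl _) (M.j_mem_acl _) :
          M.j _ - M.j _ ∈ acl (Set.range T.θ)) <;>
        rw [← hxa] at hn <;>
        refine ⟨n, fun y hy => ?_⟩ <;>
        obtain ⟨e, he⟩ := M.exists_ofReal_eq (y - x) <;>
        have he' : H.ofReal e = M.j y - M.j x := he.trans (map_sub M.j _ _) <;>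
        have hlt := H.mem_small.1 hy _ hn ((map_ne_zero _).2 hr.ne') <;>
        rw [← he', H.norm_ofReal, H.norm_ofReal, abs_of_pos hr, abs_lt] at hlt <;>
        rw [Set.mem_ofPred_eq, fixedLT_iff]
      · exact ⟨r + e, by linarith, by rw [map_add, hxa, he']; ring⟩
      · exact ⟨r - e, by linarith, by rw [map_sub, hxa, he']; ring⟩
    | univ => exact fun x _ => ⟨0, fun y _ => trivial⟩
    | inter s t _ _ ihs iht =>
      intro x hx
      obtain ⟨m, hm⟩ := ihs x hx.1
      obtain ⟨n, hn⟩ := iht x hx.2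
      exact ⟨max m n, fun y hy => ⟨hm y (H.small_anti (T.F_mono (le_max_left m n)) hy),
        hn y (H.small_anti (T.F_mono (le_max_right m n)) hy)⟩⟩
    | sUnion S _ ih =>
      rintro x ⟨s, hs, hx⟩
      obtain ⟨n, hn⟩ := ih s hs x hx
      exact ⟨n, fun y hy => ⟨s, hs, hn y hy⟩⟩
  · intro h
    let := fixedTopology M.σ
    refine isOpen_iff_forall_mem_open.2 fun x hx => ?_
    obtain ⟨n, hn⟩ := h x hx
    let γ : Idx K := ⟨n, false, false, false, 0⟩
    obtain ⟨d, hd⟩ : ∃ d, M.j d = H.ofReal (T.u γ) := by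
      obtain ⟨t, ht⟩ := M.exists_j_eq_θ γ
      exact ⟨t⁻¹, by rw [map_inv₀, ht, T.θ_of_not_kind rfl, inv_inv]⟩
    obtain ⟨d, rfl⟩ := M.exists_fixedField_eq hd
    have hu := T.u_pos γ
    have hsmall : H.ofReal (T.u γ) ∈ H.small (T.F n) :=
      H.mem_small_of_norm_le (T.arg_mem_small_F (γ := γ) le_rfl) (by rw [T.norm_arg, T.norm_ofReal_u])
    refine ⟨{y | fixedLT M.σ (x - d) y} ∩ {y | fixedLT M.σ y (x + d)}, fun y hy => hn y ?_, ?_, ?_⟩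
    · obtain ⟨h1, h2⟩ := hy
      rw [Set.mem_ofPred_eq, fixedLT_iff] at h1 h2
      obtain ⟨r, hr, h1⟩ := h1
      obtain ⟨r', hr', h2⟩ := h2
      rw [Subfield.coe_sub, map_sub, hd] at h1
      rw [Subfield.coe_add, map_add, hd] at h2
      have h3 : M.j y - M.j x = H.ofReal (r - T.u γ) := by rw [map_sub, h1]; ring
      have h4 : r - T.u γ = T.u γ - r' := H.ofReal.injective (by rw [← h3, map_sub, h2]; ring)
      refine H.mem_small_of_norm_le hsmall ?_
      rw [h3, H.norm_ofReal, T.norm_ofReal_u, abs_le]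
      constructor <;> linarith
    · exact TopologicalSpace.GenerateOpen.inter _ _ (.basic _ ⟨x - d, Or.inl rfl⟩)
        (.basic _ ⟨x + d, Or.inr rfl⟩)
    · constructor <;> rw [Set.mem_ofPred_eq, fixedLT_iff] <;> refine ⟨T.u γ, hu, ?_⟩
      · rw [Subfield.coe_sub, map_sub, hd]; ring
      · rw [Subfield.coe_add, map_add, hd]; ring

theorem j_eq_or {i : K} (hi : i ^ 2 = -1) : M.j i = H.I ∨ M.j i = -H.I := by
  rw [← sq_eq_sq_iff_eq_or_eq_neg, ← map_pow, hi, map_neg, map_one, pow_two, H.I_mul_I]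

theorem conj_j_I {i : K} (hi : i ^ 2 = -1) : H.conj (M.j i) = -M.j i := by
  rcases M.j_eq_or hi with h | h <;> rw [h]
  · exact H.conj_I
  · rw [map_neg, H.conj_I]

theorem j_I_mem_F {i : K} (hi : i ^ 2 = -1) (n : ℕ) : M.j i ∈ T.F n := by
  rcases M.j_eq_or hi with h | h <;> rw [h]
  · exact H.I_mem_acl _
  · exact neg_mem (H.I_mem_acl _)

/-- Smallness passes to real and imaginary components, so the product topology has the same
description by stages. -/
theorem exists_decomp {i : K} (hi : i ^ 2 = -1) (z : K) : ∃ a c : fixedField M.σ, z = a + i * c ∧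
    ∀ n, M.j z ∈ H.small (T.F n) → M.j a ∈ H.small (T.F n) ∧ M.j c ∈ H.small (T.F n) := by
  have hi0 : i ≠ 0 := by rintro rfl; simp at hi
  have hσi : M.σ i = -i := M.j.injective (by rw [j_σ, M.conj_j_I hi, map_neg])
  refine ⟨⟨(z + M.σ z) / 2, ?_⟩, ⟨(z - M.σ z) / (2 * i), ?_⟩, ?_, fun n hz => ⟨?_, ?_⟩⟩
  · change M.σ ((z + M.σ z) / 2) = (z + M.σ z) / 2
    rw [map_div₀, map_add, σ_σ, map_ofNat, add_comm]
  · change M.σ ((z - M.σ z) / (2 * i)) = (z - M.σ z) / (2 * i)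
    rw [map_div₀, map_sub, σ_σ, map_mul, map_ofNat, hσi]
    field_simp
    ring
  · change z = (z + M.σ z) / 2 + i * ((z - M.σ z) / (2 * i))
    field_simp
    ring
  · have h1 : M.j ((z + M.σ z) / 2) = H.comp false (M.j z) := by
      simp [comp, j_σ, map_ofNat]
    change M.j ((z + M.σ z) / 2) ∈ _
    rw [h1]
    exact H.comp_mem_small hz _
  · have h1 : M.j ((z - M.σ z) / (2 * i)) = (M.j i)⁻¹ * H.comp true (M.j z) := by
      simp [comp, j_σ, map_ofNat]
      ring
    change M.j ((z - M.σ z) / (2 * i)) ∈ _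
    rw [h1]
    exact H.mul_mem_small (inv_mem (M.j_I_mem_F hi n)) (H.comp_mem_small hz _)

theorem isOpen_involutionTopology_iff {i : K} (hi : i ^ 2 = -1)
    {s : Set K} :
    IsOpen[involutionTopology M.σ i] s ↔
      ∀ x ∈ s, ∃ n, ∀ y, M.j y - M.j x ∈ H.small (T.F n) → y ∈ s := by
  let := fixedTopology M.σ
  rw [isOpen_coinduced, isOpen_prod_iff]
  constructor
  · intro h x hx
    obtain ⟨a, c, rfl, -⟩ := M.exists_decomp hi x
    obtain ⟨A, C, hA, hC, ha, hc, hAC⟩ := h a c hx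
    obtain ⟨m, hm⟩ := M.isOpen_fixedTopology_iff.1 hA a ha
    obtain ⟨n, hn⟩ := M.isOpen_fixedTopology_iff.1 hC c hc
    refine ⟨max m n, fun y hy => ?_⟩
    obtain ⟨a', c', hy', hsmall⟩ := M.exists_decomp hi (y - (a + i * c))
    rw [← map_sub] at hy
    obtain ⟨ha', hc'⟩ := hsmall _ hy
    have h1 : (a + a', c + c') ∈ A ×ˢ C := by
      refine ⟨hm _ ?_, hn _ ?_⟩
      · rw [Subfield.coe_add, map_add, add_sub_cancel_left]
        exact H.small_anti (T.F_mono (le_max_left m n)) ha'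
      · rw [Subfield.coe_add, map_add, add_sub_cancel_left]
        exact H.small_anti (T.F_mono (le_max_right m n)) hc'
    have h2 : y = ((a + a' : fixedField M.σ) : K) + i * ((c + c' : fixedField M.σ) : K) := by
      rw [Subfield.coe_add, Subfield.coe_add]
      linear_combination hy'
    rw [h2]
    exact hAC h1
  · intro h a c hac
    obtain ⟨n, hn⟩ := h _ hac
    have hopen : ∀ a : fixedField M.σ, IsOpen {y : fixedField M.σ | M.j y - M.j a ∈ H.small (T.F n)} := by
      intro a
      refine M.isOpen_fixedTopology_iff.2 fun x hx => ⟨n, fun y hy => ?_⟩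
      rw [Set.mem_ofPred_eq] at hx ⊢
      simpa using add_mem hy hx
    refine ⟨_, _, hopen a, hopen c, ?_, ?_, ?_⟩
    · rw [Set.mem_ofPred_eq, sub_self]; exact zero_mem _
    · rw [Set.mem_ofPred_eq, sub_self]; exact zero_mem _
    · rintro ⟨a', c'⟩ ⟨ha', hc'⟩
      refine hn _ ?_
      have h1 : M.j (a' + i * c') - M.j (a + i * c) =
          (M.j a' - M.j a) + M.j i * (M.j c' - M.j c) := by
        simp only [map_add, map_mul]
        ring
      change M.j (a' + i * c') - M.j (a + i * c) ∈ _
      rw [h1]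
      exact add_mem ha' (H.mul_mem_small (M.j_I_mem_F hi n) hc')

/-- `E y - E x = E x (exp (φ (y - x)) - 1)`. For `y - x` small relative to a stage containing `E x`
and the target stage, the second factor is small and multiplication by `E x` keeps it so. -/
theorem continuous_E {i : K} (hi : i ^ 2 = -1) :
    Continuous[involutionTopology M.σ i, involutionTopology M.σ i]
    (fun x : K => (M.E x : K)) := by
  refine (@continuous_def _ _ (involutionTopology M.σ i) (involutionTopology M.σ i) _).2 fun s hs => ?_
  rw [M.isOpen_involutionTopology_iff hi] at hs ⊢
  intro x hx
  obtain ⟨m, hm⟩ := hs _ hx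
  obtain ⟨n, hn⟩ := T.exists_mem_F (M.j_mem_acl (M.E x))
  refine ⟨max m n, fun y hy => hm _ ?_⟩
  rw [← map_sub] at hy
  have h1 : M.j (M.E y) - M.j (M.E x) = M.j (M.E x) * (H.exp (M.φ (y - x)) - 1) := by
    rw [mul_sub, mul_one, j_E, j_E, ← H.exp_add, ← map_add, add_sub_cancel]
  rw [h1]
  exact H.small_anti (T.F_mono (le_max_left m n)) (H.mul_mem_small
    (T.F_mono (le_max_right m n) hn) (H.exp_sub_one_mem_small (M.small _ _ hy)))

end ExpModel

end HyperComplex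

end ExpField

theorem theorem13p3 (K : Type*) [Field K] [IsAlgClosed K] [CharZero K]
    (hK : IsSaturatedField K) :
    ∃ (E : K → Kˣ) (σ : K ≃+* K),
      ExpField.IsInvolution σ ∧ (∀ x : K, σ (E x : K) = (E (σ x) : K)) ∧
      ExpField.AxE E ∧ ExpField.AxLOG E ∧ ExpField.AxSTD E ∧ ExpField.AxSP E ∧
      ExpField.AxCCP E ∧
      ∀ i : K, i ^ 2 = -1 →
        Continuous[ExpField.involutionTopology σ i, ExpField.involutionTopology σ i]
          (fun x : K => (E x : K)) := by
  obtain ⟨X, hX⟩ := ExpField.exists_isTranscendenceBasis_of_isSaturated hK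
  let φ : Ultrafilter (Finset K) := Ultrafilter.of Filter.atTop
  let H := ExpField.hyperComplex K φ (Ultrafilter.of_le _)
  have := ExpField.isAlgClosed_germ φ (k := ℂ)
  obtain ⟨_, _, hlev⟩ := ExpField.exists_linearOrder_idx K
  obtain ⟨T⟩ := H.nonempty_tower hlev
  obtain ⟨M⟩ := T.nonempty_expModel hX
  exact ⟨M.E, M.σ, M.isInvolution_σ, M.σ_E, M.axE, M.axLOG, M.axSTD, M.axSP, M.axCCP,
    fun i hi => M.continuous_E hi⟩
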